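/- Let $k$ be a field. Throughout, $\mathcal C$ is an abelian $k$-linear monoidal category with unit object $I$, finite-dimensional Hom spaces, $k$-bilinear tensor product, in which every object $Y$ has a dual $Y^\vee$ with $\mathrm{coev}_Y:I\to Y\otimes Y^\vee$ and $\mathrm{ev}_Y:Y^\vee\otimes Y\to I$. Let $\mathcal C\boxtimes\mathcal C$ be the category obtained by adjoining finite direct sums and direct summands to the category whose objects are the pairs $X\boxtimes Y$, with $\mathrm{Hom}(X\boxtimes Y,X'\boxtimes Y')=\mathcal C(X,X')\otimes_k\mathcal C(Y,Y')$ (for the categories below this is their Deligne product), let $T:\mathcal C\boxtimes\mathcal C\to\mathcal C$ be the $k$-linear functor with $T(X\boxtimes Y)=X\otimes Y$, and let $(X\boxtimes I)\otimes-$ be the $k$-linear endofunctor $A\boxtimes B\mapsto (X\otimes A)\boxtimes B$. Call $\mathcal C$ *pure ribbon* (resp. *pure spherical*) if $\mathrm{End}(I)=k$ and $\mathcal C$ has a ribbon (resp. spherical pivotal) structure for which the pairings $\mathcal C(X,Y)\otimes\mathcal C(Y,X)\to k$, $f\otimes g\mapsto\mathrm{tr}(fg)$, are non-degenerate. **(1)**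 Let $\mathcal C$ be pure ribbon or pure spherical. If $\mathcal C$ has finitely many isomorphism classes of simple objects, then the coend $\tilde R=\int^{Y}Y^\vee\boxtimes Y$ exists in $\mathcal C\boxtimes\mathcal C$. Whenever $\tilde R$ exists, with coprojections $\pi_Y:Y^\vee\boxtimes Y\to\tilde R$, then for every $X\in\mathcal C$ the object $R(X)=(X\boxtimes I)\otimes\tilde R$ with the coprojections $(X\boxtimes I)\otimes\pi_Y$ is the coend $$R(X)=(X\boxtimes I)\otimes\tilde R=\int^Y(X\otimes Y^\vee)\boxtimes Y,$$ and the functor $R:\mathcal C\to\mathcal C\boxtimes\mathcal C$ is right adjoint to $T$, with an adjunction whose counit $TR(X)\to X$ is the morphism given on $T((X\otimes Y^\vee)\boxtimes Y)=X\otimes Y^\vee\otimes Y$ by $X\otimes\mathrm{ev}_Y$. **(2)** Let moreover $\mathcal C$ be braided, with braiding $c$, and modular: semisimple, with finitely many isomorphism classes of simple objects, $\mathrm{End}(I)=k$, admitting a ribbon structure, and non-degenerate, i.e. the functor $G:\mathcal C\boxtimes\mathcal C\to\mathcal Z(\mathcal C)$, $X\boxtimes Y\mapsto\iota_+(X)\otimes\iota_-(Y)$,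 is an equivalence. Here $\mathcal Z(\mathcal C)$ is the monoidal centre, whose objects are pairs $(Z,z)$ with half-braiding $z_U:Z\otimes U\to U\otimes Z$ and whose braiding is $c_{(Z,z),(W,w)}=z_W$, and $\iota_+(X)=(X,c_{X,-})$, $\iota_-(X)=(X,c_{-,X}^{-1})$. Then $\tilde R$ exists; denote its image under $G$ again by $\tilde R$. There is a unique morphism $\varepsilon:\tilde R\to I$ in $\mathcal C$ which on each $Y^\vee\boxtimes Y$ is $\mathrm{ev}_Y:Y^\vee\otimes Y\to I$, and there is a unique algebra structure on $\tilde R$ in $\mathcal Z(\mathcal C)$ for which $\varepsilon$ is a homomorphism of algebras in $\mathcal C$. For every algebra $A$ in $\mathcal C$ make $\iota_+(A)\otimes\tilde R$ an algebra in $\mathcal Z(\mathcal C)$, with multiplication $$\iota_+(A)\otimes\tilde R\otimes\iota_+(A)\otimes\tilde R\xrightarrow{\;1\otimes c^{-1}_{\iota_+(A),\tilde R}\otimes1\;}\iota_+(A)\otimes\iota_+(A)\otimes\tilde R\otimes\tilde R\xrightarrow{\;\mu\otimes\mu\;}\iota_+(A)\otimes\tilde R .$$ Then the left centre $C_l(\iota_+(A)\otimes\tilde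 R)$ exists and is the full centre of $A$: $$Z(A)=C_l(\iota_+(A)\otimes\tilde R),$$ with structure morphism the composite $\zeta:C_l(\iota_+(A)\otimes\tilde R)\xrightarrow{\;l\;}\iota_+(A)\otimes\tilde R\xrightarrow{\;A\otimes\varepsilon\;}A$; moreover it carries a commutative algebra structure in $\mathcal Z(\mathcal C)$ for which $l$ is a homomorphism of algebras in $\mathcal Z(\mathcal C)$ and $\zeta$ is one in $\mathcal C$. (The left centre of an algebra $B$ in a braided category is the terminal object among morphisms $y:Y\to B$ with $\mu(y\otimes B)=\mu(B\otimes y)c_{Y,B}$. The full centre of an algebra $A$ in $\mathcal C$ is the terminal object among pairs of $(Z,z)\in\mathcal Z(\mathcal C)$ and $\zeta:Z\to A$ in $\mathcal C$ with $\mu(\zeta\otimes A)=\mu(A\otimes\zeta)z_A$.) -/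

import Mathlib

open CategoryTheory MonoidalCategory Limits Opposite
open scoped TensorProduct

universe w v u

noncomputable section

namespace CentreOfAlgebra

/-- Objects of the `k`-linear tensor product `C ⊗ C` of `k`-linear categories: pairs of objects. -/
structure LinProd (k : Type w) (C : Type u) where
  fst : C
  snd : C

namespace LinProd

variable {k : Type w} [Field k] {C : Type u} [Category.{v} C] [Preadditive C] [Linear k C]

/-- Morphisms `(X, Y) ⟶ (X', Y')` of `C ⊗ C` are the elements of `C(X, X') ⊗ C(Y, Y')`. -/
@[ext]
structure Hom (X Y : LinProd k C) where
  val : (X.fst ⟶ Y.fst) ⊗[k] (X.snd ⟶ Y.snd)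

/-- Composition is determined by `(f ⊗ g) ≫ (f' ⊗ g') = (f ≫ f') ⊗ (g ≫ g')`. -/
instance : CategoryStruct (LinProd k C) where
  Hom X Y := Hom X Y
  id X := ⟨𝟙 X.fst ⊗ₜ[k] 𝟙 X.snd⟩
  comp {X Y Z} f g :=
    ⟨TensorProduct.map₂ (Linear.comp X.fst Y.fst Z.fst) (Linear.comp X.snd Y.snd Z.snd) f.val g.val⟩

/-- The pure tensor `f ⊗ g` as a morphism of `C ⊗ C`. -/
def tmul {A A' B B' : C} (f : A ⟶ A') (g : B ⟶ B') : (⟨A, B⟩ : LinProd k C) ⟶ ⟨A', B'⟩ :=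
  ⟨f ⊗ₜ[k] g⟩

instance (X Y : LinProd k C) : Zero (X ⟶ Y) := ⟨⟨0⟩⟩
instance (X Y : LinProd k C) : Add (X ⟶ Y) := ⟨fun f g => ⟨f.val + g.val⟩⟩
instance (X Y : LinProd k C) : Neg (X ⟶ Y) := ⟨fun f => ⟨-f.val⟩⟩
instance (X Y : LinProd k C) : Sub (X ⟶ Y) := ⟨fun f g => ⟨f.val - g.val⟩⟩
instance (X Y : LinProd k C) : SMul ℕ (X ⟶ Y) := ⟨fun n f => ⟨n • f.val⟩⟩
instance (X Y : LinProd k C) : SMul ℤ (X ⟶ Y) := ⟨fun n f => ⟨n • f.val⟩⟩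
instance (X Y : LinProd k C) : SMul k (X ⟶ Y) := ⟨fun a f => ⟨a • f.val⟩⟩

theorem val_injective (X Y : LinProd k C) :
    Function.Injective (fun f : X ⟶ Y => (f.val : (X.fst ⟶ Y.fst) ⊗[k] (X.snd ⟶ Y.snd))) :=
  fun _ _ h => Hom.ext h

instance (X Y : LinProd k C) : AddCommGroup (X ⟶ Y) :=
  (val_injective X Y).addCommGroup _ rfl (fun _ _ => rfl) (fun _ => rfl) (fun _ _ => rfl)
    (fun _ _ => rfl) (fun _ _ => rfl)

instance (X Y : LinProd k C) : Module k (X ⟶ Y) :=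
  (val_injective X Y).module k
    { toFun := fun f : X ⟶ Y => f.val, map_zero' := rfl, map_add' := fun _ _ => rfl }
    (fun _ _ => rfl)

@[ext]
theorem hom_ext {X Y : LinProd k C} {f g : X ⟶ Y} (h : f.val = g.val) : f = g := Hom.ext h

@[simp] theorem zero_val (X Y : LinProd k C) : (0 : X ⟶ Y).val = 0 := rfl
@[simp] theorem add_val {X Y : LinProd k C} (f g : X ⟶ Y) : (f + g).val = f.val + g.val := rfl
@[simp] theorem smul_val {X Y : LinProd k C} (a : k) (f : X ⟶ Y) : (a • f).val = a • f.val := rfl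
@[simp] theorem tmul_val {A A' B B' : C} (f : A ⟶ A') (g : B ⟶ B') :
    (tmul f g : (⟨A, B⟩ : LinProd k C) ⟶ ⟨A', B'⟩).val = f ⊗ₜ[k] g := rfl
@[simp] theorem comp_val {X Y Z : LinProd k C} (f : X ⟶ Y) (g : Y ⟶ Z) : (f ≫ g).val =
    TensorProduct.map₂ (Linear.comp X.fst Y.fst Z.fst) (Linear.comp X.snd Y.snd Z.snd)
      f.val g.val := rfl
theorem id_def (X : LinProd k C) : 𝟙 X = tmul (𝟙 X.fst) (𝟙 X.snd) := rfl

theorem tmul_comp_tmul {A A' A'' B B' B'' : C} (f : A ⟶ A') (g : B ⟶ B')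
    (f' : A' ⟶ A'') (g' : B' ⟶ B'') :
    (tmul f g : (⟨A, B⟩ : LinProd k C) ⟶ _) ≫ tmul f' g' = tmul (f ≫ f') (g ≫ g') := rfl

theorem add_comp' {X Y Z : LinProd k C} (f f' : X ⟶ Y) (g : Y ⟶ Z) :
    (f + f') ≫ g = f ≫ g + f' ≫ g := by
  ext; simp

theorem comp_add' {X Y Z : LinProd k C} (f : X ⟶ Y) (g g' : Y ⟶ Z) :
    f ≫ (g + g') = f ≫ g + f ≫ g' := by
  ext; simp

theorem zero_comp' {X Y Z : LinProd k C} (g : Y ⟶ Z) : (0 : X ⟶ Y) ≫ g = 0 := by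
  ext; simp

theorem comp_zero' {X Y Z : LinProd k C} (f : X ⟶ Y) : f ≫ (0 : Y ⟶ Z) = 0 := by
  ext; simp

theorem hom_induction {X Y : LinProd k C} {P : (X ⟶ Y) → Prop} (h0 : P 0)
    (ht : ∀ (f : X.fst ⟶ Y.fst) (g : X.snd ⟶ Y.snd), P (tmul f g)) (ha : ∀ a b, P a → P b → P (a + b))
    (a : X ⟶ Y) : P a := by
  obtain ⟨a⟩ := a
  induction a using TensorProduct.induction_on with
  | zero => exact h0
  | tmul f g => exact ht f g
  | add a b ha' hb' => exact ha _ _ ha' hb'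

instance : Category (LinProd k C) where
  id_comp f := by
    induction f using hom_induction with
    | h0 => exact comp_zero' _
    | ht f g => rw [id_def, tmul_comp_tmul, Category.id_comp, Category.id_comp]
    | ha a b ha hb => rw [comp_add', ha, hb]
  comp_id f := by
    induction f using hom_induction with
    | h0 => exact zero_comp' _
    | ht f g => rw [id_def, tmul_comp_tmul, Category.comp_id, Category.comp_id]
    | ha a b ha hb => rw [add_comp', ha, hb]
  assoc f g h := by
    induction f using hom_induction with
    | h0 => simp only [zero_comp']
    | ha a b ha hb => simp only [add_comp', ha, hb]
    | ht f f' =>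
      induction g using hom_induction with
      | h0 => simp only [zero_comp', comp_zero']
      | ha a b ha hb => simp only [add_comp', comp_add', ha, hb]
      | ht g g' =>
        induction h using hom_induction with
        | h0 => simp only [comp_zero']
        | ha a b ha hb => simp only [comp_add', ha, hb]
        | ht h h' => simp only [tmul_comp_tmul, Category.assoc]

instance : Preadditive (LinProd k C) where
  homGroup _ _ := inferInstance
  add_comp _ _ _ f f' g := add_comp' f f' g
  comp_add _ _ _ f g g' := comp_add' f g g'

instance : Linear k (LinProd k C) where
  smul_comp _ _ _ a f g := by
    apply hom_ext
    simp
  comp_smul _ _ _ f a g := by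
    apply hom_ext
    simp

theorem tmul_add {A A' B B' : C} (f : A ⟶ A') (g g' : B ⟶ B') :
    (tmul f (g + g') : (⟨A, B⟩ : LinProd k C) ⟶ _) = tmul f g + tmul f g' :=
  hom_ext (TensorProduct.tmul_add _ _ _)

theorem add_tmul {A A' B B' : C} (f f' : A ⟶ A') (g : B ⟶ B') :
    (tmul (f + f') g : (⟨A, B⟩ : LinProd k C) ⟶ _) = tmul f g + tmul f' g :=
  hom_ext (TensorProduct.add_tmul _ _ _)

theorem tmul_smul {A A' B B' : C} (a : k) (f : A ⟶ A') (g : B ⟶ B') :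
    (tmul f (a • g) : (⟨A, B⟩ : LinProd k C) ⟶ _) = a • tmul f g :=
  hom_ext (TensorProduct.tmul_smul _ _ _)

theorem smul_tmul {A A' B B' : C} (a : k) (f : A ⟶ A') (g : B ⟶ B') :
    (tmul (a • f) g : (⟨A, B⟩ : LinProd k C) ⟶ _) = a • tmul f g :=
  hom_ext (TensorProduct.smul_tmul' _ _ _).symm

end LinProd

/-- A functor of two variables that is `k`-linear in each of them. -/
structure IsBilinear (k : Type w) [Field k] {C : Type u} [Category.{v} C] [Preadditive C]
    [Linear k C] {D : Type*} [Category* D] [Preadditive D] [Linear k D] (F : C ⥤ C ⥤ D) :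
    Prop where
  map_add_left : ∀ {X X' : C} (f g : X ⟶ X') (Y : C),
    (F.map (f + g)).app Y = (F.map f).app Y + (F.map g).app Y
  map_smul_left : ∀ {X X' : C} (a : k) (f : X ⟶ X') (Y : C),
    (F.map (a • f)).app Y = a • (F.map f).app Y
  map_add_right : ∀ (X : C) {Y Y' : C} (f g : Y ⟶ Y'),
    (F.obj X).map (f + g) = (F.obj X).map f + (F.obj X).map g
  map_smul_right : ∀ (X : C) {Y Y' : C} (a : k) (f : Y ⟶ Y'),
    (F.obj X).map (a • f) = a • (F.obj X).map f

namespace LinProd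

variable {k : Type w} [Field k] {C : Type u} [Category.{v} C] [Preadditive C] [Linear k C]

section lift

variable {D : Type*} [Category* D] [Preadditive D] [Linear k D] (F : C ⥤ C ⥤ D)
  (hF : IsBilinear k F)

def liftMap (X Y : LinProd k C) : (X.fst ⟶ Y.fst) ⊗[k] (X.snd ⟶ Y.snd) →ₗ[k]
    ((F.obj X.fst).obj X.snd ⟶ (F.obj Y.fst).obj Y.snd) :=
  TensorProduct.lift (LinearMap.mk₂ k
    (fun f g => (F.map f).app X.snd ≫ (F.obj Y.fst).map g)
    (fun f f' g => by simp [hF.map_add_left])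
    (fun a f g => by simp [hF.map_smul_left])
    (fun f g g' => by simp [hF.map_add_right])
    (fun a f g => by simp [hF.map_smul_right]))

theorem liftMap_tmul {A A' B B' : C} (f : A ⟶ A') (g : B ⟶ B') :
    liftMap F hF ⟨A, B⟩ ⟨A', B'⟩ (tmul f g : (⟨A, B⟩ : LinProd k C) ⟶ ⟨A', B'⟩).val =
      (F.map f).app B ≫ (F.obj A').map g :=
  TensorProduct.lift.tmul _ _

/-- The `k`-linear functor `C ⊗ C ⥤ D` with `(X, Y) ↦ F X Y`, `f ⊗ g ↦ F f g`. -/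
def lift : LinProd k C ⥤ D where
  obj X := (F.obj X.fst).obj X.snd
  map {X Y} f := liftMap F hF X Y f.val
  map_id X := by rw [id_def, liftMap_tmul]; simp
  map_comp {X Y Z} f g := by
    induction f using hom_induction with
    | h0 => simp only [zero_val, map_zero, zero_comp]
    | ha a b ha hb => simp only [add_val, map_add, ha, hb, Preadditive.add_comp]
    | ht f f' =>
      induction g using hom_induction with
      | h0 => simp only [zero_val, map_zero, comp_zero]
      | ha a b ha hb => simp only [add_val, map_add, ha, hb, Preadditive.comp_add]
      | ht g g' =>
        refine (liftMap_tmul F hF (f ≫ g) (f' ≫ g')).trans (Eq.trans ?_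
          (congrArg₂ (· ≫ ·) (liftMap_tmul F hF f f') (liftMap_tmul F hF g g')).symm)
        simp

theorem lift_map_tmul {A A' B B' : C} (f : A ⟶ A') (g : B ⟶ B') :
    (lift F hF).map (tmul f g : (⟨A, B⟩ : LinProd k C) ⟶ ⟨A', B'⟩) =
      (F.map f).app B ≫ (F.obj A').map g :=
  liftMap_tmul F hF f g

instance : (lift F hF).Additive where
  map_add {X Y f g} := map_add (liftMap F hF X Y) f.val g.val

end lift

variable (k C) in
/-- The bilinear functor `(X, Y) ↦ (X, Y)`, `(f, g) ↦ f ⊗ g`. -/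
def pair : C ⥤ C ⥤ LinProd k C where
  obj X :=
    { obj := fun Y => ⟨X, Y⟩
      map := fun g => tmul (𝟙 X) g
      map_id := fun _ => rfl
      map_comp := fun f g => by rw [tmul_comp_tmul, Category.comp_id] }
  map {X X'} f :=
    { app := fun Y => tmul f (𝟙 Y)
      naturality := fun Y Y' g => by
        change tmul (𝟙 X) g ≫ tmul f (𝟙 Y') = tmul f (𝟙 Y) ≫ tmul (𝟙 X') g
        simp only [tmul_comp_tmul, Category.id_comp, Category.comp_id] }
  map_id X := rfl
  map_comp f g := by
    apply NatTrans.ext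
    funext Y
    change tmul (f ≫ g) (𝟙 Y) = tmul f (𝟙 Y) ≫ tmul g (𝟙 Y)
    rw [tmul_comp_tmul, Category.comp_id]

section tensor

variable [MonoidalCategory C] [MonoidalPreadditive C] [MonoidalLinear k C]

/-- Left multiplication by `(X, Y)`, as a bifunctor `(A, B) ↦ (X ⊗ A, Y ⊗ B)`. -/
def mulPair (X Y : C) : C ⥤ C ⥤ LinProd k C :=
  tensorLeft X ⋙ pair k C ⋙ (Functor.whiskeringLeft C C (LinProd k C)).obj (tensorLeft Y)

theorem mulPair_isBilinear (X Y : C) : IsBilinear k (mulPair (k := k) X Y) where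
  map_add_left f g B := by
    change tmul (X ◁ (f + g)) _ = tmul (X ◁ f) _ + tmul (X ◁ g) _
    rw [MonoidalPreadditive.whiskerLeft_add]
    exact add_tmul _ _ _
  map_smul_left a f B := by
    change tmul (X ◁ (a • f)) _ = a • tmul (X ◁ f) _
    rw [MonoidalLinear.whiskerLeft_smul]
    exact smul_tmul _ _ _
  map_add_right A _ _ f g := by
    change tmul _ (Y ◁ (f + g)) = tmul _ (Y ◁ f) + tmul _ (Y ◁ g)
    rw [MonoidalPreadditive.whiskerLeft_add]
    exact tmul_add _ _ _
  map_smul_right A _ _ a f := by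
    change tmul _ (Y ◁ (a • f)) = a • tmul _ (Y ◁ f)
    rw [MonoidalLinear.whiskerLeft_smul]
    exact tmul_smul _ _ _

/-- Left multiplication by `(X, Y)` on `C ⊗ C`: the functor `(A, B) ↦ (X ⊗ A, Y ⊗ B)`,
`f ⊗ g ↦ (X ⊗ f) ⊗ (Y ⊗ g)`. -/
def mulLeft (X Y : C) : LinProd k C ⥤ LinProd k C :=
  lift (mulPair X Y) (mulPair_isBilinear X Y)

instance (X Y : C) : (mulLeft (k := k) X Y).Additive :=
  inferInstanceAs (lift (mulPair X Y) (mulPair_isBilinear X Y)).Additive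

theorem mulLeft_map_tmul (X Y : C) {A A' B B' : C} (f : A ⟶ A') (g : B ⟶ B') :
    (mulLeft X Y).map (tmul f g : (⟨A, B⟩ : LinProd k C) ⟶ _) = tmul (X ◁ f) (Y ◁ g) := by
  refine (lift_map_tmul _ _ f g).trans ?_
  change tmul (X ◁ f) (𝟙 (Y ⊗ B)) ≫ tmul (𝟙 (X ⊗ A')) (Y ◁ g) = tmul (X ◁ f) (Y ◁ g)
  rw [tmul_comp_tmul, Category.comp_id, Category.id_comp]

def mulLeftApp {X X' : C} (f : X ⟶ X') (Y : C) (A : LinProd k C) :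
    (mulLeft X Y).obj A ⟶ (mulLeft X' Y).obj A :=
  tmul (f ▷ A.fst) (𝟙 (Y ⊗ A.snd))

/-- Left multiplication by `f ⊗ Y`, for `f : X ⟶ X'`. -/
def mulLeftMap {X X' : C} (f : X ⟶ X') (Y : C) :
    (mulLeft (k := k) X Y) ⟶ mulLeft X' Y where
  app A := mulLeftApp f Y A
  naturality A B g := by
    induction g using hom_induction with
    | h0 => rw [Functor.map_zero, Functor.map_zero, zero_comp, comp_zero]
    | ha a b ha hb =>
      rw [Functor.map_add, Functor.map_add, Preadditive.add_comp, Preadditive.comp_add, ha, hb]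
    | ht g g' =>
      refine (congrArg (· ≫ mulLeftApp f Y B) (mulLeft_map_tmul X Y g g')).trans (Eq.trans ?_
        (congrArg (mulLeftApp f Y A ≫ ·) (mulLeft_map_tmul X' Y g g')).symm)
      change tmul (X ◁ g) (Y ◁ g') ≫ tmul (f ▷ B.fst) (𝟙 (Y ⊗ B.snd)) =
        tmul (f ▷ A.fst) (𝟙 (Y ⊗ A.snd)) ≫ tmul (X' ◁ g) (Y ◁ g')
      rw [tmul_comp_tmul, tmul_comp_tmul, whisker_exchange, Category.comp_id, Category.id_comp]

theorem mulLeftMap_id (X Y : C) : mulLeftMap (k := k) (𝟙 X) Y = 𝟙 _ := by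
  apply NatTrans.ext
  funext A
  change tmul (𝟙 X ▷ A.fst) (𝟙 (Y ⊗ A.snd)) = tmul (𝟙 (X ⊗ A.fst)) (𝟙 (Y ⊗ A.snd))
  rw [id_whiskerRight]

theorem mulLeftMap_comp {X X' X'' : C} (f : X ⟶ X') (g : X' ⟶ X'') (Y : C) :
    mulLeftMap (k := k) (f ≫ g) Y = mulLeftMap f Y ≫ mulLeftMap g Y := by
  apply NatTrans.ext
  funext A
  change tmul ((f ≫ g) ▷ A.fst) (𝟙 (Y ⊗ A.snd)) =
    tmul (f ▷ A.fst) (𝟙 (Y ⊗ A.snd)) ≫ tmul (g ▷ A.fst) (𝟙 (Y ⊗ A.snd))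
  rw [comp_whiskerRight, tmul_comp_tmul, Category.comp_id]

end tensor

end LinProd

section Envelope

variable {A : Type u} [Category.{v} A] [Preadditive A]

/-- The extension of an additive functor to the additive envelope:
`(X₁, …, Xₙ) ↦ F X₁ ⊕ ⋯ ⊕ F Xₙ`. -/
def matLift {D : Type*} [Category* D] [Preadditive D] [HasFiniteBiproducts D] (F : A ⥤ D)
    [F.Additive] : Mat_ A ⥤ D where
  obj M := ⨁ fun i => F.obj (M.X i)
  map f := biproduct.matrix fun i j => F.map (f i j)
  map_id M := by
    classical
    ext i j
    by_cases h : j = i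
    · subst h
      simp
    · simp [h, Mat_.id_apply_of_ne]
  map_comp f g := by
    ext i j
    simp [biproduct.lift_desc]

def biproductPUnitIso {D : Type*} [Category* D] [Preadditive D] [HasFiniteBiproducts D] (Y : D) :
    (⨁ fun _ : PUnit.{1} => Y) ≅ Y where
  hom := biproduct.π (fun _ : PUnit.{1} => Y) PUnit.unit
  inv := biproduct.ι (fun _ : PUnit.{1} => Y) PUnit.unit
  hom_inv_id := by
    ext
    simp
  inv_hom_id := by simp

/-- `matLift F` extends `F`. -/
def embeddingMatLiftIso {D : Type*} [Category* D] [Preadditive D] [HasFiniteBiproducts D]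
    (F : A ⥤ D) [F.Additive] : Mat_.embedding A ⋙ matLift F ≅ F :=
  NatIso.ofComponents (fun X => biproductPUnitIso (F.obj X)) (fun {X Y} f => by
    change biproduct.matrix (fun (_ : PUnit.{1}) (_ : PUnit.{1}) => F.map f) ≫
      biproduct.π _ PUnit.unit = biproduct.π _ PUnit.unit ≫ F.map f
    ext
    simp)

/-- The additive and idempotent-complete envelope of a preadditive category: objects are
direct summands of formal finite direct sums of objects of `A`. -/
abbrev Envelope (A : Type u) [Category.{v} A] [Preadditive A] :=
  Idempotents.Karoubi (Mat_ A)

variable (A) in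
/-- The canonical fully faithful functor from `A` to its envelope. -/
def toEnvelope : A ⥤ Envelope A := Mat_.embedding A ⋙ Idempotents.toKaroubi (Mat_ A)

section

variable {D : Type*} [Category* D] [Preadditive D] [HasFiniteBiproducts D] [IsIdempotentComplete D]

/-- The extension of an additive functor `F : A ⥤ D` to the envelope of `A` (unique up to
unique isomorphism), for `D` additive and idempotent complete. -/
def extend (F : A ⥤ D) [F.Additive] : Envelope A ⥤ D :=
  (Idempotents.functorExtension (Mat_ A) D).obj (matLift F)

/-- `extend F` extends `F`. -/
def toEnvelopeExtendIso (F : A ⥤ D) [F.Additive] : toEnvelope A ⋙ extend F ≅ F :=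
  Functor.isoWhiskerLeft (Mat_.embedding A)
    (Functor.isoWhiskerRight
      ((Idempotents.functorExtension₂CompWhiskeringLeftToKaroubiIso (Mat_ A) D).app (matLift F))
      (Idempotents.toKaroubiEquivalence D).inverse ≪≫
    Functor.isoWhiskerLeft (matLift F) (Idempotents.toKaroubiEquivalence D).unitIso.symm) ≪≫
  embeddingMatLiftIso F

end

section

variable {B : Type u} [Category.{v} B] [Preadditive B]

/-- The natural transformation of matrix categories induced by a natural transformation
of additive functors; its component at `(X₁, …, Xₙ)` is the diagonal matrix of the `α Xᵢ`. -/
def mapMatNat {F G : A ⥤ B} [F.Additive] [G.Additive] (α : F ⟶ G) : F.mapMat_ ⟶ G.mapMat_ where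
  app M := fun i j => F.map ((𝟙 M : M ⟶ M) i j) ≫ α.app (M.X j)
  naturality M N f := by
    funext i j
    have h1 : ∀ l, F.map (f i l) ≫ F.map ((𝟙 N : N ⟶ N) l j) ≫ α.app (N.X j) =
        F.map (f i l ≫ (𝟙 N : N ⟶ N) l j) ≫ α.app (N.X j) := fun l => by
      rw [F.map_comp, Category.assoc]
    have h2 : ∀ l, (F.map ((𝟙 M : M ⟶ M) i l) ≫ α.app (M.X l)) ≫ G.map (f l j) =
        F.map ((𝟙 M : M ⟶ M) i l ≫ f l j) ≫ α.app (N.X j) := fun l => by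
      rw [Category.assoc, ← α.naturality, F.map_comp, Category.assoc]
    change ∑ l, F.map (f i l) ≫ F.map ((𝟙 N : N ⟶ N) l j) ≫ α.app (N.X j) =
      ∑ l, (F.map ((𝟙 M : M ⟶ M) i l) ≫ α.app (M.X l)) ≫ G.map (f l j)
    simp only [h1, h2, ← Preadditive.sum_comp, ← F.map_sum]
    congr 2
    exact (congrFun (congrFun (Category.comp_id f) i) j).trans
      (congrFun (congrFun (Category.id_comp f) i) j).symm

theorem mapMatNat_id (F : A ⥤ B) [F.Additive] : mapMatNat (𝟙 F) = 𝟙 F.mapMat_ := by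
  apply NatTrans.ext
  funext M
  refine Eq.trans ?_ (F.mapMat_.map_id M)
  funext i j
  exact Category.comp_id _

theorem mapMatNat_comp {F G H : A ⥤ B} [F.Additive] [G.Additive] [H.Additive] (α : F ⟶ G)
    (β : G ⟶ H) : mapMatNat (α ≫ β) = mapMatNat α ≫ mapMatNat β := by
  apply NatTrans.ext
  funext M
  funext i j
  have h : ∀ l, (F.map ((𝟙 M : M ⟶ M) i l) ≫ α.app (M.X l)) ≫ G.map ((𝟙 M : M ⟶ M) l j) ≫
      β.app (M.X j) = F.map ((𝟙 M : M ⟶ M) i l ≫ (𝟙 M : M ⟶ M) l j) ≫ (α ≫ β).app (M.X j) :=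
    fun l => by
      rw [Category.assoc, ← α.naturality_assoc, F.map_comp, Category.assoc, NatTrans.comp_app]
  change F.map ((𝟙 M : M ⟶ M) i j) ≫ (α ≫ β).app (M.X j) =
    ∑ l, (F.map ((𝟙 M : M ⟶ M) i l) ≫ α.app (M.X l)) ≫ G.map ((𝟙 M : M ⟶ M) l j) ≫ β.app (M.X j)
  simp only [h, ← Preadditive.sum_comp, ← F.map_sum]
  congr 2
  exact (congrFun (congrFun (Category.comp_id (𝟙 M)) i) j).symm

/-- The functor on envelopes induced by an additive functor. -/
def mapEnvelope (F : A ⥤ B) [F.Additive] : Envelope A ⥤ Envelope B :=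
  (Idempotents.functorExtension₂ (Mat_ A) (Mat_ B)).obj F.mapMat_

/-- The natural transformation on envelopes induced by one of additive functors. -/
def mapEnvelopeNat {F G : A ⥤ B} [F.Additive] [G.Additive] (α : F ⟶ G) :
    mapEnvelope F ⟶ mapEnvelope G :=
  (Idempotents.functorExtension₂ (Mat_ A) (Mat_ B)).map (mapMatNat α)

/-- `mapEnvelope F` extends `F`. -/
def toEnvelopeMapIso (F : A ⥤ B) [F.Additive] :
    toEnvelope A ⋙ mapEnvelope F ≅ F ⋙ toEnvelope B :=
  Functor.isoWhiskerLeft (Mat_.embedding A)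
    ((Idempotents.functorExtension₂CompWhiskeringLeftToKaroubiIso (Mat_ A) (Mat_ B)).app
      F.mapMat_) ≪≫
  Functor.isoWhiskerRight
    (NatIso.ofComponents (fun _ => Iso.refl _) (fun _ => by
      exact (Category.comp_id _).trans (Category.id_comp _).symm) :
      Mat_.embedding A ⋙ F.mapMat_ ≅ F ⋙ Mat_.embedding B)
    (Idempotents.toKaroubi (Mat_ B))

end

end Envelope

section

variable {E : Type*} [Category* E]

theorem paste {P Q R S T V : E} {m : P ⟶ Q} {l₂ : Q ⟶ R} {n₂ : R ⟶ S} {l₁ : P ⟶ T} {m' : T ⟶ R}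
    {n₁ : T ⟶ V} {M : V ⟶ S} (h : m ≫ l₂ = l₁ ≫ m') (h' : m' ≫ n₂ = n₁ ≫ M) :
    m ≫ l₂ ≫ n₂ = (l₁ ≫ n₁) ≫ M := by
  rw [← Category.assoc, h, Category.assoc, h', Category.assoc]

theorem paste₂ {P Q Q' R R' S T : E} {a : P ⟶ Q} {i : Q ⟶ R} {m : R ⟶ S} {b : P ⟶ Q'}
    {i' : Q' ⟶ R'} {m' : R' ⟶ S} {j : P ⟶ T} {n : T ⟶ R} {n' : T ⟶ R'} (h : a ≫ i = j ≫ n)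
    (h' : b ≫ i' = j ≫ n') (h'' : n ≫ m = n' ≫ m') : a ≫ i ≫ m = b ≫ i' ≫ m' := by
  rw [← Category.assoc, h, Category.assoc, h'', ← Category.assoc, ← h', Category.assoc]

end

section Deligne

variable (k : Type w) [Field k] (C : Type u) [Category.{v} C] [Preadditive C] [Linear k C]

/-- The Deligne product `C ⊠ C`: the envelope of the `k`-linear tensor product `C ⊗ C`.
It is used for categories in which `End(X) ⊗ End(Y)` is always a semisimple algebra (semisimple
categories with a nondegenerate trace); there the additive idempotent-complete envelope is
semisimple abelian, and so it is the abelian envelope. -/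
abbrev DeligneProd := Envelope (LinProd k C)

/-- The bifunctor `(X, Y) ↦ X ⊠ Y`. -/
def box : C ⥤ C ⥤ DeligneProd k C :=
  LinProd.pair k C ⋙ (Functor.whiskeringRight C _ _).obj (toEnvelope (LinProd k C))

variable {C} in
abbrev boxObj (X Y : C) : DeligneProd k C := ((box k C).obj X).obj Y

variable [MonoidalCategory C] [MonoidalPreadditive C] [MonoidalLinear k C]

theorem curriedTensor_isBilinear : IsBilinear k (curriedTensor C) where
  map_add_left _ _ _ := by simp
  map_smul_left _ _ _ := by simp
  map_add_right _ _ _ _ _ := by simp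
  map_smul_right _ _ _ _ _ := by simp

section

variable [HasFiniteBiproducts C] [IsIdempotentComplete C]

/-- The tensor product functor `T : C ⊠ C ⥤ C`, with `T (X ⊠ Y) = X ⊗ Y`. -/
def tensorFunctor : DeligneProd k C ⥤ C :=
  extend (LinProd.lift (curriedTensor C) (curriedTensor_isBilinear k C))

variable {C} in
def tensorFunctorBoxIso (X Y : C) : (tensorFunctor k C).obj (boxObj k X Y) ≅ X ⊗ Y :=
  (toEnvelopeExtendIso (LinProd.lift (curriedTensor C) (curriedTensor_isBilinear k C))).app ⟨X, Y⟩

end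

/-- The functor `X ↦ (X ⊠ 𝟙) ⊗ -` -/
def boxUnitMul : C ⥤ DeligneProd k C ⥤ DeligneProd k C where
  obj X := mapEnvelope (LinProd.mulLeft X (𝟙_ C))
  map f := mapEnvelopeNat (LinProd.mulLeftMap f (𝟙_ C))
  map_id X := by
    rw [LinProd.mulLeftMap_id, mapEnvelopeNat, mapMatNat_id]
    exact CategoryTheory.Functor.map_id _ _
  map_comp f g := by
    rw [LinProd.mulLeftMap_comp, mapEnvelopeNat, mapMatNat_comp]
    exact CategoryTheory.Functor.map_comp _ _ _

variable [RightRigidCategory C]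

/-- The contravariant functor `Y ↦ Y^∨`. -/
def dualFunctor : Cᵒᵖ ⥤ C where
  obj Y := (unop Y)ᘁ
  map f := (f.unop)ᘁ
  map_id _ := rightAdjointMate_id
  map_comp _ _ := comp_rightAdjointMate

/-- The functor `Cᵒᵖ × C ⥤ C ⊠ C`, `(Y', Y) ↦ Y'^∨ ⊠ Y`. -/
def dualBox : Cᵒᵖ ⥤ C ⥤ DeligneProd k C := dualFunctor C ⋙ box k C

variable {C} in
/-- The functor `(Y', Y) ↦ (X ⊗ Y'^∨) ⊠ Y`. -/
def tensorDualBox (X : C) : Cᵒᵖ ⥤ C ⥤ DeligneProd k C :=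
  dualFunctor C ⋙ tensorLeft X ⋙ box k C

variable {C} in
/-- The isomorphism `(X ⊗ Y') ⊠ Y ≅ (X ⊠ 𝟙) ⊗ (Y' ⊠ Y)`. -/
def boxUnitMulIso (X Y' Y : C) :
    boxObj k (X ⊗ Y') Y ≅ ((boxUnitMul k C).obj X).obj (boxObj k Y' Y) :=
  (toEnvelope (LinProd k C)).mapIso (((LinProd.pair k C).obj (X ⊗ Y')).mapIso (λ_ Y).symm) ≪≫
    (toEnvelopeMapIso (LinProd.mulLeft X (𝟙_ C))).symm.app ⟨Y', Y⟩

variable {C} in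
theorem boxUnitMulIso_naturality (X : C) {A A' B B' : C} (g : A ⟶ A') (f : B ⟶ B') :
    (toEnvelope (LinProd k C)).map (LinProd.tmul (X ◁ g) f) ≫ (boxUnitMulIso k X A' B').hom =
      (boxUnitMulIso k X A B).hom ≫
        ((boxUnitMul k C).obj X).map ((toEnvelope (LinProd k C)).map (LinProd.tmul g f)) := by
  have h := (toEnvelopeMapIso (LinProd.mulLeft (k := k) X (𝟙_ C))).inv.naturality
    (LinProd.tmul g f : (⟨A, B⟩ : LinProd k C) ⟶ ⟨A', B'⟩)
  have e1 : (boxUnitMulIso k X A B).hom = (toEnvelope (LinProd k C)).map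
      (LinProd.tmul (𝟙 (X ⊗ A)) (λ_ B).inv) ≫
      (toEnvelopeMapIso (LinProd.mulLeft (k := k) X (𝟙_ C))).inv.app ⟨A, B⟩ := rfl
  have e2 : (boxUnitMulIso k X A' B').hom = (toEnvelope (LinProd k C)).map
      (LinProd.tmul (𝟙 (X ⊗ A')) (λ_ B').inv) ≫
      (toEnvelopeMapIso (LinProd.mulLeft (k := k) X (𝟙_ C))).inv.app ⟨A', B'⟩ := rfl
  rw [e1, e2]
  refine paste ?_ h
  have e3 : (LinProd.mulLeft X (𝟙_ C)).map (LinProd.tmul g f : (⟨A, B⟩ : LinProd k C) ⟶ ⟨A', B'⟩) =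
      LinProd.tmul (X ◁ g) (𝟙_ C ◁ f) := LinProd.mulLeft_map_tmul X (𝟙_ C) g f
  have e4 : (LinProd.tmul (X ◁ g) f : (⟨X ⊗ A, B⟩ : LinProd k C) ⟶ ⟨X ⊗ A', B'⟩) ≫
        LinProd.tmul (𝟙 (X ⊗ A')) (λ_ B').inv =
      LinProd.tmul (𝟙 (X ⊗ A)) (λ_ B).inv ≫ LinProd.tmul (X ◁ g) (𝟙_ C ◁ f) := by
    rw [LinProd.tmul_comp_tmul, LinProd.tmul_comp_tmul, Category.comp_id, Category.id_comp,
      leftUnitor_inv_naturality]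
  refine (CategoryTheory.Functor.map_comp _ _ _).symm.trans
    ((congrArg (toEnvelope (LinProd k C)).map e4).trans ?_)
  refine (CategoryTheory.Functor.map_comp _ _ _).trans ?_
  exact congrArg (fun t => _ ≫ (toEnvelope (LinProd k C)).map t) e3.symm

variable {C} in
/-- The cowedge `(X ⊗ Y^∨) ⊠ Y ≅ (X ⊠ 𝟙) ⊗ (Y^∨ ⊠ Y) ⟶ (X ⊠ 𝟙) ⊗ R̃` obtained from a cowedge
`Y^∨ ⊠ Y ⟶ R̃`. -/
def mulCowedge (X : C) (c : Cowedge (dualBox k C)) : Cowedge (tensorDualBox k X) :=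
  Cowedge.mk (F := tensorDualBox k X) (((boxUnitMul k C).obj X).obj c.pt)
    (fun Y => (boxUnitMulIso k X Yᘁ Y).hom ≫ ((boxUnitMul k C).obj X).map (c.π Y))
    (fun Y Y' f => by
      have h := congrArg (((boxUnitMul k C).obj X).map) (Cowedge.condition c f)
      have h1 := boxUnitMulIso_naturality k X (fᘁ) (𝟙 Y)
      have h2 := boxUnitMulIso_naturality k X (𝟙 Y'ᘁ) f
      rw [MonoidalCategory.whiskerLeft_id] at h2
      exact paste₂ h1 h2 ((CategoryTheory.Functor.map_comp _ _ _).symm.trans (h.trans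
        (CategoryTheory.Functor.map_comp _ _ _))))

variable {C} in
/-- The functor `X ↦ (X ⊠ 𝟙) ⊗ R̃`. -/
def mulFunctor (R : DeligneProd k C) : C ⥤ DeligneProd k C := (boxUnitMul k C).flip.obj R

end Deligne


section Center

variable {C : Type u} [Category.{v} C] [Preadditive C] [MonoidalCategory C] [MonoidalPreadditive C]

namespace CenterLinear

instance (X Y : Center C) : Zero (X ⟶ Y) := ⟨⟨0, fun U => by simp⟩⟩
instance (X Y : Center C) : Add (X ⟶ Y) := ⟨fun f g => ⟨f.f + g.f, fun U => by simp⟩⟩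
instance (X Y : Center C) : Neg (X ⟶ Y) := ⟨fun f => ⟨-f.f, fun U => by
  have h1 : (-f.f) ▷ U = -(f.f ▷ U) := (tensorRight U).map_neg
  have h2 : U ◁ (-f.f) = -(U ◁ f.f) := (tensorLeft U).map_neg
  simp [h1, h2]⟩⟩
instance (X Y : Center C) : Sub (X ⟶ Y) := ⟨fun f g => ⟨f.f - g.f, fun U => by
  have h1 : (f.f - g.f) ▷ U = f.f ▷ U - g.f ▷ U := (tensorRight U).map_sub
  have h2 : U ◁ (f.f - g.f) = U ◁ f.f - U ◁ g.f := (tensorLeft U).map_sub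
  simp [h1, h2]⟩⟩
instance (X Y : Center C) : SMul ℕ (X ⟶ Y) := ⟨fun n f => ⟨n • f.f, fun U => by
  have h1 : (n • f.f) ▷ U = n • (f.f ▷ U) := (tensorRight U).map_nsmul
  have h2 : U ◁ (n • f.f) = n • (U ◁ f.f) := (tensorLeft U).map_nsmul
  simp [h1, h2]⟩⟩
instance (X Y : Center C) : SMul ℤ (X ⟶ Y) := ⟨fun n f => ⟨n • f.f, fun U => by
  have h1 : (n • f.f) ▷ U = n • (f.f ▷ U) := (tensorRight U).map_zsmul
  have h2 : U ◁ (n • f.f) = n • (U ◁ f.f) := (tensorLeft U).map_zsmul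
  simp [h1, h2]⟩⟩

theorem f_injective (X Y : Center C) : Function.Injective (fun g : X ⟶ Y => g.f) :=
  fun _ _ h => Center.ext _ _ h

instance (X Y : Center C) : AddCommGroup (X ⟶ Y) :=
  (f_injective X Y).addCommGroup _ rfl (fun _ _ => rfl) (fun _ => rfl) (fun _ _ => rfl)
    (fun _ _ => rfl) (fun _ _ => rfl)

@[simp] theorem add_f {X Y : Center C} (f g : X ⟶ Y) : (f + g).f = f.f + g.f := rfl
@[simp] theorem zero_f (X Y : Center C) : (0 : X ⟶ Y).f = 0 := rfl

/-- The centre of a preadditive monoidal category is preadditive. -/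
instance : Preadditive (Center C) where
  homGroup _ _ := inferInstance
  add_comp _ _ _ f f' g := Center.ext _ _ (Preadditive.add_comp _ _ _ f.f f'.f g.f)
  comp_add _ _ _ f g g' := Center.ext _ _ (Preadditive.comp_add _ _ _ f.f g.f g'.f)

theorem sum_f {X Y : Center C} {J : Type*} (s : Finset J) (g : J → (X ⟶ Y)) :
    (∑ j ∈ s, g j).f = ∑ j ∈ s, (g j).f :=
  map_sum ({ toFun := fun g : X ⟶ Y => g.f, map_zero' := rfl, map_add' := fun _ _ => rfl } :
    (X ⟶ Y) →+ (X.1 ⟶ Y.1)) g s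

instance : MonoidalPreadditive (Center C) where
  whiskerLeft_zero := Center.ext _ _ MonoidalPreadditive.whiskerLeft_zero
  zero_whiskerRight := Center.ext _ _ MonoidalPreadditive.zero_whiskerRight
  whiskerLeft_add f g := Center.ext _ _ (MonoidalPreadditive.whiskerLeft_add f.f g.f)
  add_whiskerRight f g := Center.ext _ _ (MonoidalPreadditive.add_whiskerRight f.f g.f)

section linear

variable {k : Type w} [Field k] [Linear k C] [MonoidalLinear k C]

instance (X Y : Center C) : SMul k (X ⟶ Y) := ⟨fun a f => ⟨a • f.f, fun U => by simp⟩⟩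

instance (X Y : Center C) : Module k (X ⟶ Y) :=
  (f_injective X Y).module k
    { toFun := fun f : X ⟶ Y => f.f, map_zero' := rfl, map_add' := fun _ _ => rfl }
    (fun _ _ => rfl)

@[simp] theorem smul_f {X Y : Center C} (a : k) (f : X ⟶ Y) : (a • f).f = a • f.f := rfl

/-- The centre of a `k`-linear monoidal category is `k`-linear. -/
instance : Linear k (Center C) where
  smul_comp _ _ _ a f g := Center.ext _ _ (Linear.smul_comp _ _ _ a f.f g.f)
  comp_smul _ _ _ f a g := Center.ext _ _ (Linear.comp_smul _ _ _ f.f a g.f)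

instance : MonoidalLinear k (Center C) where
  whiskerLeft_smul X _ _ a f := Center.ext _ _ (MonoidalLinear.whiskerLeft_smul X.1 a f.f)
  smul_whiskerRight a _ _ f X := Center.ext _ _ (MonoidalLinear.smul_whiskerRight a f.f X.1)

end linear

/-- An object of `C` exhibited as a summand of finitely many objects of the centre, compatibly
with their half-braidings. -/
structure Decomposition {J : Type} [Fintype J] (Z : J → Center C) (W : C) where
  i : ∀ j, (Z j).1 ⟶ W
  p : ∀ j, W ⟶ (Z j).1
  total : ∑ j, p j ≫ i j = 𝟙 W
  comm : ∀ j l U, (i j ≫ p l) ▷ U ≫ ((Z l).2.β U).hom = ((Z j).2.β U).hom ≫ U ◁ (i j ≫ p l)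

namespace Decomposition

variable {J : Type} [Fintype J] {Z : J → Center C} {W : C} (d : Decomposition Z W)

theorem sum_p_i_p (l : J) : ∑ j, d.p j ≫ d.i j ≫ d.p l = d.p l := by
  simp_rw [← Category.assoc, ← Preadditive.sum_comp, d.total, Category.id_comp]

theorem sum_i_p_i (j : J) : ∑ l, (d.i j ≫ d.p l) ≫ d.i l = d.i j := by
  simp_rw [Category.assoc, ← Preadditive.comp_sum, d.total, Category.comp_id]

theorem comm_inv (j l : J) (U : C) : U ◁ (d.i j ≫ d.p l) ≫ ((Z l).2.β U).inv =
    ((Z j).2.β U).inv ≫ (d.i j ≫ d.p l) ▷ U := by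
  rw [Iso.comp_inv_eq, Category.assoc, d.comm, Iso.inv_hom_id_assoc]

def hom (U : C) : W ⊗ U ⟶ U ⊗ W := ∑ j, d.p j ▷ U ≫ ((Z j).2.β U).hom ≫ U ◁ d.i j

def inv (U : C) : U ⊗ W ⟶ W ⊗ U := ∑ j, U ◁ d.p j ≫ ((Z j).2.β U).inv ≫ d.i j ▷ U

theorem i_hom (j : J) (U : C) : d.i j ▷ U ≫ d.hom U = ((Z j).2.β U).hom ≫ U ◁ d.i j := by
  have h : ∀ l, d.i j ▷ U ≫ d.p l ▷ U ≫ ((Z l).2.β U).hom ≫ U ◁ d.i l =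
      ((Z j).2.β U).hom ≫ U ◁ ((d.i j ≫ d.p l) ≫ d.i l) := fun l => by
    rw [← comp_whiskerRight_assoc, ← Category.assoc, d.comm, Category.assoc,
      ← MonoidalCategory.whiskerLeft_comp]
  simp only [hom, Preadditive.comp_sum, h]
  rw [← Preadditive.comp_sum, ← whiskerLeft_sum, d.sum_i_p_i]

theorem hom_p (j : J) (U : C) : d.hom U ≫ U ◁ d.p j = d.p j ▷ U ≫ ((Z j).2.β U).hom := by
  have h : ∀ l, (d.p l ▷ U ≫ ((Z l).2.β U).hom ≫ U ◁ d.i l) ≫ U ◁ d.p j =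
      (d.p l ≫ d.i l ≫ d.p j) ▷ U ≫ ((Z j).2.β U).hom := fun l => by
    rw [Category.assoc, Category.assoc, ← MonoidalCategory.whiskerLeft_comp, ← d.comm,
      ← comp_whiskerRight_assoc]
  simp only [hom, Preadditive.sum_comp, h]
  rw [← Preadditive.sum_comp, ← sum_whiskerRight, d.sum_p_i_p]

theorem hom_inv (U : C) : d.hom U ≫ d.inv U = 𝟙 _ := by
  have h : ∀ l, d.hom U ≫ U ◁ d.p l ≫ ((Z l).2.β U).inv ≫ d.i l ▷ U =
      (d.p l ≫ d.i l) ▷ U := fun l => by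
    rw [← Category.assoc, d.hom_p, Category.assoc, Iso.hom_inv_id_assoc, comp_whiskerRight]
  rw [inv, Preadditive.comp_sum]
  simp only [h]
  rw [← sum_whiskerRight, d.total, id_whiskerRight]

theorem inv_hom (U : C) : d.inv U ≫ d.hom U = 𝟙 _ := by
  have h : ∀ l, (U ◁ d.p l ≫ ((Z l).2.β U).inv ≫ d.i l ▷ U) ≫ d.hom U =
      U ◁ (d.p l ≫ d.i l) := fun l => by
    rw [Category.assoc, Category.assoc, d.i_hom, Iso.inv_hom_id_assoc,
      MonoidalCategory.whiskerLeft_comp]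
  rw [inv, Preadditive.sum_comp]
  simp only [h]
  rw [← whiskerLeft_sum, d.total, MonoidalCategory.whiskerLeft_id]

theorem cancel {V X : C} {f g : W ⊗ V ⟶ X} (h : ∀ j, d.i j ▷ V ≫ f = d.i j ▷ V ≫ g) : f = g := by
  have e : ∀ f : W ⊗ V ⟶ X, f = ∑ j, d.p j ▷ V ≫ d.i j ▷ V ≫ f := fun f => by
    simp_rw [← comp_whiskerRight_assoc]
    rw [← Preadditive.sum_comp, ← sum_whiskerRight, d.total, id_whiskerRight, Category.id_comp]
  rw [e f, e g]
  simp only [h]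

/-- The half-braiding induced on a summand. -/
def halfBraiding : HalfBraiding W where
  β U := ⟨d.hom U, d.inv U, d.hom_inv U, d.inv_hom U⟩
  monoidal U U' := by
    apply d.cancel
    intro j
    have h1 : d.i j ▷ (U ⊗ U') ≫ (α_ W U U').inv = (α_ _ U U').inv ≫ d.i j ▷ U ▷ U' := by simp
    change d.i j ▷ (U ⊗ U') ≫ d.hom (U ⊗ U') = d.i j ▷ (U ⊗ U') ≫ (α_ _ _ _).inv ≫
      (d.hom U ▷ U') ≫ (α_ _ _ _).hom ≫ (U ◁ d.hom U') ≫ (α_ _ _ _).inv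
    rw [d.i_hom, reassoc_of% h1, ← comp_whiskerRight_assoc, d.i_hom, comp_whiskerRight_assoc,
      associator_naturality_middle_assoc, ← MonoidalCategory.whiskerLeft_comp_assoc, d.i_hom,
      HalfBraiding.monoidal]
    simp
  naturality {U U'} f := by
    apply d.cancel
    intro j
    change d.i j ▷ U ≫ W ◁ f ≫ d.hom U' = d.i j ▷ U ≫ d.hom U ≫ f ▷ W
    rw [← whisker_exchange_assoc, d.i_hom, ← Category.assoc (d.i j ▷ U), d.i_hom,
      HalfBraiding.naturality_assoc, Category.assoc, whisker_exchange]

/-- The induced object of the centre. -/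
def obj : Center C := ⟨W, d.halfBraiding⟩

def iHom (j : J) : Z j ⟶ d.obj := ⟨d.i j, fun U => d.i_hom j U⟩

def pHom (j : J) : d.obj ⟶ Z j := ⟨d.p j, fun U => (d.hom_p j U).symm⟩

end Decomposition

/-- Finite direct sums in the centre are computed in `C`. -/
instance [HasFiniteBiproducts C] : HasFiniteBiproducts (Center C) where
  out n :=
    { has_biproduct := fun Z => by
        classical
        let d : Decomposition Z (⨁ fun j => (Z j).1) :=
          { i := biproduct.ι _
            p := biproduct.π _
            total := biproduct.total
            comm := fun j l U => by
              by_cases h : j = l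
              · subst h
                simp
              · simp [biproduct.ι_π_ne _ h] }
        exact hasBiproduct_of_total
          { pt := d.obj
            π := d.pHom
            ι := d.iHom
            ι_π := fun j l => by
              apply Center.ext
              by_cases h : j = l
              · subst h
                rw [dif_pos rfl]
                exact biproduct.ι_π_self _ _
              · rw [dif_neg h]
                exact biproduct.ι_π_ne _ h }
          (Center.ext _ _ ((sum_f _ _).trans d.total)) }

/-- Idempotents of the centre split as they do in `C`. -/
instance [IsIdempotentComplete C] : IsIdempotentComplete (Center C) where
  idempotents_split Z e he := by
    obtain ⟨W, i, p, h1, h2⟩ :=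
      IsIdempotentComplete.idempotents_split Z.1 e.f (congrArg (fun g => g.f) he)
    let d : Decomposition (fun _ : Unit => Z) W :=
      { i := fun _ => p
        p := fun _ => i
        total := by simpa using h1
        comm := fun _ _ U => by simp only [h2]; exact e.comm U }
    exact ⟨d.obj, d.pHom (), d.iHom (), Center.ext _ _ h1, Center.ext _ _ h2⟩

end CenterLinear
end Center

section Braided

variable {C : Type u} [Category.{v} C] [MonoidalCategory C]

/-- The functor `ι₊ : C ⥤ Z(C)`, `X ↦ (X, c_{X,-})`. -/
def iotaPlus (C : Type u) [Category.{v} C] [MonoidalCategory C] [BraidedCategory C] :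
    C ⥤ Center C := Center.ofBraided C

/-- The functor `ι₋ : C ⥤ Z(C)`, `X ↦ (X, c_{-,X}⁻¹)`. -/
def iotaMinus (C : Type u) [Category.{v} C] [MonoidalCategory C] [BraidedCategory C] :
    C ⥤ Center C where
  obj X := ⟨X,
    { β := fun U => (β_ U X).symm
      monoidal := fun U U' => by simp
      naturality := fun f => by simp }⟩
  map f := ⟨f, fun U => by simp⟩

/-- The algebra `ι₊(A)` in `Z(C)`, for an algebra `A` in `C`. -/
@[reducible]
def iotaPlusAlgebra [BraidedCategory C] (A : C) [MonObj A] : MonObj ((iotaPlus C).obj A) :=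
  (Center.ofBraided C).monObjObj A

end Braided
section
variable (k : Type w) [Field k] (C : Type u) [Category.{v} C] [Preadditive C] [Linear k C]
  [MonoidalCategory C] [MonoidalPreadditive C] [MonoidalLinear k C]

/-- The bifunctor `(X, Y) ↦ ι₊(X) ⊗ ι₋(Y)`. -/
def iotaPair [BraidedCategory C] : C ⥤ C ⥤ Center C :=
  iotaPlus C ⋙ curriedTensor (Center C) ⋙ (Functor.whiskeringLeft C _ _).obj (iotaMinus C)

theorem iotaPair_isBilinear [BraidedCategory C] : IsBilinear k (iotaPair C) where
  map_add_left f g _ := Center.ext _ _ (MonoidalPreadditive.add_whiskerRight f g)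
  map_smul_left a f Y := Center.ext _ _ (MonoidalLinear.smul_whiskerRight a f Y)
  map_add_right X _ _ f g := Center.ext _ _ (MonoidalPreadditive.whiskerLeft_add (X := X) f g)
  map_smul_right X _ _ a f := Center.ext _ _ (MonoidalLinear.whiskerLeft_smul X a f)

/-- The functor `C ⊠ C ⥤ Z(C)` with `X ⊠ Y ↦ ι₊(X) ⊗ ι₋(Y)`. -/
def centerFunctor [BraidedCategory C] [HasFiniteBiproducts C] [IsIdempotentComplete C] :
    DeligneProd k C ⥤ Center C :=
  extend (LinProd.lift (iotaPair C) (iotaPair_isBilinear k C))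

variable {C} in
def centerFunctorBoxIso [BraidedCategory C] [HasFiniteBiproducts C] [IsIdempotentComplete C]
    (X Y : C) : (centerFunctor k C).obj (boxObj k X Y) ≅
      (iotaPlus C).obj X ⊗ (iotaMinus C).obj Y :=
  (toEnvelopeExtendIso (LinProd.lift (iotaPair C) (iotaPair_isBilinear k C))).app ⟨X, Y⟩

end

section Ribbon

variable (C : Type u) [Category.{v} C] [MonoidalCategory C] [RightRigidCategory C]

/-- A ribbon structure on a rigid braided category: a self-dual twist. -/
structure RibbonStructure [BraidedCategory C] where
  θ : ∀ X : C, X ≅ X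
  naturality : ∀ {X Y : C} (f : X ⟶ Y), f ≫ (θ Y).hom = (θ X).hom ≫ f
  tensor : ∀ X Y : C, (θ (X ⊗ Y)).hom =
    (β_ X Y).hom ≫ ((θ Y).hom ⊗ₘ (θ X).hom) ≫ (β_ Y X).hom
  dual : ∀ X : C, (θ Xᘁ).hom = (θ X).homᘁ

variable {C} in
/-- The trace of an endomorphism in a ribbon category. -/
def RibbonStructure.trace [BraidedCategory C] (r : RibbonStructure C) {X : C} (f : X ⟶ X) :
    𝟙_ C ⟶ 𝟙_ C :=
  η_ X Xᘁ ≫ (((r.θ X).hom ≫ f) ▷ Xᘁ) ≫ (β_ X Xᘁ).hom ≫ ε_ X Xᘁ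

/-- A pivotal structure on a rigid category: a monoidal natural isomorphism `X ≅ X^∨∨`. -/
structure PivotalStructure where
  φ : ∀ X : C, X ≅ (Xᘁ : C)ᘁ
  naturality : ∀ {X Y : C} (f : X ⟶ Y), f ≫ (φ Y).hom = (φ X).hom ≫ ((fᘁ : (Yᘁ : C) ⟶ Xᘁ)ᘁ)
  tensor : ∀ X Y : C, (φ (X ⊗ Y)).hom ≫ ((rightDualTensorIso X Y).inv)ᘁ ≫
    (rightDualTensorIso Yᘁ Xᘁ).hom = (φ X).hom ⊗ₘ (φ Y).hom

namespace PivotalStructure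

variable {C} (P : PivotalStructure C)

/-- `𝟙 ⟶ X ⊗ X^∨ ⟶ X^∨∨ ⊗ X^∨ ⟶ 𝟙` -/
def rightTrace {X : C} (f : X ⟶ X) : 𝟙_ C ⟶ 𝟙_ C :=
  η_ X Xᘁ ≫ ((f ≫ (P.φ X).hom) ▷ Xᘁ) ≫ ε_ Xᘁ Xᘁᘁ

/-- `𝟙 ⟶ X^∨ ⊗ X^∨∨ ⟶ X^∨ ⊗ X ⟶ 𝟙` -/
def leftTrace {X : C} (f : X ⟶ X) : 𝟙_ C ⟶ 𝟙_ C :=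
  η_ Xᘁ Xᘁᘁ ≫ (Xᘁ ◁ ((P.φ X).inv ≫ f)) ≫ ε_ X Xᘁ

/-- A pivotal structure is spherical if left and right traces agree. -/
def IsSpherical : Prop := ∀ {X : C} (f : X ⟶ X), P.leftTrace f = P.rightTrace f

end PivotalStructure

variable (k : Type w) [Field k] [Preadditive C] [Linear k C]

/-- The endomorphisms of the unit object are the scalars. -/
def UnitEndScalar : Prop := Function.Bijective (fun a : k => a • 𝟙 (𝟙_ C))

/-- Nondegeneracy of the pairings `C(X, Y) ⊗ C(Y, X) ⟶ k`, `f ⊗ g ↦ tr (f g)`. -/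
def TracePairingNondegenerate (tr : ∀ {X : C}, (X ⟶ X) → (𝟙_ C ⟶ 𝟙_ C)) : Prop :=
  ∀ X Y : C, (∀ f : X ⟶ Y, (∀ g : Y ⟶ X, tr (f ≫ g) = 0) → f = 0) ∧
    (∀ g : Y ⟶ X, (∀ f : X ⟶ Y, tr (f ≫ g) = 0) → g = 0)

/-- `C` can be given the structure of a pure ribbon category. -/
def IsPureRibbon : Prop := UnitEndScalar C k ∧
  ∃ (_ : BraidedCategory C) (r : RibbonStructure C), TracePairingNondegenerate C r.trace

/-- `C` can be given the structure of a pure spherical category. -/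
def IsPureSpherical : Prop := UnitEndScalar C k ∧
  ∃ P : PivotalStructure C, P.IsSpherical ∧ TracePairingNondegenerate C P.rightTrace

end Ribbon

section Modular

instance (C : Type u) [Category.{v} C] [Abelian C] : HasFiniteBiproducts C :=
  Abelian.hasFiniteBiproducts

/-- Finitely many isomorphism classes of simple objects. -/
def HasFinitelyManySimples (C : Type u) [Category.{v} C] [HasZeroMorphisms C] : Prop :=
  ∃ (n : ℕ) (S : Fin n → C), ∀ X : C, Simple X → ∃ i, Nonempty (X ≅ S i)

/-- Every object is a finite direct sum of simple objects. -/
def IsSemisimple (C : Type u) [Category.{v} C] [Preadditive C] [HasFiniteBiproducts C] : Prop :=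
  ∀ X : C, ∃ (n : ℕ) (S : Fin n → C), (∀ i, Simple (S i)) ∧ Nonempty (X ≅ ⨁ S)

/-- Modular categories: semisimple ribbon categories with finitely many simple objects and
`End 𝟙 = k`, that are nondegenerate in the sense that `C ⊠ C ⥤ Z(C)` is an equivalence. -/
structure IsModular (k : Type w) [Field k] (C : Type u) [Category.{v} C] [Abelian C] [Linear k C]
    [MonoidalCategory C] [MonoidalPreadditive C] [MonoidalLinear k C] [RightRigidCategory C]
    [BraidedCategory C] : Prop where
  unit : UnitEndScalar C k
  semisimple : IsSemisimple C
  finite : HasFinitelyManySimples C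
  ribbon : Nonempty (RibbonStructure C)
  nondegenerate : (centerFunctor k C).IsEquivalence

end Modular

section Algebras

open scoped MonObj

variable {C : Type u} [Category.{v} C] [MonoidalCategory C]

/-- Algebra homomorphisms in `C` from (the underlying object of) an algebra `Z` in `Z(C)` to an
algebra `A` in `C`. -/
structure IsAlgHomToBase {Z : Center C} (m : MonObj Z) {A : C} [MonObj A] (ζ : Z.1 ⟶ A) : Prop where
  one : m.one.f ≫ ζ = η[A]
  mul : m.mul.f ≫ ζ = (ζ ⊗ₘ ζ) ≫ μ[A]

/-- The centrality condition on a morphism `ζ : Z ⟶ A` in `C`, for `Z` in `Z(C)`. -/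
def IsCentral (A : C) [MonObj A] (Z : Center C) (ζ : Z.1 ⟶ A) : Prop :=
  (ζ ▷ A) ≫ μ[A] = (Z.2.β A).hom ≫ (A ◁ ζ) ≫ μ[A]

/-- `(Z, ζ)` is a full centre of the algebra `A`. -/
structure IsFullCentre (A : C) [MonObj A] (Z : Center C) (ζ : Z.1 ⟶ A) : Prop where
  central : IsCentral A Z ζ
  terminal : ∀ (W : Center C) (ω : W.1 ⟶ A), IsCentral A W ω → ∃! f : W ⟶ Z, f.f ≫ ζ = ω

variable {D : Type*} [Category* D] [MonoidalCategory D] [BraidedCategory D]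

/-- The left centrality condition on a morphism `y : Y ⟶ B`. -/
def IsLeftCentral {B : D} (m : MonObj B) {Y : D} (y : Y ⟶ B) : Prop :=
  (y ▷ B) ≫ m.mul = (β_ Y B).hom ≫ (B ◁ y) ≫ m.mul

/-- `(L, l)` is a left centre of the algebra `B`. -/
structure IsLeftCentre {B : D} (m : MonObj B) (L : D) (l : L ⟶ B) : Prop where
  central : IsLeftCentral m l
  terminal : ∀ (Y : D) (y : Y ⟶ B), IsLeftCentral m y → ∃! f : Y ⟶ L, f ≫ l = y

/-- The tensor product of two algebras in a braided category, with multiplication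
`A ⊗ B ⊗ A ⊗ B ⟶ A ⊗ A ⊗ B ⊗ B ⟶ A ⊗ B`, the first map being given by `c_{A,B}⁻¹`. -/
@[reducible]
def tensorAlgebra {A B : D} (m : MonObj A) (n : MonObj B) : MonObj (A ⊗ B) :=
  letI := reverseBraiding D
  inferInstance

theorem tensorAlgebra_mul {A B : D} (m : MonObj A) (n : MonObj B) :
    (tensorAlgebra m n).mul = (α_ A B (A ⊗ B)).hom ≫
      A ◁ ((α_ B A B).inv ≫ (β_ A B).inv ▷ B ≫ (α_ A B B).hom) ≫ (α_ A A (B ⊗ B)).inv ≫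
        (m.mul ⊗ₘ n.mul) := by
  let _ := reverseBraiding D
  change tensorμ A B A B ≫ _ = _
  simp [tensorμ]
  rfl

/-- Homomorphisms of algebras. -/
structure IsAlgHom {A B : D} (m : MonObj A) (n : MonObj B) (f : A ⟶ B) : Prop where
  one : m.one ≫ f = n.one
  mul : m.mul ≫ f = (f ⊗ₘ f) ≫ n.mul

/-- Commutative algebras in a braided category. -/
def IsCommAlg {B : D} (m : MonObj B) : Prop := (β_ B B).hom ≫ m.mul = m.mul

end Algebras

section Evaluation

variable (k : Type w) [Field k] {C : Type u} [Category.{v} C] [Abelian C] [Linear k C]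
  [MonoidalCategory C] [MonoidalPreadditive C] [MonoidalLinear k C] [RightRigidCategory C]
  [BraidedCategory C]

/-- For a cowedge `Y^∨ ⊠ Y ⟶ R̃`, the condition that a morphism `R̃ ⟶ 𝟙` in `C` (from the
underlying object of the image of `R̃` in `Z(C)`) is given on each `Y^∨ ⊠ Y` by the evaluation
`Y^∨ ⊗ Y ⟶ 𝟙`. -/
def IsEvaluation (c : Cowedge (dualBox k C))
    (ε : ((centerFunctor k C).obj c.pt).1 ⟶ 𝟙_ C) : Prop :=
  ∀ Y : C, ((centerFunctor k C).map (c.π Y)).f ≫ ε =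
    (centerFunctorBoxIso k Yᘁ Y).hom.f ≫ ε_ Y Yᘁ

end Evaluation

end CentreOfAlgebra

end

open CentreOfAlgebra

/-!
The proof rests on a trace. A ribbon or spherical pivotal structure with nondegenerate trace pairings
gives a `k`-valued trace `tr` on `C` that is multiplicative for `⊗` (`nonempty_multiplicativeTrace`).
In an abelian category such a trace vanishes on nilpotent endomorphisms, and in combination with the
nondegeneracy this makes all endomorphism algebras semisimple. In particular (`SemisimpleTrace`)
every `k`-linear subfunctor of a representable or corepresentable functor is given by a direct
summand, and `Hom(X, Y)` and `Hom(Y, X)` have dual bases. The trace extends to `C ⊠ C` by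
`tr (f ⊠ g) = tr f * tr g`, and is again nondegenerate; it is the trace in `C` of the image under
`T`, which shows that it vanishes on nilpotents.

*The coend.* If there are finitely many simple objects, their direct sum `G` has every object as a
direct summand of a power, so a dinatural family on `Y^∨ ⊠ Y` amounts to a morphism out of
`G^∨ ⊠ G` that coequalizes the two actions of `End G`. These morphisms form a subfunctor of a
corepresentable functor, and the corresponding direct summand of `G^∨ ⊠ G` is the coend
(`MultiplicativeTrace.exists_coend`). For each `X`, the functor `(X ⊠ 𝟙) ⊗ -` has a right adjoint,
namely multiplication by a left dual of `X`, so it preserves coends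
(`nonempty_isColimit_mulCowedge`).

*The adjunction.* Let `R X` be the coend of `(X ⊗ Y^∨) ⊠ Y`. The coprojections induce a map
`Φ : C(A, X ⊗ B^∨) ⟶ Hom(A ⊠ B, R X)`, and the claim `T ⊣ R` amounts to `Φ` being bijective
(`TensorCoend.Φ_bijective`). For `ψ : X ⊗ B^∨ ⟶ A` and dual bases `gᵢ`, `gᵢ'` of `C(B, Y)` and
`C(Y, B)`, the elements `∑ (X ⊗ gᵢ^∨ ≫ ψ) ⊗ gᵢ'` form a dinatural family, hence a morphism
`φ : R X ⟶ A ⊠ B`, for which `tr (Φ h ≫ φ) = tr (h ≫ ψ)`. So `Φ` is injective by the nondegeneracy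
in `C`, and surjective by the nondegeneracy in `C ⊠ C`, since a morphism `R X ⟶ A ⊠ B` vanishes if
it pairs to zero with the image of `Φ`. This proves the first part for any additive functor `F` with
`F (X ⊠ Y) ≅ X ⊗ Y` in place of `T` (`TensorCoend.exists_adjunction`).

*The modular case.* A modular category is pure ribbon (`IsModular.isPureRibbon`). The composite of
`C ⊠ C ⥤ Z(C)` with the forgetful functor is such a functor `F`, so that the image of `R̃` in the
centre is cofree on `𝟙`: composition with `ε` identifies the morphisms `W ⟶ R̃` in `Z(C)` with the
morphisms `W ⟶ 𝟙` in `C` (`IsModular.exists_isEvaluation`). The algebra structure on `R̃` is lifted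
along this identification (`existsUnique_monObj`). By duality `ι₊ A ⊗ R̃` is cofree on `A`
(`bijective_comp_whiskerLeft`), with the universal morphism `A ⊗ ε` an algebra homomorphism. For an
algebra that is cofree on `A`, a morphism to it is left central if and only if the corresponding
morphism to `A` is central, because both conditions may be compared after composition with the split
epimorphism to `A` (`isLeftCentral_iff_isCentral`). So its left centre is the full centre of `A`
(`IsLeftCentre.isFullCentre`). It exists because the left central morphisms form a subfunctor of a
representable functor on `Z(C)`, on which the trace of `C` is nondegenerate
(`MultiplicativeTrace.center`, `exists_isLeftCentre`).
-/

noncomputable section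

namespace CentreOfAlgebra

/-! ### Nondegenerate traces and von Neumann regularity -/

/-- The `k`-linear structure of the opposite category. -/
instance linearOpposite (k : Type*) [Field k] (A : Type*) [Category* A] [Preadditive A]
    [Linear k A] : Linear k Aᵒᵖ where
  homModule X Y :=
    { smul := fun a f => (a • f.unop).op
      one_smul := fun f => Quiver.Hom.unop_inj (one_smul k f.unop)
      mul_smul := fun a b f => Quiver.Hom.unop_inj (mul_smul a b f.unop)
      smul_zero := fun a => Quiver.Hom.unop_inj (smul_zero (A := Y.unop ⟶ X.unop) a)
      smul_add := fun a f g => Quiver.Hom.unop_inj (smul_add a f.unop g.unop)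
      add_smul := fun a b f => Quiver.Hom.unop_inj (add_smul a b f.unop)
      zero_smul := fun f => Quiver.Hom.unop_inj (zero_smul k f.unop) }
  smul_comp _ _ _ a f g := Quiver.Hom.unop_inj (Linear.comp_smul _ _ _ g.unop a f.unop)
  comp_smul _ _ _ f a g := Quiver.Hom.unop_inj (Linear.smul_comp _ _ _ a g.unop f.unop)

/-- A `k`-linear trace on the endomorphisms of a `k`-linear category, for which the pairings
`tr (f ≫ g)` are nondegenerate and which vanishes on nilpotent endomorphisms. When the `Hom` spaces
are finite-dimensional, such a trace forces the endomorphism algebras to be semisimple. -/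
structure SemisimpleTrace (k : Type*) [Field k] (A : Type*) [Category* A] [Preadditive A]
    [Linear k A] where
  tr : ∀ {X : A}, (X ⟶ X) →ₗ[k] k
  cyc : ∀ {X Y : A} (f : X ⟶ Y) (g : Y ⟶ X), tr (f ≫ g) = tr (g ≫ f)
  nondeg : ∀ {X Y : A} (f : X ⟶ Y), (∀ g : Y ⟶ X, tr (f ≫ g) = 0) → f = 0
  nil : ∀ {X : A} (f : End X), IsNilpotent f → tr (X := X) f = 0

namespace SemisimpleTrace

variable {k : Type*} [Field k] {A : Type*} [Category* A] [Preadditive A] [Linear k A]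
  (τ : SemisimpleTrace k A)

include τ

theorem nondeg' {X Y : A} (g : Y ⟶ X) (h : ∀ f : X ⟶ Y, τ.tr (f ≫ g) = 0) : g = 0 :=
  τ.nondeg g fun f => by rw [τ.cyc, h]

/-- The trace on the opposite category. -/
def op : SemisimpleTrace k Aᵒᵖ where
  tr {X} := τ.tr ∘ₗ
    { toFun := fun f => f.unop
      map_add' := fun _ _ => rfl
      map_smul' := fun _ _ => rfl }
  cyc f g := τ.cyc g.unop f.unop
  nondeg f h := Quiver.Hom.unop_inj (τ.nondeg' f.unop fun g => h g.op)
  nil {X} f hf := by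
    obtain ⟨n, hn⟩ := hf
    refine τ.nil (X := X.unop) f.unop ⟨n, ?_⟩
    have h : ∀ m : ℕ, (show End X.unop from f.unop) ^ m = (show End X from f ^ m).unop := by
      intro m
      induction m with
      | zero => rfl
      | succ m ih =>
        rw [pow_succ', ih, pow_succ]
        rfl
    rw [h, hn]
    rfl

variable [∀ X Y : A, Module.Finite k (X ⟶ Y)]

theorem isSemisimpleRing_end (X : A) : IsSemisimpleRing (End X) := by
  have : Module.Finite k (End X) := inferInstanceAs (Module.Finite k (X ⟶ X))
  have : IsArtinianRing (End X) := IsArtinianRing.of_finite k (End X)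
  rw [IsArtinianRing.isSemisimpleRing_iff_jacobson, eq_bot_iff]
  intro f hf
  -- `f ≫ g` lies in the Jacobson radical, which is nilpotent
  refine τ.nondeg (X := X) f fun g => τ.nil (X := X) _ ?_
  have hfg : (show End X from g) * f ∈ Ring.jacobson (End X) := Ideal.mul_mem_left _ _ hf
  obtain ⟨n, hn⟩ := IsSemiprimaryRing.isNilpotent (R := End X)
  refine ⟨n, ?_⟩
  have := Ideal.pow_mem_pow hfg n
  rw [hn] at this
  exact this

/-- A `k`-linear subfunctor of a corepresentable functor is corepresented by a direct summand. -/
theorem exists_idempotent {P : A} (S : ∀ W : A, Set (P ⟶ W)) (zero : 0 ∈ S P)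
    (add : ∀ f ∈ S P, ∀ g ∈ S P, f + g ∈ S P)
    (comp : ∀ (W W' : A) (f : P ⟶ W) (g : W ⟶ W'), f ∈ S W → f ≫ g ∈ S W') :
    ∃ e ∈ S P, ∀ (W : A), ∀ f ∈ S W, e ≫ f = f := by
  have := τ.isSemisimpleRing_end P
  -- composition in `End P` is in the reverse order, so that `S P` is a left ideal
  let I : Ideal (End P) :=
    { carrier := S P
      zero_mem' := zero
      add_mem' := fun ha hb => add _ ha _ hb
      smul_mem' := fun c x hx => comp P P x c hx }
  obtain ⟨e, he, hI⟩ := IsSemisimpleRing.ideal_eq_span_idempotent I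
  have heI : e ∈ I := by rw [hI]; exact Ideal.subset_span rfl
  refine ⟨e, heI, fun W f hf => ?_⟩
  rw [eq_comm, ← sub_eq_zero]
  refine τ.nondeg _ fun g => ?_
  have h1 : (show End P from f ≫ g) ∈ I := comp _ _ f g hf
  rw [hI, Ideal.mem_span_singleton'] at h1
  obtain ⟨x, hx⟩ := h1
  have h2 : e ≫ (e ≫ (show P ⟶ P from x)) = e ≫ (show P ⟶ P from x) := by
    rw [← Category.assoc]
    exact congrArg (· ≫ (show P ⟶ P from x)) he
  have h3 : f ≫ g = e ≫ (show P ⟶ P from x) := hx.symm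
  rw [Preadditive.sub_comp, Category.assoc, h3, h2, sub_self, map_zero]

/-- A `k`-linear subfunctor of a representable functor is represented by a direct summand. -/
theorem exists_idempotent' {P : A} (S : ∀ W : A, Set (W ⟶ P)) (zero : 0 ∈ S P)
    (add : ∀ f ∈ S P, ∀ g ∈ S P, f + g ∈ S P)
    (comp : ∀ (W W' : A) (f : W ⟶ P) (g : W' ⟶ W), f ∈ S W → g ≫ f ∈ S W') :
    ∃ e ∈ S P, ∀ (W : A), ∀ f ∈ S W, f ≫ e = f := by
  have : ∀ X Y : Aᵒᵖ, Module.Finite k (X ⟶ Y) := fun X Y =>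
    Module.Finite.equiv
      ({ toFun := fun f => f.op
         invFun := fun f => f.unop
         map_add' := fun _ _ => rfl
         map_smul' := fun _ _ => rfl } : (Y.unop ⟶ X.unop) ≃ₗ[k] (X ⟶ Y))
  obtain ⟨e, he, h⟩ := τ.op.exists_idempotent (P := Opposite.op P)
    (fun W => {f | f.unop ∈ S W.unop}) zero
    (fun f hf g hg => add _ hf _ hg) (fun W W' f g hf => comp _ _ f.unop g.unop hf)
  exact ⟨e.unop, he, fun W f hf => Quiver.Hom.op_inj (h (Opposite.op W) f.op hf)⟩

/-- Every morphism is von Neumann regular. -/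
theorem exists_comp_comp_eq {X Y : A} (f : X ⟶ Y) : ∃ g : Y ⟶ X, f ≫ g ≫ f = f := by
  obtain ⟨e, ⟨g, hg⟩, h⟩ := τ.exists_idempotent (P := X) (fun W => {x | ∃ y : Y ⟶ W, f ≫ y = x})
    ⟨0, comp_zero⟩
    (by
      rintro _ ⟨y, rfl⟩ _ ⟨y', rfl⟩
      exact ⟨y + y', Preadditive.comp_add _ _ _ _ _ _⟩)
    (by
      rintro W W' _ g ⟨y, rfl⟩
      exact ⟨y ≫ g, (Category.assoc _ _ _).symm⟩)
  refine ⟨g, ?_⟩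
  rw [← Category.assoc, hg]
  exact h Y f ⟨𝟙 Y, Category.comp_id f⟩

theorem finrank_le (X Y : A) : Module.finrank k (X ⟶ Y) ≤ Module.finrank k (Y ⟶ X) := by
  let Φ : (X ⟶ Y) →ₗ[k] Module.Dual k (Y ⟶ X) :=
    LinearMap.mk₂ k (fun f g => τ.tr (f ≫ g)) (by simp) (by simp) (by simp) (by simp)
  have hΦ : Function.Injective Φ := (injective_iff_map_eq_zero Φ).2 fun f hf =>
    τ.nondeg f fun g => LinearMap.congr_fun hf g
  simpa only [Subspace.dual_finrank_eq] using LinearMap.finrank_le_finrank_of_injective hΦ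

/-- Bases of `Hom(X, Y)` and `Hom(Y, X)` that are dual for the trace pairing. -/
theorem exists_dualBases (X Y : A) : ∃ (n : ℕ) (g : Fin n → (X ⟶ Y)) (g' : Fin n → (Y ⟶ X)),
    (∀ x, x = ∑ i, τ.tr (x ≫ g' i) • g i) ∧ (∀ y, y = ∑ i, τ.tr (g i ≫ y) • g' i) := by
  let Φ : (Y ⟶ X) →ₗ[k] Module.Dual k (X ⟶ Y) :=
    LinearMap.mk₂ k (fun g f => τ.tr (f ≫ g)) (by simp) (by simp) (by simp) (by simp)
  have hΦ : Function.Injective Φ := (injective_iff_map_eq_zero Φ).2 fun f hf =>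
    τ.nondeg' f fun g => LinearMap.congr_fun hf g
  have hd : Module.finrank k (Y ⟶ X) = Module.finrank k (Module.Dual k (X ⟶ Y)) := by
    rw [Subspace.dual_finrank_eq]
    exact le_antisymm (τ.finrank_le _ _) (τ.finrank_le _ _)
  let e := LinearEquiv.ofInjectiveOfFinrankEq Φ hΦ hd
  let b := Module.finBasis k (X ⟶ Y)
  have h1 : ∀ (x : X ⟶ Y) i, τ.tr (x ≫ e.symm (b.coord i)) = b.repr x i := fun x i =>
    LinearMap.congr_fun (e.apply_symm_apply (b.coord i)) x
  have h2 : ∀ x, x = ∑ i, τ.tr (x ≫ e.symm (b.coord i)) • b i := fun x => by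
    simp only [h1]
    exact (b.sum_repr x).symm
  refine ⟨_, b, fun i => e.symm (b.coord i), h2, fun y => hΦ ?_⟩
  ext x
  change τ.tr (x ≫ y) = τ.tr (x ≫ _)
  conv_lhs => rw [h2 x]
  simp only [Preadditive.sum_comp, Preadditive.comp_sum, Linear.smul_comp, Linear.comp_smul,
    map_sum, map_smul, smul_eq_mul, mul_comm]

end SemisimpleTrace

end CentreOfAlgebra

end

noncomputable section

namespace CentreOfAlgebra

/-! ### Traces from pivotal and ribbon structures -/

section

variable {C : Type u} [Category.{v} C] [MonoidalCategory C]

section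

variable [BraidedCategory C]

/-- A strand passes across a cap. -/
theorem braiding_slide_cap {A B : C} (W : C) (h : A ⊗ B ⟶ 𝟙_ C) :
    (β_ W A).hom ▷ B ⊗≫ A ◁ (β_ W B).hom ⊗≫ h ▷ W = 𝟙 _ ⊗≫ W ◁ h ⊗≫ 𝟙 _ := by
  have h1 := BraidedCategory.braiding_naturality_right W h
  rw [BraidedCategory.braiding_tensor_right_hom, braiding_tensorUnit_right] at h1
  calc _ = (α_ W A B).hom ≫ ((α_ W A B).inv ≫ (β_ W A).hom ▷ B ≫ (α_ A W B).hom ≫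
          A ◁ (β_ W B).hom ≫ (α_ A B W).inv) ≫ h ▷ W := by monoidal
    _ = (α_ W A B).hom ≫ W ◁ h ≫ (ρ_ W).hom ≫ (λ_ W).inv := by rw [h1]
    _ = _ := by monoidal

/-- The caps `b` and `a`, each closed up with a crossing, are nested into one another at the price
of a full twist of the two strands. -/
theorem braiding_nested_caps (X Y X' Y' : C) (a : X' ⊗ X ⟶ 𝟙_ C) (b : Y' ⊗ Y ⟶ 𝟙_ C) :
   ((β_ X Y).hom ≫ (β_ Y X).hom) ▷ (Y' ⊗ X') ≫ (β_ (X ⊗ Y) (Y' ⊗ X')).hom ≫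
      (𝟙 _ ⊗≫ Y' ◁ a ▷ Y ⊗≫ b) =
    𝟙 _ ⊗≫ X ◁ ((β_ Y Y').hom ≫ b) ▷ X' ⊗≫ (β_ X X').hom ≫ a := by
  have h1 : X ◁ (β_ Y X').hom ⊗≫ ((β_ X X').hom ≫ a) ▷ Y =
      𝟙 _ ⊗≫ (β_ Y X).inv ▷ X' ⊗≫ Y ◁ ((β_ X X').hom ≫ a) ⊗≫ 𝟙 _ := by
    have := braiding_slide_cap Y ((β_ X X').hom ≫ a)
    calc _ = 𝟙 _ ⊗≫ ((β_ Y X).inv ≫ (β_ Y X).hom) ▷ X' ⊗≫ X ◁ (β_ Y X').hom ⊗≫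
            ((β_ X X').hom ≫ a) ▷ Y := by
            rw [Iso.inv_hom_id]; monoidal
      _ = 𝟙 _ ⊗≫ (β_ Y X).inv ▷ X' ⊗≫ ((β_ Y X).hom ▷ X' ⊗≫ X ◁ (β_ Y X').hom ⊗≫
            ((β_ X X').hom ≫ a) ▷ Y) := by monoidal
      _ = _ := by rw [this]; monoidal
  have h2 : (β_ Y X).hom ▷ Y' ≫ (β_ (X ⊗ Y) Y').hom ≫ Y' ◁ (β_ Y X).inv = (β_ (Y ⊗ X) Y').hom := by
    rw [BraidedCategory.braiding_naturality_left_assoc, ← MonoidalCategory.whiskerLeft_comp,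
      Iso.hom_inv_id]
    simp
  rw [BraidedCategory.braiding_tensor_left_hom] at h2
  have h3 : (β_ Y X).hom ▷ Y' ⊗≫ X ◁ (β_ Y Y').hom ⊗≫ (β_ X Y').hom ▷ Y ⊗≫ Y' ◁ (β_ Y X).inv =
    𝟙 _ ⊗≫ Y ◁ (β_ X Y').hom ⊗≫ (β_ Y Y').hom ▷ X ⊗≫ 𝟙 _ := by
    rw [BraidedCategory.braiding_tensor_left_hom] at h2
    calc _ = (β_ Y X).hom ▷ Y' ≫ ((α_ _ _ _).hom ≫ X ◁ (β_ Y Y').hom ≫ (α_ _ _ _).inv ≫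
            (β_ X Y').hom ▷ Y ≫ (α_ _ _ _).hom) ≫ Y' ◁ (β_ Y X).inv := by monoidal
      _ = _ := by rw [h2]; monoidal
  have h4 := braiding_slide_cap X ((β_ Y Y').hom ≫ b)
  calc _ = ((β_ X Y).hom ≫ (β_ Y X).hom) ▷ (Y' ⊗ X') ⊗≫
          X ◁ (β_ Y Y').hom ▷ X' ⊗≫ ((X ⊗ Y') ◁ (β_ Y X').hom ≫ (β_ X Y').hom ▷ (X' ⊗ Y)) ⊗≫
          Y' ◁ ((β_ X X').hom ≫ a) ▷ Y ⊗≫ b := by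
        rw [BraidedCategory.braiding_tensor_left_hom, BraidedCategory.braiding_tensor_right_hom,
          BraidedCategory.braiding_tensor_right_hom]
        monoidal
    _ = ((β_ X Y).hom ≫ (β_ Y X).hom) ▷ (Y' ⊗ X') ⊗≫
          X ◁ (β_ Y Y').hom ▷ X' ⊗≫ (β_ X Y').hom ▷ (Y ⊗ X') ⊗≫
          Y' ◁ (X ◁ (β_ Y X').hom ⊗≫ ((β_ X X').hom ≫ a) ▷ Y) ⊗≫ b := by
        rw [whisker_exchange]
        monoidal
    _ = (β_ X Y).hom ▷ (Y' ⊗ X') ⊗≫ ((β_ Y X).hom ▷ Y' ⊗≫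
          X ◁ (β_ Y Y').hom ⊗≫ (β_ X Y').hom ▷ Y ⊗≫ Y' ◁ (β_ Y X).inv) ▷ X' ⊗≫
          ((Y' ⊗ Y) ◁ ((β_ X X').hom ≫ a) ≫ b ▷ 𝟙_ C) ⊗≫ 𝟙 _ := by
        rw [h1]
        monoidal
    _ = 𝟙 _ ⊗≫ ((β_ X Y).hom ▷ Y' ⊗≫ Y ◁ (β_ X Y').hom ⊗≫ ((β_ Y Y').hom ≫ b) ▷ X) ▷ X' ⊗≫
          (β_ X X').hom ≫ a := by
        rw [h3, whisker_exchange]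
        monoidal
    _ = _ := by
        rw [h4]
        monoidal

end

variable [RightRigidCategory C]

variable (C) in
/-- A dinatural family of morphisms `X ⊗ X^∨ ⟶ 𝟙`, compatible with tensor products. Pivotal and
ribbon structures both produce one, and it suffices to define a multiplicative trace. -/
structure TraceCap where
  cap : ∀ X : C, X ⊗ Xᘁ ⟶ 𝟙_ C
  dinatural : ∀ {X Y : C} (f : X ⟶ Y), f ▷ Yᘁ ≫ cap Y = X ◁ fᘁ ≫ cap X
  tensor : ∀ X Y : C, (X ⊗ Y) ◁ (rightDualTensorIso X Y).inv ≫ cap (X ⊗ Y) =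
    𝟙 _ ⊗≫ X ◁ cap Y ▷ Xᘁ ⊗≫ cap X

theorem coevaluation_comp_rightDualTensorIso (X Y : C) :
    η_ (X ⊗ Y) (X ⊗ Y)ᘁ ≫ (X ⊗ Y) ◁ (rightDualTensorIso X Y).hom =
      η_ X Xᘁ ⊗≫ (X ◁ η_ Y Yᘁ) ▷ Xᘁ ⊗≫ 𝟙 _ := by
  have h := @coevaluation_comp_rightAdjointMate C _ _ (X ⊗ Y) (X ⊗ Y) ⟨Yᘁ ⊗ Xᘁ⟩
    (RightRigidCategory.rightDual _) (𝟙 (X ⊗ Y))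
  rw [id_whiskerRight, Category.comp_id] at h
  exact h

theorem rightDualTensorIso_inv_comp_evaluation (X Y : C) :
    (rightDualTensorIso X Y).inv ▷ (X ⊗ Y) ≫ ε_ (X ⊗ Y) (X ⊗ Y)ᘁ =
      𝟙 _ ⊗≫ (Yᘁ : C) ◁ (ε_ X Xᘁ ▷ Y) ⊗≫ ε_ Y Yᘁ := by
  have h := @rightAdjointMate_comp_evaluation C _ _ (X ⊗ Y) (X ⊗ Y)
    (RightRigidCategory.rightDual _) ⟨Yᘁ ⊗ Xᘁ⟩ (𝟙 (X ⊗ Y))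
  rw [MonoidalCategory.whiskerLeft_id, Category.id_comp] at h
  exact h

namespace TraceCap

variable (P : TraceCap C)

/-- The trace of an endomorphism: its strand closed up by the coevaluation and the cap. -/
def trace {X : C} (f : X ⟶ X) : 𝟙_ C ⟶ 𝟙_ C := η_ X Xᘁ ≫ f ▷ Xᘁ ≫ P.cap X

theorem trace_comm {X Y : C} (f : X ⟶ Y) (g : Y ⟶ X) : P.trace (f ≫ g) = P.trace (g ≫ f) := by
  rw [trace, trace, comp_whiskerRight, comp_whiskerRight, Category.assoc, Category.assoc,
    P.dinatural f, ← whisker_exchange_assoc, ← Category.assoc, ← Category.assoc (η_ Y _),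
    coevaluation_comp_rightAdjointMate]

/-- The trace over the second tensor factor of an endomorphism of the form `f ⊗ g`. -/
theorem trace_tensorHom {X Y : C} (f : X ⟶ X) (g : Y ⟶ Y) :
    P.trace (f ⊗ₘ g) = η_ X Xᘁ ⊗≫ X ◁ (P.trace g) ▷ Xᘁ ⊗≫ f ▷ Xᘁ ≫ P.cap X := by
  have h1 : (f ⊗ₘ g) ▷ (X ⊗ Y)ᘁ ≫ P.cap (X ⊗ Y) = (X ⊗ Y) ◁ (rightDualTensorIso X Y).hom ≫
      (f ⊗ₘ g) ▷ (Yᘁ ⊗ Xᘁ) ≫ 𝟙 _ ⊗≫ X ◁ P.cap Y ▷ Xᘁ ⊗≫ P.cap X := by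
    rw [← P.tensor, whisker_exchange_assoc, ← MonoidalCategory.whiskerLeft_comp_assoc,
      Iso.hom_inv_id, MonoidalCategory.whiskerLeft_id, Category.id_comp]
  rw [trace, h1, ← Category.assoc, coevaluation_comp_rightDualTensorIso, trace]
  calc _ = η_ X Xᘁ ⊗≫ (X ◁ (η_ Y Yᘁ ≫ g ▷ Yᘁ)) ▷ Xᘁ ⊗≫
          (f ▷ (Y ⊗ Yᘁ) ≫ X ◁ P.cap Y) ▷ Xᘁ ⊗≫ P.cap X := by
        rw [tensorHom_def']
        monoidal
    _ = _ := by
        rw [← whisker_exchange]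
        monoidal

/-- The family given by `X ⊗ X^∨ ⟶ X^∨∨ ⊗ X^∨ ⟶ 𝟙` in a pivotal category. -/
def ofPivotal (P : PivotalStructure C) : TraceCap C where
  cap X := (P.φ X).hom ▷ Xᘁ ≫ ε_ Xᘁ Xᘁᘁ
  dinatural {X Y} f := by
    rw [← comp_whiskerRight_assoc, P.naturality, comp_whiskerRight_assoc,
      rightAdjointMate_comp_evaluation, whisker_exchange_assoc]
  tensor X Y := by
    have h : (P.φ (X ⊗ Y)).hom = ((P.φ X).hom ⊗ₘ (P.φ Y).hom) ≫
        (rightDualTensorIso Yᘁ Xᘁ).inv ≫ ((rightDualTensorIso X Y).hom)ᘁ := by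
      rw [← P.tensor]
      simp only [Category.assoc, Iso.hom_inv_id_assoc]
      rw [← comp_rightAdjointMate, Iso.hom_inv_id, rightAdjointMate_id, Category.comp_id]
    rw [whisker_exchange_assoc, h]
    simp only [comp_whiskerRight, Category.assoc]
    rw [← whisker_exchange_assoc, rightAdjointMate_comp_evaluation,
      ← MonoidalCategory.whiskerLeft_comp_assoc, Iso.inv_hom_id, MonoidalCategory.whiskerLeft_id,
      Category.id_comp, rightDualTensorIso_inv_comp_evaluation]
    calc _ = 𝟙 _ ⊗≫ X ◁ ((P.φ Y).hom ▷ Yᘁ) ▷ Xᘁ ⊗≫ ((P.φ X).hom ▷ ((Yᘁ)ᘁ ⊗ Yᘁ) ≫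
          (Xᘁ)ᘁ ◁ ε_ Yᘁ Yᘁᘁ) ▷ Xᘁ ⊗≫ ε_ Xᘁ Xᘁᘁ := by
          rw [tensorHom_def']
          monoidal
      _ = _ := by
          rw [← whisker_exchange]
          monoidal

/-- The family given by `X ⊗ X^∨ ⟶ X ⊗ X^∨ ⟶ X^∨ ⊗ X ⟶ 𝟙` in a ribbon category, the first two
morphisms being the twist of `X` and the braiding. -/
def ofRibbon [BraidedCategory C] (r : RibbonStructure C) : TraceCap C where
  cap X := (r.θ X).hom ▷ Xᘁ ≫ (β_ X Xᘁ).hom ≫ ε_ X Xᘁ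
  dinatural {X Y} f := by
    rw [← comp_whiskerRight_assoc, r.naturality, comp_whiskerRight_assoc,
      BraidedCategory.braiding_naturality_left_assoc, ← rightAdjointMate_comp_evaluation,
      ← BraidedCategory.braiding_naturality_right_assoc, whisker_exchange_assoc]
  tensor X Y := by
    have h : (r.θ (X ⊗ Y)).hom = ((r.θ X).hom ⊗ₘ (r.θ Y).hom) ≫ (β_ X Y).hom ≫ (β_ Y X).hom := by
      rw [r.tensor, BraidedCategory.braiding_naturality_assoc]
    rw [whisker_exchange_assoc, BraidedCategory.braiding_naturality_right_assoc,
      rightDualTensorIso_inv_comp_evaluation, h, comp_whiskerRight, Category.assoc,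
      braiding_nested_caps]
    calc _ = 𝟙 _ ⊗≫ X ◁ ((r.θ Y).hom ▷ Yᘁ) ▷ Xᘁ ⊗≫ ((r.θ X).hom ▷ (Y ⊗ Yᘁ) ≫
          X ◁ ((β_ Y Yᘁ).hom ≫ ε_ Y Yᘁ)) ▷ Xᘁ ⊗≫ (β_ X Xᘁ).hom ≫ ε_ X Xᘁ := by
          rw [tensorHom_def']
          monoidal
      _ = _ := by
          rw [← whisker_exchange]
          monoidal

theorem trace_ofPivotal (P : PivotalStructure C) {X : C} (f : X ⟶ X) :
    (ofPivotal P).trace f = P.rightTrace f := by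
  simp [trace, ofPivotal, PivotalStructure.rightTrace]

theorem trace_ofRibbon [BraidedCategory C] (r : RibbonStructure C) {X : C} (f : X ⟶ X) :
    (ofRibbon r).trace f = r.trace f := by
  rw [trace, ofRibbon, RibbonStructure.trace, ← r.naturality, comp_whiskerRight_assoc]

end TraceCap

end

end CentreOfAlgebra

end

noncomputable section

namespace CentreOfAlgebra

/-! ### The trace of a pure category -/

section

variable (k : Type w) [Field k] (C : Type u) [Category.{v} C] [Preadditive C] [Linear k C]
  [MonoidalCategory C]

/-- A semisimple trace on a monoidal category that is multiplicative for the tensor product. -/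
structure MultiplicativeTrace extends SemisimpleTrace k C where
  tensorHom : ∀ {X Y : C} (f : X ⟶ X) (g : Y ⟶ Y), tr (f ⊗ₘ g) = tr f * tr g

variable {k C}

/-- The identification of `k` with the endomorphisms of the unit object. -/
def unitEndEquiv (h : UnitEndScalar C k) : k ≃ₗ[k] (𝟙_ C ⟶ 𝟙_ C) :=
  LinearEquiv.ofBijective (LinearMap.toSpanSingleton k _ (𝟙 (𝟙_ C))) h

end

section

variable {k : Type w} [Field k] {C : Type u} [Category.{v} C] [Abelian C] [Linear k C]

/-- A cyclic functional vanishes on nilpotent endomorphisms: factor `f` through its image `K` as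
`e ≫ m`; then `f` and the endomorphism `m ≫ e` of `K` have the same value, and the order of
nilpotency of `m ≫ e` is smaller. -/
theorem cyclic_eq_zero_of_isNilpotent (t : ∀ {X : C}, (X ⟶ X) →ₗ[k] k)
    (cyc : ∀ {X Y : C} (f : X ⟶ Y) (g : Y ⟶ X), t (f ≫ g) = t (g ≫ f)) {X : C} (f : End X)
    (hf : IsNilpotent f) : t (X := X) f = 0 := by
  obtain ⟨n, hn⟩ := hf
  induction n generalizing X with
  | zero =>
    have h : f = 0 := by rw [← mul_one f, ← pow_zero f, hn, mul_zero]
    rw [h]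
    exact map_zero (t (X := X))
  | succ n ih =>
    obtain ⟨K, e, _, m, _, rfl⟩ : ∃ (K : C) (e : X ⟶ K) (_ : Epi e) (m : K ⟶ X) (_ : Mono m),
        e ≫ m = f :=
      ⟨_, factorThruImage _, inferInstance, image.ι _, inferInstance, image.fac (X := X) f⟩
    let g : End K := m ≫ e
    have h : ∀ j : ℕ, (show End X from e ≫ m) ^ (j + 1) = e ≫ (show K ⟶ K from g ^ j) ≫ m := by
      intro j
      induction j with
      | zero =>
        rw [zero_add, pow_one, pow_zero]
        exact congrArg (e ≫ ·) (Category.id_comp m).symm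
      | succ j hj =>
        rw [pow_succ' (show End X from e ≫ m), hj, pow_succ' g]
        change (e ≫ (show K ⟶ K from g ^ j) ≫ m) ≫ e ≫ m =
          e ≫ ((show K ⟶ K from g ^ j) ≫ m ≫ e) ≫ m
        simp only [Category.assoc]
    have hg : g ^ n = 0 := by
      have h0 := (h n).symm.trans hn
      rw [← Category.assoc] at h0
      exact zero_of_epi_comp e (zero_of_comp_mono m h0)
    exact (cyc e m).trans (ih g hg)

variable [MonoidalCategory C] [MonoidalPreadditive C] [MonoidalLinear k C] [RightRigidCategory C]

namespace TraceCap

variable (P : TraceCap C)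

/-- The trace of a family of caps, when its pairings are nondegenerate. -/
def multiplicativeTrace (h : UnitEndScalar C k) (nd : TracePairingNondegenerate C P.trace) :
    MultiplicativeTrace k C :=
  have cyc : ∀ {X Y : C} (f : X ⟶ Y) (g : Y ⟶ X), (unitEndEquiv h).symm (P.trace (f ≫ g)) =
    (unitEndEquiv h).symm (P.trace (g ≫ f)) := fun f g => by rw [P.trace_comm]
  let t : ∀ {X : C}, (X ⟶ X) →ₗ[k] k := fun {X} => (unitEndEquiv h).symm.toLinearMap ∘ₗ
      { toFun := P.trace
        map_add' := fun f g => by simp [trace]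
        map_smul' := fun a f => by simp [trace] }
  { tr := t
    cyc := cyc
    nondeg := fun {X Y} f hf => (nd X Y).1 f fun g =>
      (unitEndEquiv h).symm.injective ((hf g).trans (map_zero _).symm)
    nil := cyclic_eq_zero_of_isNilpotent t cyc
    tensorHom := fun {X Y} f g => by
      change (unitEndEquiv h).symm (P.trace (f ⊗ₘ g)) =
        (unitEndEquiv h).symm (P.trace f) * (unitEndEquiv h).symm (P.trace g)
      obtain ⟨b, hb⟩ := (unitEndEquiv h).surjective (P.trace g)
      have hb' : P.trace g = b • 𝟙 (𝟙_ C) := hb.symm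
      have h1 : P.trace (f ⊗ₘ g) = b • P.trace f := by
        rw [trace_tensorHom, hb', trace]
        simp [monoidalComp]
      rw [h1, ← hb, LinearEquiv.symm_apply_apply, map_smul, smul_eq_mul, mul_comm] }

end TraceCap

theorem nonempty_multiplicativeTrace (h : IsPureRibbon C k ∨ IsPureSpherical C k) :
    Nonempty (MultiplicativeTrace k C) := by
  rcases h with ⟨h, _, r, nd⟩ | ⟨h, P, -, nd⟩
  · refine ⟨(TraceCap.ofRibbon r).multiplicativeTrace h ?_⟩
    simp only [TracePairingNondegenerate, TraceCap.trace_ofRibbon]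
    exact nd
  · refine ⟨(TraceCap.ofPivotal P).multiplicativeTrace h ?_⟩
    simp only [TracePairingNondegenerate, TraceCap.trace_ofPivotal]
    exact nd

/-- In a pure category the right duals are also left duals. -/
theorem exists_exactPairing (h : IsPureRibbon C k ∨ IsPureSpherical C k) (X : C) :
    ∃ Y : C, Nonempty (ExactPairing Y X) := by
  refine ⟨Xᘁ, ?_⟩
  rcases h with ⟨_, _, _, _⟩ | ⟨_, P, _⟩
  · exact ⟨BraidedCategory.exactPairing_swap X Xᘁ⟩
  · exact ⟨exactPairingCongrRight (P.φ X)⟩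

/-- The unit is simple: it has a simple direct summand, and the corresponding idempotent is a
nonzero scalar. -/
theorem simple_unit (h : UnitEndScalar C k) (hs : IsSemisimple C) : Simple (𝟙_ C) := by
  obtain ⟨n, S, hS, ⟨e⟩⟩ := hs (𝟙_ C)
  have h1 : 𝟙 (𝟙_ C) ≠ 0 := fun h0 => one_ne_zero (α := k) (h.1 (by simp [h0]))
  have hn : Nonempty (Fin n) := by
    by_contra hn
    rw [not_nonempty_iff] at hn
    apply h1
    have h0 : e.hom = 0 := by
      ext j
      exact hn.elim j
    rw [← e.hom_inv_id, h0, zero_comp]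
  obtain ⟨j⟩ := hn
  have := hS j
  let i : S j ⟶ 𝟙_ C := biproduct.ι S j ≫ e.inv
  let p : 𝟙_ C ⟶ S j := e.hom ≫ biproduct.π S j
  have hip : i ≫ p = 𝟙 _ := by simp [i, p]
  obtain ⟨c, hc : c • 𝟙 (𝟙_ C) = p ≫ i⟩ := h.2 (p ≫ i)
  have hi : i ≠ 0 := fun h0 => id_nonzero (S j) (by rw [← hip, h0, zero_comp])
  have hc1 : c = 1 := by
    have h2 : c • i = i := by
      calc c • i = i ≫ (c • 𝟙 (𝟙_ C)) := by simp
        _ = i := by rw [hc, ← Category.assoc, hip, Category.id_comp]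
    by_contra hc1
    apply hi
    have h3 : (c - 1) • i = 0 := by rw [sub_smul, h2, one_smul, sub_self]
    exact (smul_eq_zero.1 h3).resolve_left (sub_ne_zero.2 hc1)
  rw [hc1, one_smul] at hc
  exact Simple.of_iso (⟨p, i, hc.symm, hip⟩ : 𝟙_ C ≅ S j)

theorem exists_retraction_of_ne_zero {I : C} [Simple I] (hs : IsSemisimple C) {W : C} (a : I ⟶ W)
    (ha : a ≠ 0) : ∃ r : W ⟶ I, a ≫ r = 𝟙 I := by
  obtain ⟨n, S, hS, ⟨e⟩⟩ := hs W
  obtain ⟨j, hj⟩ : ∃ j, a ≫ e.hom ≫ biproduct.π S j ≠ 0 := by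
    by_contra hc
    push Not at hc
    apply ha
    rw [← cancel_mono e.hom]
    ext j
    simpa using hc j
  have := hS j
  have := isIso_of_hom_simple hj
  exact ⟨e.hom ≫ biproduct.π S j ≫ inv (a ≫ e.hom ≫ biproduct.π S j), by
    rw [← Category.assoc, ← Category.assoc, Category.assoc a, IsIso.hom_inv_id]⟩

/-- Modular categories are pure ribbon: for `f ≠ 0`, the mate `𝟙 ⟶ Y ⊗ X^∨` of `f` is a split
monomorphism since `𝟙` is simple, and a retraction of it is the mate of some `g : Y ⟶ X`, for which
`f ≫ g` has trace `1`. -/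
theorem IsModular.isPureRibbon [BraidedCategory C] (h : IsModular k C) : IsPureRibbon C k := by
  obtain ⟨r⟩ := h.ribbon
  have := simple_unit h.unit h.semisimple
  have nd : ∀ {X Y : C} (f : X ⟶ Y), (∀ g : Y ⟶ X, r.trace (f ≫ g) = 0) → f = 0 := by
    intro X Y f hf
    by_contra hne
    have ha : η_ X Xᘁ ≫ f ▷ Xᘁ ≠ 0 := fun h0 => hne (by
      have h1 := tensorRightHomEquiv_symm_coevaluation_comp_whiskerRight (Y' := Xᘁ) f
      rw [h0] at h1
      rw [← cancel_epi (λ_ X).hom, ← h1]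
      simp [tensorRightHomEquiv])
    -- `ρ` retracts the mate of `f`, and every morphism `Y ⊗ X^∨ ⟶ 𝟙` is the mate of some `g`
    obtain ⟨ρ, hρ⟩ := exists_retraction_of_ne_zero h.semisimple _ ha
    obtain ⟨g, hg⟩ : ∃ g : Y ⟶ X, g ▷ Xᘁ ≫ (β_ X Xᘁ).hom ≫ ε_ X Xᘁ = ρ := by
      let _ := BraidedCategory.exactPairing_swap X Xᘁ
      refine ⟨tensorRightHomEquiv Y Xᘁ X (𝟙_ C) ρ ≫ (λ_ X).hom, ?_⟩
      refine Eq.trans ?_ ((tensorRightHomEquiv Y Xᘁ X (𝟙_ C)).symm_apply_apply ρ)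
      change _ = _ ▷ Xᘁ ≫ (α_ _ _ _).hom ≫ _ ◁ ((β_ X Xᘁ).hom ≫ ε_ X Xᘁ) ≫ (ρ_ _).hom
      generalize tensorRightHomEquiv Y Xᘁ X (𝟙_ C) ρ = g
      generalize (β_ X Xᘁ).hom ≫ ε_ X Xᘁ = a
      monoidal
    have h1 := hf (g ≫ (r.θ X).inv)
    rw [← TraceCap.trace_ofRibbon, TraceCap.trace] at h1
    have h2 : (f ≫ g ≫ (r.θ X).inv) ▷ Xᘁ ≫ (TraceCap.ofRibbon r).cap X = f ▷ Xᘁ ≫ ρ := by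
      rw [← hg]
      change _ ≫ (r.θ X).hom ▷ Xᘁ ≫ (β_ X Xᘁ).hom ≫ ε_ X Xᘁ = _
      rw [← comp_whiskerRight_assoc]
      simp
    rw [h2, ← Category.assoc, hρ] at h1
    exact id_nonzero _ h1
  refine ⟨h.unit, inferInstance, r, fun X Y => ⟨nd, fun g hg => nd g fun f => ?_⟩⟩
  refine Eq.trans ?_ (hg f)
  rw [← TraceCap.trace_ofRibbon, TraceCap.trace_comm, TraceCap.trace_ofRibbon]

end

end CentreOfAlgebra

end

noncomputable section

namespace CentreOfAlgebra

/-! ### Envelopes: extension from generators -/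

section Generating

variable {A : Type*} [Category* A] {E : Type*} [Category* E] [Preadditive E]

/-- Every object is a direct summand of a finite direct sum of objects in the image of `t`. -/
def IsGenerating (t : A ⥤ E) : Prop := ∀ Z : E, ∃ (J : Type) (_ : Fintype J) (a : J → A)
  (p : ∀ j, Z ⟶ t.obj (a j)) (i : ∀ j, t.obj (a j) ⟶ Z), ∑ j, p j ≫ i j = 𝟙 Z

namespace IsGenerating

variable {t : A ⥤ E} (ht : IsGenerating t)

include ht

theorem hom_ext {Z W : E} {f g : Z ⟶ W}
    (h : ∀ (a : A) (i : t.obj a ⟶ Z), i ≫ f = i ≫ g) : f = g := by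
  obtain ⟨J, _, a, p, i, hpi⟩ := ht Z
  rw [← Category.id_comp f, ← Category.id_comp g, ← hpi, Preadditive.sum_comp, Preadditive.sum_comp]
  simp only [Category.assoc, h]

theorem hom_ext' {Z W : E} {f g : Z ⟶ W}
    (h : ∀ (a : A) (p : W ⟶ t.obj a), f ≫ p = g ≫ p) : f = g := by
  obtain ⟨J, _, a, p, i, hpi⟩ := ht W
  rw [← Category.comp_id f, ← Category.comp_id g, ← hpi, Preadditive.comp_sum, Preadditive.comp_sum]
  simp only [← Category.assoc, h]

theorem map_hom_ext {D : Type*} [Category* D] [Preadditive D] (F : E ⥤ D) [F.Additive] {Z : E}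
    {W : D} {f g : F.obj Z ⟶ W} (h : ∀ (a : A) (i : t.obj a ⟶ Z), F.map i ≫ f = F.map i ≫ g) :
    f = g := by
  obtain ⟨J, _, a, p, i, hpi⟩ := ht Z
  rw [← Category.id_comp f, ← Category.id_comp g, ← F.map_id, ← hpi, F.map_sum,
    Preadditive.sum_comp, Preadditive.sum_comp]
  simp only [F.map_comp, Category.assoc, h]

/-- Natural transformations of additive functors extend along a generating full functor. -/
theorem exists_natTrans [t.Full] {D : Type*} [Category* D] [Preadditive D] (F G : E ⥤ D)
    [F.Additive] [G.Additive] (α : t ⋙ F ⟶ t ⋙ G) :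
    ∃ γ : F ⟶ G, ∀ a, γ.app (t.obj a) = α.app a := by
  choose J fJ a p i hpi using ht
  have key : ∀ {Z W : E} (f : Z ⟶ W) {b c : A} (x : t.obj b ⟶ Z) (y : W ⟶ t.obj c),
      F.map (x ≫ f ≫ y) ≫ α.app c = α.app b ≫ G.map (x ≫ f ≫ y) := fun f b c x y => by
    obtain ⟨h, hh⟩ := t.map_surjective (x ≫ f ≫ y)
    rw [← hh]
    exact α.naturality h
  have nat : ∀ {Z W : E} (f : Z ⟶ W), F.map f ≫ ∑ j, F.map (p W j) ≫ α.app (a W j) ≫ G.map (i W j) =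
      (∑ j, F.map (p Z j) ≫ α.app (a Z j) ≫ G.map (i Z j)) ≫ G.map f := fun {Z W} f => by
    have h1 : ∀ j, F.map f ≫ F.map (p W j) ≫ α.app (a W j) ≫ G.map (i W j) =
        ∑ l, F.map (p Z l) ≫ α.app (a Z l) ≫ G.map (i Z l) ≫ G.map f ≫ G.map (p W j ≫ i W j) := by
      intro j
      have h2 : f ≫ p W j = ∑ l, p Z l ≫ i Z l ≫ f ≫ p W j := by
        simp_rw [← Category.assoc (p Z _)]
        rw [← Preadditive.sum_comp, hpi, Category.id_comp]
      rw [← F.map_comp_assoc, h2, F.map_sum, Preadditive.sum_comp]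
      refine Finset.sum_congr rfl fun l _ => ?_
      rw [F.map_comp, Category.assoc, ← Category.assoc (F.map _) (α.app _), key]
      simp only [G.map_comp, Category.assoc]
    rw [Preadditive.comp_sum, Finset.sum_congr rfl fun j _ => h1 j, Finset.sum_comm,
      Preadditive.sum_comp]
    refine Finset.sum_congr rfl fun l _ => ?_
    simp only [← Preadditive.comp_sum, ← G.map_sum, hpi, G.map_id, Category.comp_id, Category.assoc]
  refine ⟨{ app := fun Z => ∑ j, F.map (p Z j) ≫ α.app (a Z j) ≫ G.map (i Z j),
            naturality := fun Z W f => nat f }, fun b => ?_⟩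
  have h1 : ∀ j, F.map (p (t.obj b) j) ≫ α.app (a (t.obj b) j) ≫ G.map (i (t.obj b) j) =
      F.map (p (t.obj b) j ≫ i (t.obj b) j) ≫ α.app b := fun j => by
    have h2 := key (𝟙 _) (i (t.obj b) j) (𝟙 _)
    simp only [Category.comp_id] at h2
    rw [← h2, F.map_comp, Category.assoc]
  change ∑ j, F.map (p (t.obj b) j) ≫ α.app (a (t.obj b) j) ≫ G.map (i (t.obj b) j) = _
  simp only [h1]
  rw [← Preadditive.sum_comp, ← F.map_sum, hpi, F.map_id, Category.id_comp]

end IsGenerating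

end Generating

section Envelope

variable {A : Type u} [Category.{v} A] [Preadditive A]

instance : (toEnvelope A).Full := inferInstanceAs (Mat_.embedding A ⋙ _).Full
instance : (toEnvelope A).Faithful := inferInstanceAs (Mat_.embedding A ⋙ _).Faithful
instance : (toEnvelope A).Additive := inferInstanceAs (Mat_.embedding A ⋙ _).Additive

theorem isGenerating_toEnvelope : IsGenerating (toEnvelope A) := by
  classical
  intro Z
  let pr : ∀ j : Z.X.ι, Z.X ⟶ (Mat_.embedding A).obj (Z.X.X j) := fun j =>
    (fun l _ => (𝟙 Z.X : Z.X ⟶ Z.X) l j)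
  let inc : ∀ j : Z.X.ι, (Mat_.embedding A).obj (Z.X.X j) ⟶ Z.X := fun j =>
    (fun _ l => (𝟙 Z.X : Z.X ⟶ Z.X) j l)
  have h : ∑ j, pr j ≫ inc j = 𝟙 Z.X := by
    funext l m
    have h1 : (∑ j, pr j ≫ inc j : Z.X ⟶ Z.X) l m = ∑ j, (pr j ≫ inc j) l m :=
      map_sum ({ toFun := fun f => f l m, map_zero' := rfl, map_add' := fun _ _ => rfl } :
        (Z.X ⟶ Z.X) →+ (Z.X.X l ⟶ Z.X.X m)) _ _
    refine h1.trans (Eq.trans ?_ (congrFun (congrFun (Category.comp_id (𝟙 Z.X)) l) m))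
    refine Finset.sum_congr rfl fun j _ => ?_
    exact Fintype.sum_unique (ι := PUnit.{1})
      (fun _ => (𝟙 Z.X : Z.X ⟶ Z.X) l j ≫ (𝟙 Z.X : Z.X ⟶ Z.X) j m)
  refine ⟨Z.X.ι, inferInstance, Z.X.X,
    fun j => Z.decompId_i ≫ (Idempotents.toKaroubi _).map (pr j),
    fun j => (Idempotents.toKaroubi _).map (inc j) ≫ Z.decompId_p, ?_⟩
  have h2 : ∀ j, (Z.decompId_i ≫ (Idempotents.toKaroubi _).map (pr j)) ≫
      (Idempotents.toKaroubi _).map (inc j) ≫ Z.decompId_p =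
      Z.decompId_i ≫ (Idempotents.toKaroubi _).map (pr j ≫ inc j) ≫ Z.decompId_p := fun j => by
    simp only [Functor.map_comp, Category.assoc]
  refine (Finset.sum_congr rfl fun j _ => h2 j).trans ?_
  rw [← Preadditive.comp_sum, ← Preadditive.sum_comp, ← Functor.map_sum, h,
    CategoryTheory.Functor.map_id]
  refine (congrArg _ (Category.id_comp _)).trans Z.decompId.symm

instance matLift_additive {D : Type*} [Category* D] [Preadditive D] [HasFiniteBiproducts D]
    (F : A ⥤ D) [F.Additive] : (matLift F).Additive where
  map_add {M N f g} := by
    change biproduct.matrix (fun i j => F.map ((f + g) i j)) =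
      biproduct.matrix (fun i j => F.map (f i j)) + biproduct.matrix (fun i j => F.map (g i j))
    ext i j
    simp [F.map_add]

theorem functorExtension₂_additive {A D : Type*} [Category* A] [Preadditive A] [Category* D]
    [Preadditive D] (F : A ⥤ D) [F.Additive] :
    ((Idempotents.functorExtension₂ A D).obj F).Additive where
  map_add {P Q f g} := by
    apply Idempotents.Karoubi.hom_ext
    exact F.map_add

instance extend_additive {D : Type*} [Category* D] [Preadditive D] [HasFiniteBiproducts D]
    [IsIdempotentComplete D] (F : A ⥤ D) [F.Additive] : (extend F).Additive := by
  have := functorExtension₂_additive (matLift F)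
  have : (Idempotents.toKaroubiEquivalence D).inverse.Additive :=
    (Idempotents.toKaroubiEquivalence D).inverse_additive
  exact inferInstanceAs ((Idempotents.functorExtension₂ (Mat_ A) D).obj (matLift F) ⋙
    (Idempotents.toKaroubiEquivalence D).inverse).Additive

end Envelope

end CentreOfAlgebra

end

noncomputable section

namespace CentreOfAlgebra

/-! ### The trace on the Deligne product -/

section

variable {k : Type w} [Field k] {C : Type u} [Category.{v} C] [Preadditive C] [Linear k C]

namespace LinProd

/-- Morphisms of `C ⊗ C` as elements of a tensor product. -/
def valEquiv (X Y : LinProd k C) : (X ⟶ Y) ≃ₗ[k] (X.fst ⟶ Y.fst) ⊗[k] (X.snd ⟶ Y.snd) where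
  toFun f := f.val
  invFun f := ⟨f⟩
  map_add' _ _ := rfl
  map_smul' _ _ := rfl

instance [∀ X Y : C, Module.Finite k (X ⟶ Y)] (X Y : LinProd k C) : Module.Finite k (X ⟶ Y) :=
  Module.Finite.equiv (valEquiv X Y).symm

end LinProd

/-- The morphism `A ⊠ B ⟶ A' ⊠ B'` given by a morphism of `C ⊗ C`. -/
def boxMor {A A' B B' : C} (z : (⟨A, B⟩ : LinProd k C) ⟶ ⟨A', B'⟩) :
    boxObj k A B ⟶ boxObj k A' B' :=
  (toEnvelope (LinProd k C)).map z

section boxMor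

variable {A A' A'' B B' B'' : C}

theorem boxMor_id : boxMor (𝟙 (⟨A, B⟩ : LinProd k C)) = 𝟙 (boxObj k A B) :=
  (toEnvelope (LinProd k C)).map_id _

theorem boxMor_comp (z : (⟨A, B⟩ : LinProd k C) ⟶ ⟨A', B'⟩)
    (z' : (⟨A', B'⟩ : LinProd k C) ⟶ ⟨A'', B''⟩) : boxMor z ≫ boxMor z' = boxMor (z ≫ z') :=
  ((toEnvelope (LinProd k C)).map_comp _ _).symm

theorem boxMor_add (z z' : (⟨A, B⟩ : LinProd k C) ⟶ ⟨A', B'⟩) :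
    boxMor (z + z') = boxMor z + boxMor z' :=
  (toEnvelope (LinProd k C)).map_add

theorem boxMor_zero : boxMor (0 : (⟨A, B⟩ : LinProd k C) ⟶ ⟨A', B'⟩) = 0 :=
  (toEnvelope (LinProd k C)).map_zero _ _

theorem boxMor_injective : Function.Injective
    (boxMor : ((⟨A, B⟩ : LinProd k C) ⟶ ⟨A', B'⟩) → (boxObj k A B ⟶ boxObj k A' B')) :=
  (toEnvelope (LinProd k C)).map_injective

theorem boxMor_surjective : Function.Surjective
    (boxMor : ((⟨A, B⟩ : LinProd k C) ⟶ ⟨A', B'⟩) → (boxObj k A B ⟶ boxObj k A' B')) :=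
  (toEnvelope (LinProd k C)).map_surjective

theorem deligneProd_hom_ext {Z W : DeligneProd k C} {f g : Z ⟶ W}
    (h : ∀ (A B : C) (i : boxObj k A B ⟶ Z), i ≫ f = i ≫ g) : f = g :=
  isGenerating_toEnvelope.hom_ext fun a i => h a.fst a.snd i

theorem deligneProd_hom_ext' {Z W : DeligneProd k C} {f g : Z ⟶ W}
    (h : ∀ (A B : C) (p : W ⟶ boxObj k A B), f ≫ p = g ≫ p) : f = g :=
  isGenerating_toEnvelope.hom_ext' fun a p => h a.fst a.snd p

end boxMor

variable [MonoidalCategory C] [MonoidalPreadditive C] [MonoidalLinear k C]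

variable (k C) in
/-- The functor `(X, Y) ↦ X ⊗ Y` on `C ⊗ C`. -/
abbrev linProdTensor : LinProd k C ⥤ C :=
  LinProd.lift (curriedTensor C) (curriedTensor_isBilinear k C)

theorem linProdTensor_map_tmul {A A' B B' : C} (f : A ⟶ A') (g : B ⟶ B') :
    (linProdTensor k C).map (LinProd.tmul f g : (⟨A, B⟩ : LinProd k C) ⟶ ⟨A', B'⟩) = f ⊗ₘ g :=
  (LinProd.lift_map_tmul _ _ f g).trans (MonoidalCategory.tensorHom_def f g).symm

namespace MultiplicativeTrace

variable (τ : MultiplicativeTrace k C)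

variable [∀ X Y : C, Module.Finite k (X ⟶ Y)]

/-- The trace on `C ⊗ C` with `tr (f ⊗ g) = tr f * tr g`. It vanishes on nilpotents because it is
the trace in `C` of the image under the tensor product functor. -/
def linProd : SemisimpleTrace k (LinProd k C) where
  tr {X} := τ.tr ∘ₗ LinProd.liftMap (curriedTensor C) (curriedTensor_isBilinear k C) X X ∘ₗ
    (LinProd.valEquiv X X).toLinearMap
  cyc {X Y} f g := by
    change τ.tr ((linProdTensor k C).map (f ≫ g)) = τ.tr ((linProdTensor k C).map (g ≫ f))
    rw [Functor.map_comp, τ.cyc, Functor.map_comp]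
  nondeg {X Y} f hf := by
    obtain ⟨n, g, g', h1, -⟩ := τ.exists_dualBases X.fst Y.fst
    obtain ⟨m, h, h', h2, -⟩ := τ.exists_dualBases X.snd Y.snd
    let t : (X ⟶ X) →ₗ[k] k :=
      τ.tr ∘ₗ LinProd.liftMap (curriedTensor C) (curriedTensor_isBilinear k C) X X ∘ₗ
        (LinProd.valEquiv X X).toLinearMap
    -- the tensor products of dual bases are dual bases
    have key : ∀ f : X ⟶ Y, f = ∑ i, ∑ j, t (f ≫ LinProd.tmul (g' i) (h' j)) •
        (LinProd.tmul (g i) (h j) : X ⟶ Y) := fun f => by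
      induction f using LinProd.hom_induction with
      | h0 => simp
      | ha a b ha hb =>
        conv_lhs => rw [ha, hb]
        simp only [Preadditive.add_comp, map_add, add_smul, Finset.sum_add_distrib]
      | ht x y =>
        have ht : ∀ i j, t ((LinProd.tmul x y : X ⟶ Y) ≫ LinProd.tmul (g' i) (h' j)) =
            τ.tr (x ≫ g' i) * τ.tr (y ≫ h' j) := fun i j => by
          rw [← τ.tensorHom]
          exact congrArg τ.tr (linProdTensor_map_tmul (k := k) (x ≫ g' i) (y ≫ h' j))
        simp only [ht]
        apply LinProd.hom_ext
        change x ⊗ₜ[k] y = LinProd.valEquiv X Y _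
        conv_lhs => rw [h1 x, h2 y]
        rw [map_sum, TensorProduct.sum_tmul]
        refine Finset.sum_congr rfl fun i _ => ?_
        rw [map_sum, TensorProduct.tmul_sum]
        refine Finset.sum_congr rfl fun j _ => ?_
        rw [map_smul, TensorProduct.smul_tmul_smul]
        rfl
    rw [key f]
    refine Finset.sum_eq_zero fun i _ => Finset.sum_eq_zero fun j _ => ?_
    have := hf (LinProd.tmul (g' i) (h' j))
    change t _ = 0 at this
    rw [this, zero_smul]
  nil {X} f hf := by
    refine τ.nil (X := X.fst ⊗ X.snd) ((linProdTensor k C).map f) ?_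
    obtain ⟨n, hn⟩ := hf
    exact ⟨n, (map_pow ((linProdTensor k C).mapEnd X) f n).symm.trans
      ((congrArg _ hn).trans ((linProdTensor k C).map_zero X X))⟩

theorem linProd_tr {X : LinProd k C} (f : X ⟶ X) :
    τ.linProd.tr f = τ.tr ((linProdTensor k C).map f) := rfl

theorem linProd_tr_tmul {X Y : C} (f : X ⟶ X) (g : Y ⟶ Y) :
    τ.linProd.tr (LinProd.tmul f g : (⟨X, Y⟩ : LinProd k C) ⟶ ⟨X, Y⟩) = τ.tr f * τ.tr g := by
  rw [← τ.tensorHom, ← linProdTensor_map_tmul (k := k)]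
  rfl

section

variable (F : DeligneProd k C ⥤ C) (b : toEnvelope (LinProd k C) ⋙ F ≅ linProdTensor k C)

include b in
theorem tr_map_boxMor {A B : C} (z : (⟨A, B⟩ : LinProd k C) ⟶ ⟨A, B⟩) :
    τ.tr (F.map (boxMor z)) = τ.linProd.tr z := by
  let β : F.obj (boxObj k A B) ≅ (linProdTensor k C).obj ⟨A, B⟩ := b.app ⟨A, B⟩
  have h : F.map (boxMor z) = β.hom ≫ (linProdTensor k C).map z ≫ β.inv := by
    have h1 : F.map (boxMor z) ≫ β.hom = β.hom ≫ (linProdTensor k C).map z := b.hom.naturality z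
    rw [← Category.assoc, ← h1, Category.assoc, Iso.hom_inv_id, Category.comp_id]
  rw [h, τ.cyc, Category.assoc, Iso.inv_hom_id, Category.comp_id, linProd_tr]

include b in
/-- Nondegeneracy of the trace on the Deligne product. -/
theorem eq_zero_of_tr_map {Z W : DeligneProd k C} (f : Z ⟶ W)
    (hf : ∀ g : W ⟶ Z, τ.tr (F.map (f ≫ g)) = 0) : f = 0 := by
  apply deligneProd_hom_ext
  intro A B i
  apply deligneProd_hom_ext'
  intro A' B' p
  obtain ⟨x, hx⟩ := boxMor_surjective ((i ≫ f) ≫ p)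
  have hx0 : x = 0 := τ.linProd.nondeg x fun g => by
    rw [← τ.tr_map_boxMor F b, ← boxMor_comp, hx, ← hf (p ≫ boxMor g ≫ i)]
    simp only [Category.assoc]
    rw [F.map_comp, τ.cyc, ← F.map_comp]
    simp only [Category.assoc]
  rw [← hx, hx0, boxMor_zero, comp_zero, zero_comp]

end

end MultiplicativeTrace

end

/-! ### Existence of the coend -/

/-- `Y` is a direct summand of a finite direct sum of copies of `G`. -/
def IsSummandOfPower {C : Type*} [Category* C] [Preadditive C] (G Y : C) : Prop :=
  ∃ (J : Type) (_ : Fintype J) (p : J → (Y ⟶ G)) (q : J → (G ⟶ Y)), ∑ j, p j ≫ q j = 𝟙 Y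

theorem IsSummandOfPower.glue {C : Type*} [Category* C] [Preadditive C] {G Y Y₁ Y₂ : C}
    (h₁ : IsSummandOfPower G Y₁) (h₂ : IsSummandOfPower G Y₂) (p₁ : Y ⟶ Y₁) (i₁ : Y₁ ⟶ Y)
    (p₂ : Y ⟶ Y₂) (i₂ : Y₂ ⟶ Y) (h : p₁ ≫ i₁ + p₂ ≫ i₂ = 𝟙 Y) : IsSummandOfPower G Y := by
  obtain ⟨J₁, _, x₁, y₁, e₁⟩ := h₁
  obtain ⟨J₂, _, x₂, y₂, e₂⟩ := h₂
  refine ⟨J₁ ⊕ J₂, inferInstance, Sum.elim (fun j => p₁ ≫ x₁ j) (fun j => p₂ ≫ x₂ j),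
    Sum.elim (fun j => y₁ j ≫ i₁) (fun j => y₂ j ≫ i₂), ?_⟩
  have h3 : ∀ j, (p₁ ≫ x₁ j) ≫ y₁ j ≫ i₁ = p₁ ≫ (x₁ j ≫ y₁ j) ≫ i₁ := by simp
  have h4 : ∀ j, (p₂ ≫ x₂ j) ≫ y₂ j ≫ i₂ = p₂ ≫ (x₂ j ≫ y₂ j) ≫ i₂ := by simp
  simp only [Fintype.sum_sum_type, Sum.elim_inl, Sum.elim_inr, h3, h4]
  rw [← Preadditive.comp_sum, ← Preadditive.comp_sum, ← Preadditive.sum_comp,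
    ← Preadditive.sum_comp, e₁, e₂, Category.id_comp, Category.id_comp, h]

section

variable {k : Type w} [Field k] {C : Type u} [Category.{v} C] [Abelian C] [Linear k C]
  [∀ X Y : C, Module.Finite k (X ⟶ Y)]

theorem finrank_end_lt {Y Z : C} (i : Z ⟶ Y) (p : Y ⟶ Z) (hip : i ≫ p = 𝟙 Z) (hpi : p ≫ i ≠ 𝟙 Y) :
    Module.finrank k (Z ⟶ Z) < Module.finrank k (Y ⟶ Y) := by
  let φ : (Z ⟶ Z) →ₗ[k] (Y ⟶ Y) :=
    { toFun := fun f => p ≫ f ≫ i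
      map_add' := by simp
      map_smul' := by simp }
  have hφ : Function.Injective φ := fun f g h => by
    have h1 : i ≫ (p ≫ f ≫ i) ≫ p = i ≫ (p ≫ g ≫ i) ≫ p := congrArg (fun x => i ≫ x ≫ p) h
    simpa [hip, reassoc_of% hip] using h1
  rw [← LinearMap.finrank_range_of_inj hφ]
  apply Submodule.finrank_lt
  intro htop
  obtain ⟨f, hf : p ≫ f ≫ i = 𝟙 Y⟩ : 𝟙 Y ∈ LinearMap.range φ := htop ▸ Submodule.mem_top
  apply hpi
  calc p ≫ i = (p ≫ i) ≫ p ≫ f ≫ i := by rw [hf, Category.comp_id]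
    _ = p ≫ f ≫ i := by rw [Category.assoc, reassoc_of% hip]
    _ = _ := hf

namespace SemisimpleTrace

variable (τ : SemisimpleTrace k C)

include τ

/-- If there are finitely many simple objects up to isomorphism, their direct sum generates. -/
theorem exists_generator (h : HasFinitelyManySimples C) : ∃ G : C, ∀ Y, IsSummandOfPower G Y := by
  obtain ⟨n, S, hS⟩ := h
  refine ⟨⨁ S, fun Y => ?_⟩
  -- a proper nonzero subobject of `Y` is a direct summand, by regularity of its inclusion, and both
  -- summands have smaller endomorphism algebras
  induction hd : Module.finrank k (Y ⟶ Y) using Nat.strong_induction_on generalizing Y with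
  | _ d ih =>
  by_cases hY : Simple Y
  · obtain ⟨j, ⟨e⟩⟩ := hS Y hY
    exact ⟨Unit, inferInstance, fun _ => e.hom ≫ biproduct.ι S j, fun _ => biproduct.π S j ≫ e.inv,
      by simp⟩
  by_cases h0 : 𝟙 Y = 0
  · exact ⟨Empty, inferInstance, fun j => j.elim, fun j => j.elim, by simp [h0]⟩
  obtain ⟨Z, f, _, hf⟩ : ∃ (Z : C) (f : Z ⟶ Y) (_ : Mono f), f ≠ 0 ∧ ¬ IsIso f := by
    by_contra hc
    push Not at hc
    refine hY ⟨fun {Z} f _ => ⟨fun _ hf0 => h0 ?_, fun hf => hc Z f inferInstance hf⟩⟩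
    rw [← IsIso.inv_hom_id f]
    exact (congrArg (inv f ≫ ·) hf0).trans comp_zero
  obtain ⟨g, hg⟩ := τ.exists_comp_comp_eq f
  have hfg : f ≫ g = 𝟙 Z := by
    rw [← cancel_mono f, Category.assoc, hg, Category.id_comp]
  have hgf : g ≫ f ≠ 𝟙 Y := fun h => hf.2 ⟨g, hfg, h⟩
  have he : (𝟙 Y - g ≫ f) ≫ (𝟙 Y - g ≫ f) = 𝟙 Y - g ≫ f := by
    simp [reassoc_of% hfg]
  obtain ⟨W, i, p, hip, hpi⟩ := IsIdempotentComplete.idempotents_split Y _ he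
  refine IsSummandOfPower.glue (ih _ ?_ Z rfl) (ih _ ?_ W rfl) g f p i (by rw [hpi]; abel)
  · rw [← hd]
    exact finrank_end_lt f g hfg hgf
  · rw [← hd]
    refine finrank_end_lt i p hip fun h => hf.1 ?_
    rw [hpi, sub_eq_self] at h
    rw [← hg, h, comp_zero]

end SemisimpleTrace

variable [MonoidalCategory C] [MonoidalPreadditive C] [MonoidalLinear k C] [RightRigidCategory C]

variable (k) in
/-- The morphism `Y'^∨ ⊠ X ⟶ Y^∨ ⊠ X'` of `C ⊠ C` given by `g : Y ⟶ Y'` and `f : X ⟶ X'`. -/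
def dualBoxMap {X X' Y Y' : C} (g : Y ⟶ Y') (f : X ⟶ X') : boxObj k (Y'ᘁ) X ⟶ boxObj k (Yᘁ) X' :=
  boxMor (LinProd.tmul (gᘁ) f)

theorem dualBoxMap_comp {X X' X'' Y Y' Y'' : C} (g : Y ⟶ Y') (f : X ⟶ X') (g' : Y'' ⟶ Y)
    (f' : X' ⟶ X'') : dualBoxMap k g f ≫ dualBoxMap k g' f' = dualBoxMap k (g' ≫ g) (f ≫ f') := by
  rw [dualBoxMap, dualBoxMap, dualBoxMap, comp_rightAdjointMate, ← LinProd.tmul_comp_tmul,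
    boxMor_comp]

theorem dualBoxMap_id (X Y : C) : dualBoxMap k (𝟙 Y) (𝟙 X) = 𝟙 (boxObj k (Yᘁ) X) := by
  rw [dualBoxMap, rightAdjointMate_id, ← boxMor_id]
  rfl

theorem rightAdjointMate_add {X Y : C} (f g : X ⟶ Y) : (f + g)ᘁ = fᘁ + gᘁ := by
  simp [rightAdjointMate]

theorem rightAdjointMate_smul {X Y : C} (a : k) (f : X ⟶ Y) : (a • f)ᘁ = a • fᘁ := by
  simp [rightAdjointMate]

theorem dualBoxMap_sum_left {J : Type*} [Fintype J] {X X' Y Y' : C} (g : J → (Y ⟶ Y'))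
    (f : X ⟶ X') : dualBoxMap k (∑ j, g j) f = ∑ j, dualBoxMap k (g j) f :=
  map_sum (AddMonoidHom.mk' (fun g => dualBoxMap k g f) fun a b => by
    rw [dualBoxMap, rightAdjointMate_add, LinProd.add_tmul, boxMor_add]
    rfl) g _

theorem dualBoxMap_sum_right {J : Type*} [Fintype J] {X X' Y Y' : C} (g : Y ⟶ Y')
    (f : J → (X ⟶ X')) : dualBoxMap k g (∑ j, f j) = ∑ j, dualBoxMap k g (f j) :=
  map_sum (AddMonoidHom.mk' (fun f => dualBoxMap k g f) fun a b => by
    rw [dualBoxMap, LinProd.tmul_add, boxMor_add]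
    rfl) f _

theorem dualBox_map_app {X Y Y' : C} (g : Y ⟶ Y') :
    ((dualBox k C).map g.op).app X = dualBoxMap k g (𝟙 X) := rfl

theorem dualBox_obj_map {X X' Y : C} (f : X ⟶ X') :
    ((dualBox k C).obj (Opposite.op Y)).map f = dualBoxMap k (𝟙 Y) f := by
  rw [dualBoxMap, rightAdjointMate_id]
  rfl

/-- Dinatural families are determined by their component at a generator. -/
theorem dinatural_eq_sum {Z : DeligneProd k C} (κ : ∀ Y : C, boxObj k Yᘁ Y ⟶ Z)
    (hκ : ∀ {Y Y' : C} (f : Y ⟶ Y'), dualBoxMap k f (𝟙 Y) ≫ κ Y = dualBoxMap k (𝟙 Y') f ≫ κ Y')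
    {G Y : C} {J : Type} [Fintype J] {p : J → (Y ⟶ G)} {q : J → (G ⟶ Y)}
    (h : ∑ j, p j ≫ q j = 𝟙 Y) : κ Y = ∑ j, dualBoxMap k (q j) (p j) ≫ κ G := by
  have h1 : ∀ j, dualBoxMap k (q j) (p j) ≫ κ G = dualBoxMap k (𝟙 Y) (p j ≫ q j) ≫ κ Y := by
    intro j
    have h2 : dualBoxMap k (q j) (p j) = dualBoxMap k (𝟙 Y) (p j) ≫ dualBoxMap k (q j) (𝟙 G) := by
      rw [dualBoxMap_comp, Category.comp_id, Category.comp_id]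
    rw [h2, Category.assoc, hκ, ← Category.assoc, dualBoxMap_comp, Category.comp_id]
  simp only [h1]
  rw [← Preadditive.sum_comp, ← dualBoxMap_sum_right, h, dualBoxMap_id, Category.id_comp]

/-- A morphism on `G^∨ ⊠ G` that coequalizes the actions of the endomorphisms of a generator `G`
extends to a dinatural family. -/
theorem dinatural_of_generator {G : C} {J : C → Type} [∀ Y, Fintype (J Y)]
    {p : ∀ Y, J Y → (Y ⟶ G)} {q : ∀ Y, J Y → (G ⟶ Y)} (h : ∀ Y, ∑ j, p Y j ≫ q Y j = 𝟙 Y)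
    {Z : DeligneProd k C} (κ : boxObj k Gᘁ G ⟶ Z)
    (hκ : ∀ f : G ⟶ G, dualBoxMap k f (𝟙 G) ≫ κ = dualBoxMap k (𝟙 G) f ≫ κ)
    {Y Y' : C} (f : Y ⟶ Y') :
    dualBoxMap k f (𝟙 Y) ≫ ∑ j, dualBoxMap k (q Y j) (p Y j) ≫ κ =
      dualBoxMap k (𝟙 Y') f ≫ ∑ j, dualBoxMap k (q Y' j) (p Y' j) ≫ κ := by
  have h1 : ∀ j, dualBoxMap k f (𝟙 Y) ≫ dualBoxMap k (q Y j) (p Y j) ≫ κ =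
      ∑ l, dualBoxMap k (q Y' l) (p Y j) ≫ dualBoxMap k (𝟙 G) (q Y j ≫ f ≫ p Y' l) ≫ κ := by
    intro j
    have h2 : q Y j ≫ f = ∑ l, (q Y j ≫ f ≫ p Y' l) ≫ q Y' l := by
      simp only [Category.assoc]
      simp_rw [← Category.assoc f]
      rw [← Preadditive.comp_sum]
      simp_rw [Category.assoc]
      rw [← Preadditive.comp_sum, h, Category.comp_id]
    rw [← Category.assoc, dualBoxMap_comp, Category.id_comp, h2, dualBoxMap_sum_left,
      Preadditive.sum_comp]
    refine Finset.sum_congr rfl fun l _ => ?_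
    rw [← hκ, ← Category.assoc (dualBoxMap k _ _), dualBoxMap_comp, Category.comp_id]
  have h3 : ∀ l, dualBoxMap k (𝟙 Y') f ≫ dualBoxMap k (q Y' l) (p Y' l) ≫ κ =
      ∑ j, dualBoxMap k (q Y' l) (p Y j) ≫ dualBoxMap k (𝟙 G) (q Y j ≫ f ≫ p Y' l) ≫ κ := by
    intro l
    have h2 : f ≫ p Y' l = ∑ j, p Y j ≫ q Y j ≫ f ≫ p Y' l := by
      simp_rw [← Category.assoc (p Y _)]
      rw [← Preadditive.sum_comp, h, Category.id_comp]
    conv_lhs => rw [← Category.assoc, dualBoxMap_comp, Category.comp_id, h2, dualBoxMap_sum_right,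
      Preadditive.sum_comp]
    refine Finset.sum_congr rfl fun j _ => ?_
    rw [← Category.assoc (dualBoxMap k _ _), dualBoxMap_comp, Category.id_comp]
  rw [Preadditive.comp_sum, Preadditive.comp_sum, Finset.sum_congr rfl fun j _ => h1 j,
    Finset.sum_congr rfl fun j _ => h3 j, Finset.sum_comm]

/-- The coend of `Y^∨ ⊠ Y` exists: for a generator `G` it is the direct summand of `G^∨ ⊠ G`
that corepresents the morphisms coequalizing the two actions of the endomorphisms of `G`. -/
theorem MultiplicativeTrace.exists_coend (τ : MultiplicativeTrace k C)
    (h : HasFinitelyManySimples C) :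
    ∃ c : Cowedge (dualBox k C), Nonempty (IsColimit c) := by
  obtain ⟨G, hG⟩ := τ.exists_generator h
  choose J fJ p q hpq using hG
  let P : LinProd k C := ⟨Gᘁ, G⟩
  have dr : ∀ f : G ⟶ G, dualBoxMap k (𝟙 G) f = boxMor (LinProd.tmul (𝟙 Gᘁ) f) :=
    fun f => by rw [dualBoxMap, rightAdjointMate_id]
  obtain ⟨e, he, hS⟩ := τ.linProd.exists_idempotent (P := P)
    (fun W => {x | ∀ f : G ⟶ G, (LinProd.tmul (fᘁ) (𝟙 G) : P ⟶ P) ≫ x =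
      (LinProd.tmul (𝟙 Gᘁ) f : P ⟶ P) ≫ x})
    (fun f => by rw [comp_zero, comp_zero])
    (fun x hx y hy f => by rw [Preadditive.comp_add, Preadditive.comp_add, hx, hy])
    (fun W W' x g hx f => by rw [← Category.assoc, hx, Category.assoc])
  have het : boxMor e ≫ boxMor e = boxMor e := by rw [boxMor_comp, hS _ e he]
  obtain ⟨R, i, s, his, hsi⟩ := IsIdempotentComplete.idempotents_split _ _ het
  have hsG : ∀ f : G ⟶ G, dualBoxMap k f (𝟙 G) ≫ s = dualBoxMap k (𝟙 G) f ≫ s := fun f => by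
    have hs : s = boxMor e ≫ s := by rw [← hsi, Category.assoc, his, Category.comp_id]
    rw [dr, dualBoxMap, hs, ← Category.assoc, ← Category.assoc, boxMor_comp, boxMor_comp, he]
  have hκ : ∀ {Z : DeligneProd k C} (κ : boxObj k Gᘁ G ⟶ Z),
      (∀ f : G ⟶ G, dualBoxMap k f (𝟙 G) ≫ κ = dualBoxMap k (𝟙 G) f ≫ κ) →
      boxMor e ≫ κ = κ := by
    intro Z κ hκ
    apply deligneProd_hom_ext'
    intro A B y
    obtain ⟨x, hx⟩ := boxMor_surjective (κ ≫ y)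
    have hx' : e ≫ x = x := hS _ x fun f => boxMor_injective (by
      rw [← boxMor_comp, ← boxMor_comp, hx, ← dr, ← Category.assoc, ← Category.assoc, ← hκ]
      rfl)
    rw [Category.assoc, ← hx, boxMor_comp, hx']
  have hs : ∀ {Z : DeligneProd k C} (κ : boxObj k Gᘁ G ⟶ Z),
      (∀ f : G ⟶ G, dualBoxMap k f (𝟙 G) ≫ κ = dualBoxMap k (𝟙 G) f ≫ κ) → s ≫ i ≫ κ = κ :=
    fun κ h => by rw [← Category.assoc, hsi, hκ κ h]
  -- `R` is the image of `e`; the cowedge is extended from `s` at the generator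
  let c : Cowedge (dualBox k C) :=
    Cowedge.mk (F := dualBox k C) R (fun Y => ∑ j, dualBoxMap k (q Y j) (p Y j) ≫ s)
      (fun Y Y' f => by
        rw [dualBox_map_app, dualBox_obj_map]
        exact dinatural_of_generator hpq s hsG f)
  have hd : ∀ (d : Cowedge (dualBox k C)) {Y Y' : C} (f : Y ⟶ Y'),
      dualBoxMap k f (𝟙 Y) ≫ d.π Y = dualBoxMap k (𝟙 Y') f ≫ d.π Y' := fun d Y Y' f => by
    rw [← dualBox_obj_map]
    exact Cowedge.condition d f
  have hcG : c.π G = s := by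
    change ∑ j, dualBoxMap k (q G j) (p G j) ≫ s = s
    have h1 : ∀ j, dualBoxMap k (q G j) (p G j) ≫ s = dualBoxMap k (𝟙 G) (p G j ≫ q G j) ≫ s := by
      intro j
      have h2 : dualBoxMap k (q G j) (p G j) =
          dualBoxMap k (𝟙 G) (p G j) ≫ dualBoxMap k (q G j) (𝟙 G) := by
        rw [dualBoxMap_comp, Category.comp_id, Category.comp_id]
      rw [h2, Category.assoc, hsG, ← Category.assoc, dualBoxMap_comp, Category.comp_id]
    simp only [h1]
    rw [← Preadditive.sum_comp, ← dualBoxMap_sum_right, hpq, dualBoxMap_id, Category.id_comp]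
  refine ⟨c, ⟨Multicofork.IsColimit.mk _ (fun d => i ≫ d.π G) (fun d (Y : C) => ?_)
    fun d m hm => ?_⟩⟩
  · refine Eq.trans ?_ (dinatural_eq_sum (fun Y : C => d.π Y) (hd d) (hpq Y)).symm
    change (∑ j, dualBoxMap k (q Y j) (p Y j) ≫ s) ≫ i ≫ d.π G = _
    rw [Preadditive.sum_comp]
    refine Finset.sum_congr rfl fun j _ => ?_
    exact (Category.assoc _ _ _).trans
      (congrArg (dualBoxMap k (q Y j) (p Y j) ≫ ·) (hs (d.π G) (hd d)))
  · have h1 : s ≫ m = d.π G := (congrArg (· ≫ m) hcG.symm).trans (hm G)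
    rw [← h1]
    exact ((Category.id_comp m).symm.trans (congrArg (· ≫ m) his.symm)).trans (Category.assoc _ _ _)

end

end CentreOfAlgebra

end

noncomputable section

namespace CentreOfAlgebra

/-! ### Multiplication by a dualizable object preserves the coend -/

section

variable {A B : Type u} [Category.{v} A] [Preadditive A] [Category.{v} B] [Preadditive B]
  {F : A ⥤ B} {G : B ⥤ A} [F.Additive] [G.Additive]

/-- An adjunction of additive functors, applied to all entries of a matrix. -/
def mapMatAdjunction (adj : F ⊣ G) : F.mapMat_ ⊣ G.mapMat_ :=
  Adjunction.mkOfHomEquiv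
    { homEquiv := fun M N =>
        { toFun := fun f i j => adj.homEquiv (M.X i) (N.X j) (f i j)
          invFun := fun f i j => (adj.homEquiv (M.X i) (N.X j)).symm (f i j)
          left_inv := fun f => by
            funext i j
            exact (adj.homEquiv (M.X i) (N.X j)).symm_apply_apply (f i j)
          right_inv := fun f => by
            funext i j
            exact (adj.homEquiv (M.X i) (N.X j)).apply_symm_apply (f i j) }
      homEquiv_naturality_left_symm := fun {M' M N} f g => by
        funext i j
        change (adj.homAddEquiv (M'.X i) (N.X j)).symm (∑ l, f i l ≫ g l j) =
          ∑ l, F.map (f i l) ≫ (adj.homEquiv (M.X l) (N.X j)).symm (g l j)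
        rw [map_sum]
        exact Finset.sum_congr rfl fun l _ => adj.homEquiv_naturality_left_symm _ _
      homEquiv_naturality_right := fun {M N N'} f g => by
        funext i j
        change adj.homAddEquiv (M.X i) (N'.X j) (∑ l, f i l ≫ g l j) =
          ∑ l, adj.homEquiv (M.X i) (N.X l) (f i l) ≫ G.map (g l j)
        rw [map_sum]
        exact Finset.sum_congr rfl fun l _ => adj.homEquiv_naturality_right _ _ }

end

section

variable {A B : Type*} [Category* A] [Category* B] {F : A ⥤ B} {G : B ⥤ A}

theorem homEquiv_sandwich (adj : F ⊣ G) {P : A} {Q : B} {p : P ⟶ P} {q : Q ⟶ Q} {x : F.obj P ⟶ Q}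
    (h : F.map p ≫ x ≫ q = x) : p ≫ adj.homEquiv P Q x ≫ G.map q = adj.homEquiv P Q x := by
  rw [← adj.homEquiv_naturality_right, ← adj.homEquiv_naturality_left, h]

theorem homEquiv_symm_sandwich (adj : F ⊣ G) {P : A} {Q : B} {p : P ⟶ P} {q : Q ⟶ Q}
    {x : P ⟶ G.obj Q} (h : p ≫ x ≫ G.map q = x) :
    F.map p ≫ (adj.homEquiv P Q).symm x ≫ q = (adj.homEquiv P Q).symm x := by
  rw [← adj.homEquiv_naturality_right_symm, ← adj.homEquiv_naturality_left_symm, h]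

/-- The extension of an adjunction to the idempotent completions. -/
def karoubiAdjunction (adj : F ⊣ G) :
    (Idempotents.functorExtension₂ A B).obj F ⊣ (Idempotents.functorExtension₂ B A).obj G :=
  Adjunction.mkOfHomEquiv
    { homEquiv := fun P Q =>
        { toFun := fun f => ⟨adj.homEquiv P.X Q.X f.f, homEquiv_sandwich adj f.comm⟩
          invFun := fun f => ⟨(adj.homEquiv P.X Q.X).symm f.f, homEquiv_symm_sandwich adj f.comm⟩
          left_inv := fun f => Idempotents.Karoubi.hom_ext _ _
            ((adj.homEquiv P.X Q.X).symm_apply_apply f.f)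
          right_inv := fun f => Idempotents.Karoubi.hom_ext _ _
            ((adj.homEquiv P.X Q.X).apply_symm_apply f.f) }
      homEquiv_naturality_left_symm := fun f g => Idempotents.Karoubi.hom_ext _ _
        (adj.homEquiv_naturality_left_symm f.f g.f)
      homEquiv_naturality_right := fun f g => Idempotents.Karoubi.hom_ext _ _
        (adj.homEquiv_naturality_right f.f g.f) }

end

/-- The extension of an adjunction of additive functors to the envelopes. -/
def mapEnvelopeAdjunction {A B : Type u} [Category.{v} A] [Preadditive A] [Category.{v} B]
    [Preadditive B] {F : A ⥤ B} {G : B ⥤ A} [F.Additive] [G.Additive] (adj : F ⊣ G) :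
    mapEnvelope F ⊣ mapEnvelope G :=
  karoubiAdjunction (mapMatAdjunction adj)

section

variable {k : Type w} [Field k] {C : Type u} [Category.{v} C] [Preadditive C] [Linear k C]
  [MonoidalCategory C] [MonoidalPreadditive C] [MonoidalLinear k C]

namespace LinProd

/-- A natural transformation between additive functors on `C ⊗ C` may be checked on pure
tensors. -/
theorem naturality_of_tmul {D : Type*} [Category* D] [Preadditive D] {F G : LinProd k C ⥤ D}
    [F.Additive] [G.Additive] (α : ∀ X, F.obj X ⟶ G.obj X)
    (h : ∀ {A A' B B' : C} (f : A ⟶ A') (g : B ⟶ B'),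
      F.map (tmul f g : (⟨A, B⟩ : LinProd k C) ⟶ ⟨A', B'⟩) ≫ α _ = α _ ≫ G.map (tmul f g))
    {X Y : LinProd k C} (f : X ⟶ Y) : F.map f ≫ α Y = α X ≫ G.map f := by
  induction f using hom_induction with
  | h0 => rw [F.map_zero, G.map_zero, zero_comp, comp_zero]
  | ha a b ha hb => rw [F.map_add, G.map_add, Preadditive.add_comp, Preadditive.comp_add, ha, hb]
  | ht f g => exact h f g

/-- If `X'` and `Y'` are left dual to `X` and `Y`, multiplication by `(X', Y')` is right adjoint
to multiplication by `(X, Y)`. -/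
def mulLeftAdjunction {X X' Y Y' : C} (a : tensorLeft X ⊣ tensorLeft X')
    (b : tensorLeft Y ⊣ tensorLeft Y') : mulLeft (k := k) X Y ⊣ mulLeft X' Y' where
  unit :=
    { app := fun Z => tmul (a.unit.app Z.fst) (b.unit.app Z.snd)
      naturality := fun _ _ f => naturality_of_tmul (F := 𝟭 _) (G := mulLeft X Y ⋙ mulLeft X' Y')
        (fun Z => tmul (a.unit.app Z.fst) (b.unit.app Z.snd)) (fun {A A' B B'} f g => by
          have h1 : (mulLeft X Y ⋙ mulLeft X' Y').map
              (tmul f g : (⟨A, B⟩ : LinProd k C) ⟶ ⟨A', B'⟩) =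
              tmul (X' ◁ X ◁ f) (Y' ◁ Y ◁ g) :=
            (congrArg (mulLeft X' Y').map (mulLeft_map_tmul X Y f g)).trans
              (mulLeft_map_tmul _ _ _ _)
          rw [h1]
          refine (congrArg₂ (tmul (k := k)) (a.unit.naturality f) (b.unit.naturality g) :)) f }
  counit :=
    { app := fun Z => tmul (a.counit.app Z.fst) (b.counit.app Z.snd)
      naturality := fun _ _ f => naturality_of_tmul (F := mulLeft X' Y' ⋙ mulLeft X Y) (G := 𝟭 _)
        (fun Z => tmul (a.counit.app Z.fst) (b.counit.app Z.snd)) (fun {A A' B B'} f g => by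
          have h1 : (mulLeft X' Y' ⋙ mulLeft X Y).map
              (tmul f g : (⟨A, B⟩ : LinProd k C) ⟶ ⟨A', B'⟩) =
              tmul (X ◁ X' ◁ f) (Y ◁ Y' ◁ g) :=
            (congrArg (mulLeft X Y).map (mulLeft_map_tmul X' Y' f g)).trans
              (mulLeft_map_tmul _ _ _ _)
          rw [h1]
          exact (congrArg₂ (tmul (k := k)) (a.counit.naturality f) (b.counit.naturality g) :)) f }
  left_triangle_components Z := by
    refine (congrArg (· ≫ tmul (a.counit.app (X ⊗ Z.fst)) (b.counit.app (Y ⊗ Z.snd)))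
      (mulLeft_map_tmul X Y (a.unit.app Z.fst) (b.unit.app Z.snd))).trans ?_
    exact congrArg₂ (tmul (k := k)) (a.left_triangle_components Z.fst)
      (b.left_triangle_components Z.snd)
  right_triangle_components Z := by
    refine (congrArg (tmul (a.unit.app (X' ⊗ Z.fst)) (b.unit.app (Y' ⊗ Z.snd)) ≫ ·)
      (mulLeft_map_tmul X' Y' (a.counit.app Z.fst) (b.counit.app Z.snd))).trans ?_
    exact congrArg₂ (tmul (k := k)) (a.right_triangle_components Z.fst)
      (b.right_triangle_components Z.snd)

end LinProd

variable (k) in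
/-- If `X'` is left dual to `X`, then `(X ⊠ 𝟙) ⊗ -` is left adjoint to `(X' ⊠ 𝟙) ⊗ -`. -/
def boxUnitMulAdjunction (X' X : C) [ExactPairing X' X] :
    (boxUnitMul k C).obj X ⊣ (boxUnitMul k C).obj X' :=
  mapEnvelopeAdjunction
    (LinProd.mulLeftAdjunction (tensorLeftAdjunction X' X) (tensorLeftAdjunction (𝟙_ C) (𝟙_ C)))

end

section

variable {k : Type w} [Field k] {C : Type u} [Category.{v} C] [Preadditive C] [Linear k C]
  [MonoidalCategory C] [MonoidalPreadditive C] [MonoidalLinear k C] [RightRigidCategory C]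

theorem boxMor_comp_boxUnitMulIso (X : C) {A A' B B' : C} (g : A ⟶ A') (f : B ⟶ B') :
    boxMor (LinProd.tmul (X ◁ g) f) ≫ (boxUnitMulIso k X A' B').hom =
      (boxUnitMulIso k X A B).hom ≫ ((boxUnitMul k C).obj X).map (boxMor (LinProd.tmul g f)) :=
  boxUnitMulIso_naturality k X g f

theorem map_boxMor_comp_boxUnitMulIso_inv (X : C) {A A' B B' : C} (g : A ⟶ A') (f : B ⟶ B') :
    ((boxUnitMul k C).obj X).map (boxMor (LinProd.tmul g f)) ≫ (boxUnitMulIso k X A' B').inv =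
      (boxUnitMulIso k X A B).inv ≫ boxMor (LinProd.tmul (X ◁ g) f) := by
  rw [Iso.comp_inv_eq, Category.assoc, Iso.eq_inv_comp, boxMor_comp_boxUnitMulIso]

/-- The functor `(X ⊠ 𝟙) ⊗ -` preserves the coend of `Y^∨ ⊠ Y` if it is a left adjoint. -/
theorem nonempty_isColimit_mulCowedge {X : C} {N : DeligneProd k C ⥤ DeligneProd k C}
    (adj : (boxUnitMul k C).obj X ⊣ N) (c : Cowedge (dualBox k C)) (hc : IsColimit c) :
    Nonempty (IsColimit (mulCowedge k X c)) := by
  have hnat : ∀ (Z : DeligneProd k C) (κ : ∀ Y : C, boxObj k (X ⊗ Yᘁ) Y ⟶ Z)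
      (_ : ∀ {Y Y' : C} (f : Y ⟶ Y'), boxMor (LinProd.tmul (X ◁ fᘁ) (𝟙 Y)) ≫ κ Y =
        boxMor (LinProd.tmul (𝟙 (X ⊗ Y'ᘁ)) f) ≫ κ Y') {Y Y' : C} (f : Y ⟶ Y'),
      boxMor (LinProd.tmul (fᘁ) (𝟙 Y)) ≫ adj.homEquiv (boxObj k Yᘁ Y) Z
          ((boxUnitMulIso k X Yᘁ Y).inv ≫ κ Y) =
        boxMor (LinProd.tmul (𝟙 Y'ᘁ) f) ≫ adj.homEquiv (boxObj k Y'ᘁ Y') Z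
          ((boxUnitMulIso k X Y'ᘁ Y').inv ≫ κ Y') := by
    intro Z κ hκ Y Y' f
    rw [← adj.homEquiv_naturality_left, ← adj.homEquiv_naturality_left, ← Category.assoc,
      ← Category.assoc, map_boxMor_comp_boxUnitMulIso_inv, map_boxMor_comp_boxUnitMulIso_inv,
      Category.assoc, Category.assoc, hκ, MonoidalCategory.whiskerLeft_id]
  let e : ∀ d : Cowedge (tensorDualBox k X), Cowedge (dualBox k C) := fun d =>
    Cowedge.mk (F := dualBox k C) (N.obj d.pt)
      (fun Y => adj.homEquiv (boxObj k Yᘁ Y) d.pt ((boxUnitMulIso k X Yᘁ Y).inv ≫ d.π Y))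
      (fun Y Y' f => hnat d.pt (fun Y : C => d.π Y) (fun f => Cowedge.condition d f) f)
  have key : ∀ {R Z : DeligneProd k C} {Y : C} (π : boxObj k Yᘁ Y ⟶ R) (m : R ⟶ N.obj Z)
      (x : boxObj k (X ⊗ Yᘁ) Y ⟶ Z), π ≫ m = adj.homEquiv _ Z ((boxUnitMulIso k X Yᘁ Y).inv ≫ x) ↔
      ((boxUnitMulIso k X Yᘁ Y).hom ≫ ((boxUnitMul k C).obj X).map π) ≫
        (adj.homEquiv R Z).symm m = x := by
    intro R Z Y π m x
    rw [← Equiv.symm_apply_eq, adj.homEquiv_naturality_left_symm, Iso.eq_inv_comp, Category.assoc]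
  refine ⟨Multicofork.IsColimit.mk _ (fun d => (adj.homEquiv c.pt d.pt).symm (hc.desc (e d)))
    (fun d (Y : C) => ?_) fun d m hm => ?_⟩
  · exact (key (c.π Y) (hc.desc (e d)) (d.π Y)).1 (hc.fac (e d) (WalkingMultispan.right Y))
  · refine (Equiv.eq_symm_apply (adj.homEquiv c.pt d.pt)).2 ?_
    refine Cowedge.IsColimit.hom_ext hc fun Y => ?_
    refine ((key (c.π Y) (adj.homEquiv c.pt d.pt m) (d.π Y)).2 ?_).trans
      (hc.fac (e d) (WalkingMultispan.right Y)).symm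
    exact (congrArg (_ ≫ ·) (Equiv.symm_apply_apply (adj.homEquiv c.pt d.pt) m)).trans (hm Y)

end

end CentreOfAlgebra

end

noncomputable section

namespace CentreOfAlgebra

/-! ### The right adjoint of the tensor product functor -/

section

variable {k : Type w} [Field k] {C : Type u} [Category.{v} C] [Abelian C] [Linear k C]
  [MonoidalCategory C] [MonoidalPreadditive C] [MonoidalLinear k C] [RightRigidCategory C]

/-- For a functor `R : C ⥤ C ⊠ C`, the structure of a coend of `(X ⊗ Y^∨) ⊠ Y` on each `R X`, with
coprojections natural in `X`. -/
structure TensorCoend (R : C ⥤ DeligneProd k C) where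
  π : ∀ X Y : C, boxObj k (X ⊗ Yᘁ) Y ⟶ R.obj X
  dinatural : ∀ (X : C) {Y Y' : C} (f : Y ⟶ Y'),
    boxMor (LinProd.tmul (X ◁ fᘁ) (𝟙 Y)) ≫ π X Y = boxMor (LinProd.tmul (𝟙 (X ⊗ Y'ᘁ)) f) ≫ π X Y'
  naturality : ∀ {X X' : C} (f : X ⟶ X') (Y : C),
    boxMor (LinProd.tmul (f ▷ Yᘁ) (𝟙 Y)) ≫ π X' Y = π X Y ≫ R.map f
  exists_desc : ∀ (X : C) {Z : DeligneProd k C} (κ : ∀ Y : C, boxObj k (X ⊗ Yᘁ) Y ⟶ Z),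
    (∀ {Y Y' : C} (f : Y ⟶ Y'), boxMor (LinProd.tmul (X ◁ fᘁ) (𝟙 Y)) ≫ κ Y =
      boxMor (LinProd.tmul (𝟙 (X ⊗ Y'ᘁ)) f) ≫ κ Y') → ∃ φ : R.obj X ⟶ Z, ∀ Y, π X Y ≫ φ = κ Y
  hom_ext : ∀ {X : C} {Z : DeligneProd k C} {φ φ' : R.obj X ⟶ Z},
    (∀ Y, π X Y ≫ φ = π X Y ≫ φ') → φ = φ'

namespace TensorCoend

variable {R : C ⥤ DeligneProd k C} (d : TensorCoend R)

include d in
theorem additive : R.Additive where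
  map_add {X X' f g} := d.hom_ext fun Y => by
    rw [← d.naturality, Preadditive.comp_add, ← d.naturality, ← d.naturality,
      MonoidalPreadditive.add_whiskerRight, LinProd.add_tmul, boxMor_add, Preadditive.add_comp]

/-- The morphism `A ⊠ B ⟶ (X ⊗ B^∨) ⊠ B ⟶ R X` given by `h : A ⟶ X ⊗ B^∨`. -/
def Φ {A B X : C} (h : A ⟶ X ⊗ Bᘁ) : boxObj k A B ⟶ R.obj X :=
  boxMor (LinProd.tmul h (𝟙 B)) ≫ d.π X B

theorem Φ_add {A B X : C} (h h' : A ⟶ X ⊗ Bᘁ) : d.Φ (h + h') = d.Φ h + d.Φ h' := by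
  rw [Φ, LinProd.add_tmul, boxMor_add, Preadditive.add_comp, Φ, Φ]

theorem Φ_comp_map {A B X X' : C} (h : A ⟶ X ⊗ Bᘁ) (f : X ⟶ X') :
    d.Φ h ≫ R.map f = d.Φ (h ≫ f ▷ Bᘁ) := by
  rw [Φ, Category.assoc, ← d.naturality, ← Category.assoc, boxMor_comp, LinProd.tmul_comp_tmul,
    Category.comp_id, Φ]

theorem boxMor_comp_π {A B X Y : C} (h : A ⟶ X ⊗ Yᘁ) (g : B ⟶ Y) :
    boxMor (LinProd.tmul h g) ≫ d.π X Y = d.Φ (h ≫ X ◁ gᘁ) := by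
  have h1 : boxMor (k := k) (LinProd.tmul h g) =
      boxMor (LinProd.tmul h (𝟙 B)) ≫ boxMor (LinProd.tmul (𝟙 (X ⊗ Yᘁ)) g) := by
    rw [boxMor_comp, LinProd.tmul_comp_tmul, Category.comp_id, Category.id_comp]
  rw [h1, Category.assoc, ← d.dinatural, ← Category.assoc, boxMor_comp, LinProd.tmul_comp_tmul,
    Category.comp_id, Φ]

theorem boxMor_comp_Φ {A A' B B' X : C} (f : A ⟶ A') (g : B ⟶ B') (h : A' ⟶ X ⊗ B'ᘁ) :
    boxMor (LinProd.tmul f g) ≫ d.Φ h = d.Φ (f ≫ h ≫ X ◁ gᘁ) := by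
  rw [Φ, ← Category.assoc, boxMor_comp, LinProd.tmul_comp_tmul, Category.comp_id,
    boxMor_comp_π, Category.assoc]

section trace

variable [∀ X Y : C, Module.Finite k (X ⟶ Y)] (τ : MultiplicativeTrace k C)
  (F : DeligneProd k C ⥤ C) (b : toEnvelope (LinProd k C) ⋙ F ≅ linProdTensor k C)

/-- The pure tensors `(X ⊗ g^∨ ≫ ψ) ⊗ g'`, bilinearly in `g` and `g'`. -/
def dualTmul {A B X : C} (ψ : X ⊗ Bᘁ ⟶ A) (Y' Y : C) :
    (B ⟶ Y') →ₗ[k] (Y ⟶ B) →ₗ[k] ((⟨X ⊗ Y'ᘁ, Y⟩ : LinProd k C) ⟶ ⟨A, B⟩) :=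
  LinearMap.mk₂ k (fun g g' => LinProd.tmul (X ◁ gᘁ ≫ ψ) g')
    (fun g₁ g₂ g' => by
      rw [rightAdjointMate_add, MonoidalPreadditive.whiskerLeft_add, Preadditive.add_comp,
        LinProd.add_tmul])
    (fun a g g' => by
      rw [rightAdjointMate_smul, MonoidalLinear.whiskerLeft_smul, Linear.smul_comp,
        LinProd.smul_tmul])
    (fun g g₁ g₂ => LinProd.tmul_add _ _ _)
    (fun a g g' => LinProd.tmul_smul _ _ _)

include b in
/-- Morphisms out of `R X` are obtained from the dual bases of the spaces `C(B, Y)` and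
`C(Y, B)`: these give the dinatural family `∑ (X ⊗ gᵢ^∨ ≫ ψ) ⊗ gᵢ'`. -/
theorem exists_tr_eq {A B X : C} (ψ : X ⊗ Bᘁ ⟶ A) : ∃ φ : R.obj X ⟶ boxObj k A B,
    ∀ h : A ⟶ X ⊗ Bᘁ, τ.tr (F.map (d.Φ h ≫ φ)) = τ.tr (h ≫ ψ) := by
  choose n g g' h1 h2 using fun Y => τ.exists_dualBases B Y
  obtain ⟨φ, hφ⟩ := d.exists_desc X
    (fun Y => boxMor (∑ i, dualTmul (k := k) ψ Y Y (g Y i) (g' Y i))) (by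
      intro Y Y' f
      rw [boxMor_comp, boxMor_comp]
      congr 1
      have e1 : ∀ i, (LinProd.tmul (X ◁ fᘁ) (𝟙 Y) : (⟨X ⊗ Y'ᘁ, Y⟩ : LinProd k C) ⟶ _) ≫
          dualTmul ψ Y Y (g Y i) (g' Y i) = dualTmul ψ Y' Y (g Y i ≫ f) (g' Y i) := fun i => by
        change LinProd.tmul _ _ ≫ LinProd.tmul _ _ = LinProd.tmul _ _
        rw [LinProd.tmul_comp_tmul, Category.id_comp, comp_rightAdjointMate,
          MonoidalCategory.whiskerLeft_comp, Category.assoc]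
      have e2 : ∀ j, (LinProd.tmul (𝟙 (X ⊗ Y'ᘁ)) f : (⟨X ⊗ Y'ᘁ, Y⟩ : LinProd k C) ⟶ _) ≫
          dualTmul ψ Y' Y' (g Y' j) (g' Y' j) = dualTmul ψ Y' Y (g Y' j) (f ≫ g' Y' j) :=
        fun j => by
          change LinProd.tmul _ _ ≫ LinProd.tmul _ _ = LinProd.tmul _ _
          rw [LinProd.tmul_comp_tmul, Category.id_comp]
      have e3 : ∀ i, dualTmul (k := k) ψ Y' Y (g Y i ≫ f) (g' Y i) =
          ∑ j, τ.tr ((g Y i ≫ f) ≫ g' Y' j) • dualTmul ψ Y' Y (g Y' j) (g' Y i) := fun i => by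
        conv_lhs => rw [h1 Y' (g Y i ≫ f)]
        simp only [map_sum, map_smul, LinearMap.sum_apply, LinearMap.smul_apply]
      have e4 : ∀ j, dualTmul (k := k) ψ Y' Y (g Y' j) (f ≫ g' Y' j) =
          ∑ i, τ.tr ((g Y i ≫ f) ≫ g' Y' j) • dualTmul ψ Y' Y (g Y' j) (g' Y i) := fun j => by
        conv_lhs => rw [h2 Y (f ≫ g' Y' j)]
        simp only [map_sum, map_smul, Category.assoc]
      simp only [Preadditive.comp_sum, e1, e2, e3, e4]
      exact Finset.sum_comm)
  refine ⟨φ, fun h => ?_⟩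
  rw [Φ, Category.assoc, hφ, boxMor_comp, τ.tr_map_boxMor F b, Preadditive.comp_sum, map_sum]
  have e : ∀ i, τ.linProd.tr ((LinProd.tmul h (𝟙 B) : (⟨A, B⟩ : LinProd k C) ⟶ _) ≫
      dualTmul ψ B B (g B i) (g' B i)) = τ.tr (h ≫ X ◁ (τ.tr (g' B i) • g B i)ᘁ ≫ ψ) := fun i => by
    rw [rightAdjointMate_smul, MonoidalLinear.whiskerLeft_smul, Linear.smul_comp, Linear.comp_smul,
      map_smul, smul_eq_mul, mul_comm, ← τ.linProd_tr_tmul]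
    change τ.linProd.tr (LinProd.tmul _ _ ≫ LinProd.tmul _ _) = _
    rw [LinProd.tmul_comp_tmul, Category.id_comp]
  have e' : ∀ x : Fin (n B) → (B ⟶ B), ∑ i, τ.tr (h ≫ X ◁ (x i)ᘁ ≫ ψ) =
      τ.tr (h ≫ X ◁ (∑ i, x i)ᘁ ≫ ψ) := fun x =>
    (map_sum (AddMonoidHom.mk' (fun x : B ⟶ B => τ.tr (h ≫ X ◁ xᘁ ≫ ψ)) fun a b => by
      simp only [rightAdjointMate_add, MonoidalPreadditive.whiskerLeft_add, Preadditive.add_comp,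
        Preadditive.comp_add, map_add]) x _).symm
  have h3 : ∑ i, τ.tr (g' B i) • g B i = 𝟙 B := by
    have := h1 B (𝟙 B)
    simp only [Category.id_comp] at this
    exact this.symm
  simp only [e]
  rw [e', h3, rightAdjointMate_id, MonoidalCategory.whiskerLeft_id, Category.id_comp]

variable [F.Additive]

include b in
/-- A morphism out of `R X` that pairs to zero with all the morphisms `Φ h` is zero. -/
theorem eq_zero_of_tr_Φ {A B X : C} (φ : R.obj X ⟶ boxObj k A B)
    (hφ : ∀ h : A ⟶ X ⊗ Bᘁ, τ.tr (F.map (d.Φ h ≫ φ)) = 0) : φ = 0 := by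
  refine d.hom_ext fun Y => ?_
  rw [comp_zero]
  refine τ.eq_zero_of_tr_map F b _ fun g => ?_
  obtain ⟨z, rfl⟩ := boxMor_surjective g
  rw [F.map_comp, τ.cyc, ← F.map_comp]
  induction z using LinProd.hom_induction with
  | h0 => rw [boxMor_zero, zero_comp, F.map_zero, map_zero]
  | ha x y hx hy => rw [boxMor_add, Preadditive.add_comp, F.map_add, map_add, hx, hy, add_zero]
  | ht h g => rw [← Category.assoc, boxMor_comp_π, hφ]

/-- Multiplication by the scalar `a` on `A ⊠ B`. -/
def boxScalar (a : k) (A B : C) : boxObj k A B ⟶ boxObj k A B :=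
  boxMor (a • 𝟙 (⟨A, B⟩ : LinProd k C))

include b in
theorem tr_map_comp_boxScalar {A B : C} (x : boxObj k A B ⟶ boxObj k A B) (a : k) :
    τ.tr (F.map (x ≫ boxScalar a A B)) = a * τ.tr (F.map x) := by
  obtain ⟨z, rfl⟩ := boxMor_surjective x
  rw [boxScalar, boxMor_comp, τ.tr_map_boxMor F b, τ.tr_map_boxMor F b, Linear.comp_smul,
    Category.comp_id, map_smul, smul_eq_mul]

include b in
/-- The pairing of a morphism out of `R X` with the morphisms `Φ h` is linear in `h`. -/
theorem exists_linearMap_tr {A B X : C} (φ : R.obj X ⟶ boxObj k A B) :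
    ∃ L : (A ⟶ X ⊗ Bᘁ) →ₗ[k] k, ∀ h, L h = τ.tr (F.map (d.Φ h ≫ φ)) := by
  obtain ⟨z, hz⟩ := boxMor_surjective (d.π X B ≫ φ)
  refine ⟨{ toFun := fun h => τ.tr (F.map (d.Φ h ≫ φ)), map_add' := ?_, map_smul' := ?_ },
    fun _ => rfl⟩
  · intro h h'
    rw [Φ_add, Preadditive.add_comp, F.map_add, map_add]
  · intro a h
    rw [Φ, Φ, Category.assoc, Category.assoc, ← hz, boxMor_comp, boxMor_comp,
      τ.tr_map_boxMor F b, τ.tr_map_boxMor F b, LinProd.smul_tmul, Linear.smul_comp, map_smul]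
    rfl

include τ b in
/-- The functor `R` is right adjoint to the tensor product on the objects `A ⊠ B`, since
`C(A, X ⊗ B^∨) ≅ C(A ⊗ B, X)`. Both sides are finite-dimensional with nondegenerate pairings, and
`Φ` has an adjoint for these pairings by `exists_tr_eq`: this gives injectivity, and surjectivity
since by `eq_zero_of_tr_Φ` a morphism `R X ⟶ A ⊠ B` is determined by its pairings with all `Φ h`. -/
theorem Φ_bijective (A B X : C) : Function.Bijective (d.Φ (A := A) (B := B) (X := X)) := by
  constructor
  · intro h h' hh
    rw [← sub_eq_zero]
    have h0 : d.Φ (h - h') = 0 := by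
      have := d.Φ_add (h - h') h'
      rw [sub_add_cancel, hh] at this
      simpa using this
    refine τ.nondeg _ fun ψ => ?_
    obtain ⟨φ, hφ⟩ := d.exists_tr_eq τ F b ψ
    rw [← hφ, h0, zero_comp, F.map_zero, map_zero]
  · intro g
    obtain ⟨n, h, h', h1, -⟩ := τ.exists_dualBases A (X ⊗ Bᘁ)
    choose φ hφ using fun i => d.exists_tr_eq τ F b (h' i)
    refine ⟨∑ i, τ.tr (F.map (g ≫ φ i)) • h i, ?_⟩
    rw [← sub_eq_zero]
    refine τ.eq_zero_of_tr_map F b _ fun χ => ?_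
    obtain ⟨L, hL⟩ := d.exists_linearMap_tr τ F b χ
    -- the morphisms `φ i` span the space of morphisms `R X ⟶ A ⊠ B`
    have hχ : χ = ∑ i, φ i ≫ boxScalar (L (h i)) A B := by
      rw [← sub_eq_zero]
      refine d.eq_zero_of_tr_Φ τ F b _ fun x => ?_
      rw [Preadditive.comp_sub, F.map_sub, map_sub, ← hL, Preadditive.comp_sum, F.map_sum, map_sum,
        sub_eq_zero]
      conv_lhs => rw [h1 x]
      rw [map_sum]
      refine Finset.sum_congr rfl fun i _ => ?_
      rw [← Category.assoc, tr_map_comp_boxScalar τ F b, hφ, map_smul, smul_eq_mul, mul_comm]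
    have hg : τ.tr (F.map (g ≫ χ)) = ∑ i, L (h i) * τ.tr (F.map (g ≫ φ i)) := by
      conv_lhs => rw [hχ]
      rw [Preadditive.comp_sum, F.map_sum, map_sum]
      refine Finset.sum_congr rfl fun i _ => ?_
      rw [← Category.assoc, tr_map_comp_boxScalar τ F b]
    rw [Preadditive.sub_comp, F.map_sub, map_sub, ← hL, map_sum, hg, sub_eq_zero]
    refine Finset.sum_congr rfl fun i _ => ?_
    rw [map_smul, smul_eq_mul, mul_comm]

end trace

end TensorCoend

end

end CentreOfAlgebra

end

noncomputable section

namespace CentreOfAlgebra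

section

variable {k : Type w} [Field k] {C : Type u} [Category.{v} C] [Abelian C] [Linear k C]
  [MonoidalCategory C] [MonoidalPreadditive C] [MonoidalLinear k C] [RightRigidCategory C]

namespace TensorCoend

variable {R : C ⥤ DeligneProd k C} (d : TensorCoend R)

/-- The component `A ⊠ B ⟶ R (A ⊗ B)` of the unit. -/
def boxUnit (A B : C) : boxObj k A B ⟶ R.obj (A ⊗ B) :=
  d.Φ (tensorRightHomEquiv A B Bᘁ (A ⊗ B) (𝟙 (A ⊗ B)))

theorem boxUnit_comp_map {A B X : C} (f : A ⊗ B ⟶ X) :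
    d.boxUnit A B ≫ R.map f = d.Φ (tensorRightHomEquiv A B Bᘁ X f) := by
  rw [boxUnit, Φ_comp_map, ← tensorRightHomEquiv_naturality, Category.id_comp]

theorem tensorRightHomEquiv_tensorHom_comp {A A' B B' X : C} (f : A ⟶ A') (g : B ⟶ B')
    (x : A' ⊗ B' ⟶ X) : tensorRightHomEquiv A B Bᘁ X ((f ⊗ₘ g) ≫ x) =
      f ≫ tensorRightHomEquiv A' B' B'ᘁ X x ≫ X ◁ gᘁ := by
  have h : ∀ y : A' ⟶ X ⊗ B'ᘁ, (tensorRightHomEquiv A' B Bᘁ X).symm (y ≫ X ◁ gᘁ) =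
      A' ◁ g ≫ (tensorRightHomEquiv A' B' B'ᘁ X).symm y := fun y => by
    simp only [tensorRightHomEquiv, Equiv.coe_fn_symm_mk, comp_whiskerRight, Category.assoc]
    rw [associator_naturality_middle_assoc, ← MonoidalCategory.whiskerLeft_comp_assoc,
      rightAdjointMate_comp_evaluation, whisker_exchange_assoc,
      MonoidalCategory.whiskerLeft_comp_assoc, associator_naturality_right_assoc]
  rw [← Equiv.eq_symm_apply, tensorRightHomEquiv_symm_naturality, h, Equiv.symm_apply_apply,
    MonoidalCategory.tensorHom_def, Category.assoc]

/-- The morphism `A ⊗ B ⟶ A' ⊗ B'` given by a morphism of `C ⊗ C`. -/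
def tensorMor {A A' B B' : C} (z : (⟨A, B⟩ : LinProd k C) ⟶ ⟨A', B'⟩) : A ⊗ B ⟶ A' ⊗ B' :=
  (linProdTensor k C).map z

theorem boxUnit_naturality {A A' B B' : C} (z : (⟨A, B⟩ : LinProd k C) ⟶ ⟨A', B'⟩) :
    boxMor z ≫ d.boxUnit A' B' = d.boxUnit A B ≫ R.map (tensorMor z) := by
  have := d.additive
  induction z using LinProd.hom_induction with
  | h0 =>
    have h : tensorMor (0 : (⟨A, B⟩ : LinProd k C) ⟶ ⟨A', B'⟩) = 0 :=
      (linProdTensor k C).map_zero _ _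
    rw [boxMor_zero, zero_comp, h, R.map_zero, comp_zero]
  | ha x y hx hy =>
    have h : tensorMor (x + y) = tensorMor x + tensorMor y := (linProdTensor k C).map_add
    rw [boxMor_add, Preadditive.add_comp, hx, hy, h, R.map_add, Preadditive.comp_add]
  | ht f g =>
    have h : tensorMor (LinProd.tmul f g : (⟨A, B⟩ : LinProd k C) ⟶ ⟨A', B'⟩) = f ⊗ₘ g :=
      linProdTensor_map_tmul f g
    rw [h, boxUnit_comp_map, boxUnit, boxMor_comp_Φ, ← tensorRightHomEquiv_tensorHom_comp,
      Category.comp_id]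

variable [∀ X Y : C, Module.Finite k (X ⟶ Y)] (τ : MultiplicativeTrace k C)
  (F : DeligneProd k C ⥤ C) (b : toEnvelope (LinProd k C) ⋙ F ≅ linProdTensor k C) [F.Additive]

include τ in
/-- An additive functor `F : C ⊠ C ⥤ C` with `F (X ⊠ Y) ≅ X ⊗ Y` is left adjoint to the functor
sending `X` to the coend of `(X ⊗ Y^∨) ⊠ Y`. -/
theorem exists_adjunction : ∃ adj : F ⊣ R, ∀ X Y : C,
    F.map (d.π X Y) ≫ adj.counit.app X =
      b.hom.app ⟨X ⊗ Yᘁ, Y⟩ ≫ (α_ X Yᘁ Y).hom ≫ (X ◁ ε_ Y Yᘁ) ≫ (ρ_ X).hom := by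
  have := d.additive
  let β : ∀ A B : C, F.obj (boxObj k A B) ≅ A ⊗ B := fun A B => b.app ⟨A, B⟩
  have hβ : ∀ {A B A' B' : C} (z : (⟨A, B⟩ : LinProd k C) ⟶ ⟨A', B'⟩),
      (β A B).inv ≫ F.map (boxMor z) = tensorMor z ≫ (β A' B').inv :=
    fun z => (b.inv.naturality z).symm
  -- the unit `γ`, extended from the objects `A ⊠ B`
  obtain ⟨γ, hγ⟩ := (isGenerating_toEnvelope (A := LinProd k C)).exists_natTrans
    (𝟭 (DeligneProd k C)) (F ⋙ R)
    { app := fun a => d.boxUnit a.fst a.snd ≫ R.map (β a.fst a.snd).inv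
      naturality := fun a a' z => by
        change boxMor z ≫ d.boxUnit a'.fst a'.snd ≫ R.map (β a'.fst a'.snd).inv =
          (d.boxUnit a.fst a.snd ≫ R.map (β a.fst a.snd).inv) ≫ R.map (F.map (boxMor z))
        rw [Category.assoc, ← R.map_comp, hβ, R.map_comp, ← Category.assoc, ← Category.assoc]
        exact congrArg (· ≫ _) (d.boxUnit_naturality z) }
  have hγ' : ∀ {A B X : C} (f : A ⊗ B ⟶ X), γ.app (boxObj k A B) ≫ R.map ((β A B).hom ≫ f) =
      d.Φ (tensorRightHomEquiv A B Bᘁ X f) := fun {A B X} f => by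
    have h1 : γ.app (boxObj k A B) = d.boxUnit A B ≫ R.map (β A B).inv := hγ ⟨A, B⟩
    rw [h1, Category.assoc, ← R.map_comp, Iso.inv_hom_id_assoc, boxUnit_comp_map]
  have nat : ∀ {Z W : DeligneProd k C} (i : Z ⟶ W), i ≫ γ.app W = γ.app Z ≫ R.map (F.map i) :=
    fun i => γ.naturality i
  have hbox : ∀ A B X : C, Function.Bijective
      (fun f : F.obj (boxObj k A B) ⟶ X => γ.app (boxObj k A B) ≫ R.map f) := fun A B X => by
    have h1 : (fun f : F.obj (boxObj k A B) ⟶ X => γ.app (boxObj k A B) ≫ R.map f) =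
        fun f => d.Φ (tensorRightHomEquiv A B Bᘁ X ((β A B).inv ≫ f)) := funext fun f => by
      rw [← hγ', Iso.hom_inv_id_assoc]
    rw [h1]
    exact (d.Φ_bijective τ F b A B X).comp ((tensorRightHomEquiv A B Bᘁ X).bijective.comp
      ((β A B).homFromEquiv (Z := X)).bijective)
  have hcomp : ∀ {Z W : DeligneProd k C} {X : C} (i : Z ⟶ W) (f : F.obj W ⟶ X),
      γ.app Z ≫ R.map (F.map i ≫ f) = i ≫ γ.app W ≫ R.map f := fun i f => by
    rw [R.map_comp, ← Category.assoc, ← Category.assoc]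
    exact congrArg (· ≫ _) (nat i).symm
  have hbij : ∀ (Z : DeligneProd k C) (X : C), Function.Bijective
      (fun f : F.obj Z ⟶ X => γ.app Z ≫ R.map f) := fun Z X => by
    constructor
    · intro f f' hf
      refine isGenerating_toEnvelope.map_hom_ext F fun a i => (hbox a.fst a.snd X).1 ?_
      exact (hcomp i f).trans ((congrArg (i ≫ ·) hf).trans (hcomp i f').symm)
    · intro g
      obtain ⟨J, _, a, p, i, hpi⟩ := isGenerating_toEnvelope Z
      choose f hf using fun j => (hbox (a j).fst (a j).snd X).2 (i j ≫ g)
      refine ⟨∑ j, F.map (p j) ≫ f j, ?_⟩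
      change γ.app Z ≫ R.map _ = g
      rw [R.map_sum, Preadditive.comp_sum]
      have h1 : ∀ j, γ.app Z ≫ R.map (F.map (p j) ≫ f j) = p j ≫ i j ≫ g := fun j => by
        exact (hcomp (p j) (f j)).trans (congrArg (p j ≫ ·) (hf j))
      have h2 : ∀ g : Z ⟶ R.obj X, ∑ j, p j ≫ i j ≫ g = g := fun g => by
        simp only [← Category.assoc]
        rw [← Preadditive.sum_comp, hpi, Category.id_comp]
      simp only [h1]
      exact h2 g
  let e : ∀ (Z : DeligneProd k C) (X : C), (F.obj Z ⟶ X) ≃ (Z ⟶ R.obj X) := fun Z X =>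
    Equiv.ofBijective _ (hbij Z X)
  have he : ∀ {Z : DeligneProd k C} {X : C} (f : F.obj Z ⟶ X), e Z X f = γ.app Z ≫ R.map f :=
    fun f => rfl
  refine ⟨Adjunction.mkOfHomEquiv
    { homEquiv := e
      homEquiv_naturality_left_symm := fun f g => by
        rw [Equiv.symm_apply_eq, he, hcomp, ← he, Equiv.apply_symm_apply]
      homEquiv_naturality_right := fun f g => by
        rw [he, he, R.map_comp, Category.assoc] }, fun X Y => ?_⟩
  rw [Adjunction.mkOfHomEquiv_counit_app]
  apply (hbox (X ⊗ Yᘁ) Y X).1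
  have h1 : γ.app _ ≫ R.map (F.map (d.π X Y) ≫ (e (R.obj X) X).symm (𝟙 _)) = d.π X Y := by
    rw [hcomp, ← he, Equiv.apply_symm_apply, Category.comp_id]
  have h2 : d.Φ (tensorRightHomEquiv (X ⊗ Yᘁ) Y Yᘁ X
      ((α_ X Yᘁ Y).hom ≫ (X ◁ ε_ Y Yᘁ) ≫ (ρ_ X).hom)) = d.π X Y := by
    have h3 : (α_ X Yᘁ Y).hom ≫ (X ◁ ε_ Y Yᘁ) ≫ (ρ_ X).hom =
        (tensorRightHomEquiv (X ⊗ Yᘁ) Y Yᘁ X).symm (𝟙 _) := by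
      simp [tensorRightHomEquiv]
    rw [h3, Equiv.apply_symm_apply, Φ]
    exact (congrArg (· ≫ _) boxMor_id).trans (Category.id_comp _)
  exact h1.trans (h2.symm.trans (hγ' _).symm)

end TensorCoend

theorem toEnvelopeMapIso_inv_naturality {A B : Type u} [Category.{v} A] [Preadditive A]
    [Category.{v} B] [Preadditive B] {F G : A ⥤ B} [F.Additive] [G.Additive] (α : F ⟶ G) (a : A) :
    (toEnvelope B).map (α.app a) ≫ (toEnvelopeMapIso G).inv.app a =
      (toEnvelopeMapIso F).inv.app a ≫ (mapEnvelopeNat α).app ((toEnvelope A).obj a) := by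
  apply Idempotents.Karoubi.hom_ext
  let M : Mat_ A := (Mat_.embedding A).obj a
  have h : ∀ (H : A ⥤ B) [H.Additive], ((toEnvelopeMapIso H).inv.app a).f = 𝟙 (H.mapMat_.obj M) :=
    fun H _ => Category.id_comp _
  have hα : ((mapEnvelopeNat α).app ((toEnvelope A).obj a)).f = (mapMatNat α).app M := by
    change F.mapMat_.map (𝟙 M) ≫ (mapMatNat α).app M = _
    rw [F.mapMat_.map_id, Category.id_comp]
  have hβ : (mapMatNat α).app M = (Mat_.embedding B).map (α.app a) := by
    funext i j
    refine (congrArg (fun x => F.map x ≫ α.app a) (Mat_.id_apply_self M PUnit.unit)).trans ?_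
    exact (congrArg (· ≫ α.app a) (F.map_id a)).trans (Category.id_comp _)
  refine Eq.trans (congrArg ((Mat_.embedding B).map (α.app a) ≫ ·) (h G)) (Eq.trans ?_
    (congrArg₂ (· ≫ ·) (h F) (hα.trans hβ)).symm)
  exact (Category.comp_id _).trans (Category.id_comp _).symm

theorem boxUnitMulIso_naturality_left {X X' : C} (f : X ⟶ X') (A B : C) :
    boxMor (LinProd.tmul (f ▷ A) (𝟙 B)) ≫ (boxUnitMulIso k X' A B).hom =
      (boxUnitMulIso k X A B).hom ≫ ((boxUnitMul k C).map f).app (boxObj k A B) := by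
  have h := toEnvelopeMapIso_inv_naturality (LinProd.mulLeftMap (k := k) f (𝟙_ C)) ⟨A, B⟩
  have h1 : boxMor (k := k) (LinProd.tmul (f ▷ A) (𝟙 B)) ≫
      boxMor (LinProd.tmul (𝟙 (X' ⊗ A)) (λ_ B).inv) =
      boxMor (LinProd.tmul (𝟙 (X ⊗ A)) (λ_ B).inv) ≫
        boxMor (LinProd.tmul (f ▷ A) (𝟙 (𝟙_ C ⊗ B))) := by
    rw [boxMor_comp, boxMor_comp, LinProd.tmul_comp_tmul, LinProd.tmul_comp_tmul]
    simp only [Category.comp_id, Category.id_comp]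
  exact paste h1 h

/-- The coends `(X ⊠ 𝟙) ⊗ R̃` as a functor of `X`. -/
def tensorCoendMulFunctor (c : Cowedge (dualBox k C))
    (hc : ∀ X, IsColimit (mulCowedge k X c)) : TensorCoend (mulFunctor k c.pt) where
  π X Y := (mulCowedge k X c).π Y
  dinatural X Y Y' f := Cowedge.condition (mulCowedge k X c) f
  naturality {X X'} f Y := by
    have h1 : boxMor (LinProd.tmul (f ▷ Yᘁ) (𝟙 Y)) ≫ (boxUnitMulIso k X' Yᘁ Y).hom =
        (boxUnitMulIso k X Yᘁ Y).hom ≫ ((boxUnitMul k C).map f).app (boxObj k Yᘁ Y) :=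
      boxUnitMulIso_naturality_left f Yᘁ Y
    exact paste h1 (((boxUnitMul k C).map f).naturality (c.π Y)).symm
  exists_desc X Z κ hκ := by
    let e : Cowedge (tensorDualBox k X) := Cowedge.mk (F := tensorDualBox k X) Z κ
      (fun Y Y' f => hκ f)
    exact ⟨(hc X).desc e, fun Y => (hc X).fac e (WalkingMultispan.right Y)⟩
  hom_ext {X Z φ φ'} h := Cowedge.IsColimit.hom_ext (hc X) h

end

end CentreOfAlgebra

end

noncomputable section

namespace CentreOfAlgebra

/-! ### Left centres -/

section

variable {D : Type*} [Category* D] [MonoidalCategory D] [BraidedCategory D]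

namespace IsLeftCentral

variable {B : D} {m : MonObj B} {Y Y' : D} {y : Y ⟶ B} {y' : Y' ⟶ B}

theorem comp (hy : IsLeftCentral m y) (f : Y' ⟶ Y) : IsLeftCentral m (f ≫ y) := by
  unfold IsLeftCentral at hy ⊢
  rw [comp_whiskerRight, Category.assoc, hy, BraidedCategory.braiding_naturality_left_assoc,
    MonoidalCategory.whiskerLeft_comp, Category.assoc]

theorem one : IsLeftCentral m m.one := by
  unfold IsLeftCentral
  rw [m.one_mul, m.mul_one]
  exact (braiding_rightUnitor B).symm

theorem mul (hy : IsLeftCentral m y) (hy' : IsLeftCentral m y') :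
    IsLeftCentral m ((y ⊗ₘ y') ≫ m.mul) := by
  unfold IsLeftCentral at hy hy' ⊢
  have h1 : m.mul ▷ B ≫ m.mul = (α_ B B B).hom ≫ B ◁ m.mul ≫ m.mul := m.mul_assoc
  have h2 : B ◁ m.mul ≫ m.mul = (α_ B B B).inv ≫ m.mul ▷ B ≫ m.mul := by
    rw [h1, Iso.inv_hom_id_assoc]
  calc ((y ⊗ₘ y') ≫ m.mul) ▷ B ≫ m.mul
    _ = (α_ Y Y' B).hom ≫ y ▷ (Y' ⊗ B) ≫ B ◁ (y' ▷ B ≫ m.mul) ≫ m.mul := by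
      rw [comp_whiskerRight, Category.assoc, h1, MonoidalCategory.tensorHom_def]
      simp
    _ = (α_ Y Y' B).hom ≫ Y ◁ ((β_ Y' B).hom ≫ B ◁ y') ≫ (α_ Y B B).inv ≫
        (y ▷ B ≫ m.mul) ▷ B ≫ m.mul := by
      rw [hy', ← Category.assoc (β_ Y' B).hom, MonoidalCategory.whiskerLeft_comp, Category.assoc,
        h2, ← whisker_exchange_assoc]
      simp
    _ = (β_ (Y ⊗ Y') B).hom ≫ B ◁ ((y ⊗ₘ y') ≫ m.mul) ≫ m.mul := by
      rw [hy, MonoidalCategory.whiskerLeft_comp B, Category.assoc, h2,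
        MonoidalCategory.tensorHom_def', BraidedCategory.braiding_tensor_left_hom]
      simp only [MonoidalCategory.whiskerLeft_comp, comp_whiskerRight, Category.assoc]
      rw [← associator_naturality_right_assoc, ← whisker_exchange_assoc,
        ← associator_inv_naturality_right_assoc]
      simp

/-- Elements of the left centre commute with each other. -/
theorem braiding_mul (hy : IsLeftCentral m y) (y' : Y' ⟶ B) :
    (β_ Y Y').hom ≫ (y' ⊗ₘ y) ≫ m.mul = (y ⊗ₘ y') ≫ m.mul := by
  unfold IsLeftCentral at hy
  rw [MonoidalCategory.tensorHom_def' y y', Category.assoc, hy,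
    BraidedCategory.braiding_naturality_right_assoc, MonoidalCategory.tensorHom_def y' y,
    Category.assoc]

end IsLeftCentral

namespace IsLeftCentre

variable {B : D} {m : MonObj B} {L : D} {l : L ⟶ B} (h : IsLeftCentre m L l)

include h

theorem mono : Mono l where
  right_cancellation {W} f _ hfg :=
    (h.terminal W (f ≫ l) (h.central.comp f)).unique rfl hfg.symm

/-- The left centre is a commutative subalgebra. -/
theorem exists_monObj : ∃ n : MonObj L, IsCommAlg n ∧ IsAlgHom n m l := by
  have := h.mono
  obtain ⟨u, hu, -⟩ := h.terminal _ _ IsLeftCentral.one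
  obtain ⟨μ, hμ, -⟩ := h.terminal _ _ (h.central.mul h.central)
  refine ⟨{ one := u, mul := μ, one_mul := ?_, mul_one := ?_, mul_assoc := ?_ }, ?_, ⟨hu, hμ⟩⟩
  · rw [← cancel_mono l, Category.assoc, hμ, MonoidalCategory.tensorHom_def, Category.assoc,
      ← comp_whiskerRight_assoc, hu, ← whisker_exchange_assoc, m.one_mul, leftUnitor_naturality]
  · rw [← cancel_mono l, Category.assoc, hμ, MonoidalCategory.tensorHom_def', Category.assoc,
      ← MonoidalCategory.whiskerLeft_comp_assoc, hu, whisker_exchange_assoc, m.mul_one,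
      rightUnitor_naturality]
  · have h1 : μ ▷ L ≫ (l ⊗ₘ l) = ((l ⊗ₘ l) ⊗ₘ l) ≫ m.mul ▷ B := by
      rw [← MonoidalCategory.tensorHom_id, ← MonoidalCategory.tensorHom_id,
        MonoidalCategory.tensorHom_comp_tensorHom, MonoidalCategory.tensorHom_comp_tensorHom, hμ,
        Category.id_comp, Category.comp_id]
    have h2 : L ◁ μ ≫ (l ⊗ₘ l) = (l ⊗ₘ l ⊗ₘ l) ≫ B ◁ m.mul := by
      rw [← MonoidalCategory.id_tensorHom, ← MonoidalCategory.id_tensorHom,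
        MonoidalCategory.tensorHom_comp_tensorHom, MonoidalCategory.tensorHom_comp_tensorHom, hμ,
        Category.id_comp, Category.comp_id]
    have h3 : m.mul ▷ B ≫ m.mul = (α_ B B B).hom ≫ B ◁ m.mul ≫ m.mul := m.mul_assoc
    rw [← cancel_mono l, Category.assoc, Category.assoc, Category.assoc, hμ, reassoc_of% h1,
      reassoc_of% h2, h3, associator_naturality_assoc]
  · change (β_ L L).hom ≫ μ = μ
    rw [← cancel_mono l, Category.assoc, hμ, h.central.braiding_mul]

end IsLeftCentre

end

/-- Left centres exist in the presence of a nondegenerate trace: the left central morphisms form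
a subfunctor of a representable functor, which is represented by a direct summand. -/
theorem exists_isLeftCentre {k : Type*} [Field k] {D : Type*} [Category* D] [Preadditive D]
    [Linear k D] [∀ X Y : D, Module.Finite k (X ⟶ Y)] [MonoidalCategory D] [MonoidalPreadditive D]
    [BraidedCategory D] [IsIdempotentComplete D] (τ : SemisimpleTrace k D) {B : D}
    (m : MonObj B) : ∃ L l, IsLeftCentre m L l := by
  obtain ⟨e, he, h⟩ := τ.exists_idempotent' (P := B) (fun W => {f | IsLeftCentral m f})
    (by simp [IsLeftCentral])
    (fun f (hf : IsLeftCentral m f) g (hg : IsLeftCentral m g) => by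
      change IsLeftCentral m (f + g)
      unfold IsLeftCentral at hf hg ⊢
      rw [MonoidalPreadditive.add_whiskerRight, Preadditive.add_comp, hf, hg,
        MonoidalPreadditive.whiskerLeft_add, Preadditive.add_comp, Preadditive.comp_add])
    (fun W W' f g hf => IsLeftCentral.comp hf g)
  obtain ⟨L, i, p, hip, hpi⟩ := IsIdempotentComplete.idempotents_split B e (h B e he)
  refine ⟨L, i, ⟨?_, fun Y y hy => ⟨y ≫ p, ?_, fun f hf => ?_⟩⟩⟩
  · have hi : i = i ≫ e := by rw [← hpi, reassoc_of% hip]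
    rw [hi]
    exact IsLeftCentral.comp he i
  · change (y ≫ p) ≫ i = y
    rw [Category.assoc, hpi, h Y y hy]
  · rw [← hf, Category.assoc, hip, Category.comp_id]

end CentreOfAlgebra

end

noncomputable section

namespace CentreOfAlgebra

/-! ### Cofree objects of the centre and full centres -/

section

open scoped MonObj

variable {C : Type u} [Category.{v} C] [MonoidalCategory C]

section augmentation

variable {M : C} {ε : M ⟶ 𝟙_ C} {u : 𝟙_ C ⟶ M} {p : M ⊗ M ⟶ M} (hu : u ≫ ε = 𝟙 (𝟙_ C))
  (hp : p ≫ ε = (ε ⊗ₘ ε) ≫ (λ_ (𝟙_ C)).hom)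

include hu hp in
theorem augmentation_one_mul : (u ▷ M ≫ p) ≫ ε = (λ_ M).hom ≫ ε := by
  rw [Category.assoc, hp, MonoidalCategory.tensorHom_def, Category.assoc,
    ← comp_whiskerRight_assoc, hu]
  simp

include hu hp in
theorem augmentation_mul_one : (M ◁ u ≫ p) ≫ ε = (ρ_ M).hom ≫ ε := by
  rw [Category.assoc, hp, MonoidalCategory.tensorHom_def', Category.assoc,
    ← MonoidalCategory.whiskerLeft_comp_assoc, hu, unitors_equal]
  simp

include hp in
theorem augmentation_mul_assoc :
    (p ▷ M ≫ p) ≫ ε = ((α_ M M M).hom ≫ M ◁ p ≫ p) ≫ ε := by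
  have h1 : p ▷ M ≫ (ε ⊗ₘ ε) = ((ε ⊗ₘ ε) ⊗ₘ ε) ≫ (λ_ (𝟙_ C)).hom ▷ 𝟙_ C := by
    rw [← MonoidalCategory.tensorHom_id, ← MonoidalCategory.tensorHom_id,
      MonoidalCategory.tensorHom_comp_tensorHom, MonoidalCategory.tensorHom_comp_tensorHom, hp,
      Category.id_comp, Category.comp_id]
  have h2 : M ◁ p ≫ (ε ⊗ₘ ε) = (ε ⊗ₘ ε ⊗ₘ ε) ≫ 𝟙_ C ◁ (λ_ (𝟙_ C)).hom := by
    rw [← MonoidalCategory.id_tensorHom, ← MonoidalCategory.id_tensorHom,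
      MonoidalCategory.tensorHom_comp_tensorHom, MonoidalCategory.tensorHom_comp_tensorHom, hp,
      Category.id_comp, Category.comp_id]
  rw [Category.assoc, Category.assoc, Category.assoc, hp, reassoc_of% h1, reassoc_of% h2,
    ← associator_naturality_assoc]
  congr 1
  monoidal

end augmentation

/-- If `M` is cofree on `𝟙`, the unit and the multiplication lift uniquely along `ε` from those of
`𝟙`, and the axioms may be checked after composition with `ε`. -/
theorem existsUnique_monObj {M : Center C} {ε : M.1 ⟶ 𝟙_ C}
    (hε : ∀ W : Center C, Function.Bijective (fun f : W ⟶ M => f.f ≫ ε)) :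
    ∃! m : MonObj M, IsAlgHomToBase m ε := by
  have ext : ∀ {W : Center C} {f g : W ⟶ M}, f.f ≫ ε = g.f ≫ ε → f = g := fun h => (hε _).1 h
  obtain ⟨u, hu⟩ := (hε (𝟙_ (Center C))).2 (𝟙 (𝟙_ C))
  obtain ⟨p, hp⟩ := (hε (M ⊗ M)).2 ((ε ⊗ₘ ε) ≫ (λ_ (𝟙_ C)).hom)
  refine ⟨{ one := u, mul := p, one_mul := ?_, mul_one := ?_, mul_assoc := ?_ }, ⟨hu, hp⟩, ?_⟩
  · exact ext (augmentation_one_mul hu hp)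
  · exact ext (augmentation_mul_one hu hp)
  · exact ext (augmentation_mul_assoc hp)
  · rintro ⟨u', p'⟩ ⟨h1, h2⟩
    have h1' : u' = u := ext (h1.trans hu.symm)
    have h2' : p' = p := ext (h2.trans hp.symm)
    subst h1' h2'
    rfl

variable [BraidedCategory C]

theorem iotaPlus_tensor_β (X Y U : C) :
    (((iotaPlus C).obj X ⊗ (iotaPlus C).obj Y).2.β U).hom = (β_ (X ⊗ Y) U).hom :=
  (BraidedCategory.braiding_tensor_left_hom X Y U).symm

/-- The functor `ι₊` preserves duals. -/
@[reducible]
def exactPairingIotaPlus (X Y : C) [ExactPairing X Y] :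
    ExactPairing ((iotaPlus C).obj X) ((iotaPlus C).obj Y) where
  coevaluation' := ⟨η_ X Y, fun U => by
    rw [iotaPlus_tensor_β]
    refine (BraidedCategory.braiding_naturality_left (η_ X Y) U).trans ?_
    rw [braiding_tensorUnit_left]
    rfl⟩
  evaluation' := ⟨ε_ X Y, fun U => by
    rw [iotaPlus_tensor_β]
    refine Eq.trans ?_ (BraidedCategory.braiding_naturality_left (ε_ X Y) U)
    rw [braiding_tensorUnit_left]
    rfl⟩
  coevaluation_evaluation' := Center.ext _ _ (by
    change Y ◁ η_ X Y ≫ (α_ ((iotaPlus C).obj Y) ((iotaPlus C).obj X) ((iotaPlus C).obj Y)).inv.f ≫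
      ε_ X Y ▷ Y = (ρ_ Y).hom ≫ (λ_ ((iotaPlus C).obj Y)).inv.f
    rw [Center.associator_inv_f, Center.leftUnitor_inv_f]
    exact ExactPairing.coevaluation_evaluation X Y)
  evaluation_coevaluation' := Center.ext _ _ (by
    change η_ X Y ▷ X ≫ (α_ X Y X).hom ≫ X ◁ ε_ X Y =
      (λ_ X).hom ≫ (ρ_ ((iotaPlus C).obj X)).inv.f
    rw [Center.rightUnitor_inv_f]
    exact ExactPairing.evaluation_coevaluation X Y)

/-- If `M` is cofree on `𝟙`, then `ι₊ X ⊗ M` is cofree on `X`. -/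
theorem bijective_comp_whiskerLeft {M : Center C} {ε : M.1 ⟶ 𝟙_ C}
    (hε : ∀ W : Center C, Function.Bijective (fun f : W ⟶ M => f.f ≫ ε)) (X X' : C)
    [ExactPairing X X'] (W : Center C) :
    Function.Bijective (fun f : W ⟶ (iotaPlus C).obj X ⊗ M => f.f ≫ (X ◁ ε) ≫ (ρ_ X).hom) := by
  let _ := exactPairingIotaPlus X X'
  let e := tensorLeftHomEquiv W ((iotaPlus C).obj X) ((iotaPlus C).obj X') M
  have h : (fun f : W ⟶ (iotaPlus C).obj X ⊗ M => f.f ≫ (X ◁ ε) ≫ (ρ_ X).hom) =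
      fun f => tensorLeftHomEquiv W.1 X X' (𝟙_ C) ((e.symm f).f ≫ ε) ≫ (ρ_ X).hom := by
    funext f
    obtain ⟨g, rfl⟩ := e.surjective f
    have h1 : (e g).f = tensorLeftHomEquiv W.1 X X' M.1 g.f := by
      change (λ_ W).inv.f ≫ η_ X X' ▷ W.1 ≫ (α_ X X' W.1).hom ≫ X ◁ g.f = _
      rw [Center.leftUnitor_inv_f]
      rfl
    rw [Equiv.symm_apply_apply, h1]
    exact ((congrArg (· ≫ (ρ_ X).hom)
      (tensorLeftHomEquiv_naturality (Y := X) (Y' := X') g.f ε)).trans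
      (Category.assoc _ _ _)).symm
  rw [h]
  exact ((ρ_ X).homToEquiv (Z := W.1)).bijective.comp
    ((tensorLeftHomEquiv W.1 X X' (𝟙_ C)).bijective.comp ((hε _).comp e.symm.bijective))

section augmentation

/-- Naturality of the exchange of the two middle factors in `A ⊗ M ⊗ A ⊗ M`. -/
theorem middleExchange_naturality (A : C) {M M' : C} (f : M ⟶ M') :
    ((α_ A M (A ⊗ M)).hom ≫ A ◁ ((α_ M A M).inv ≫ (β_ A M).inv ▷ M ≫ (α_ A M M).hom) ≫
      (α_ A A (M ⊗ M)).inv) ≫ (A ⊗ A) ◁ (f ⊗ₘ f) =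
    (A ◁ f ⊗ₘ A ◁ f) ≫ (α_ A M' (A ⊗ M')).hom ≫
      A ◁ ((α_ M' A M').inv ≫ (β_ A M').inv ▷ M' ≫ (α_ A M' M').hom) ≫ (α_ A A (M' ⊗ M')).inv := by
  have h := @tensorμ_natural C _ _ (reverseBraiding C) _ _ _ _ _ _ _ _ (𝟙 A) f (𝟙 A) f
  rw [MonoidalCategory.id_tensorHom_id, MonoidalCategory.id_tensorHom,
    MonoidalCategory.id_tensorHom] at h
  have hμ : ∀ N : C, @tensorμ C _ _ (reverseBraiding C) A N A N = (α_ A N (A ⊗ N)).hom ≫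
      A ◁ ((α_ N A N).inv ≫ (β_ A N).inv ▷ N ≫ (α_ A N N).hom) ≫ (α_ A A (N ⊗ N)).inv := fun N => by
    simp only [tensorμ, MonoidalCategory.whiskerLeft_comp, Category.assoc]
    rfl
  rw [hμ, hμ] at h
  exact h.symm

variable {M : C} {ε : M ⟶ 𝟙_ C}

theorem augmentation_section {u : 𝟙_ C ⟶ M} (hu : u ≫ ε = 𝟙 (𝟙_ C)) (A : C) :
    ((ρ_ A).inv ≫ A ◁ u) ≫ A ◁ ε ≫ (ρ_ A).hom = 𝟙 A := by
  rw [Category.assoc, ← MonoidalCategory.whiskerLeft_comp_assoc, hu,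
    MonoidalCategory.whiskerLeft_id, Category.id_comp, Iso.inv_hom_id]

theorem augmentation_one {u : 𝟙_ C ⟶ M} (hu : u ≫ ε = 𝟙 (𝟙_ C)) {A : C} (e : 𝟙_ C ⟶ A) :
    ((λ_ (𝟙_ C)).inv ≫ (e ⊗ₘ u)) ≫ A ◁ ε ≫ (ρ_ A).hom = e := by
  rw [Category.assoc, ← MonoidalCategory.id_tensorHom,
    MonoidalCategory.tensorHom_comp_tensorHom_assoc, hu, Category.comp_id,
    MonoidalCategory.tensorHom_id, rightUnitor_naturality, ← unitors_equal, Iso.inv_hom_id_assoc]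

theorem augmentation_mul {p : M ⊗ M ⟶ M} (hp : p ≫ ε = (ε ⊗ₘ ε) ≫ (λ_ (𝟙_ C)).hom) {A : C}
    (q : A ⊗ A ⟶ A) :
    ((α_ A M (A ⊗ M)).hom ≫ A ◁ ((α_ M A M).inv ≫ (β_ A M).inv ▷ M ≫ (α_ A M M).hom) ≫
      (α_ A A (M ⊗ M)).inv ≫ (q ⊗ₘ p)) ≫ A ◁ ε ≫ (ρ_ A).hom =
      ((A ◁ ε ≫ (ρ_ A).hom) ⊗ₘ (A ◁ ε ≫ (ρ_ A).hom)) ≫ q := by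
  have h1 : (q ⊗ₘ p) ≫ A ◁ ε = (A ⊗ A) ◁ (ε ⊗ₘ ε) ≫ (q ⊗ₘ (λ_ (𝟙_ C)).hom) := by
    rw [← MonoidalCategory.id_tensorHom, ← MonoidalCategory.id_tensorHom,
      MonoidalCategory.tensorHom_comp_tensorHom, MonoidalCategory.tensorHom_comp_tensorHom,
      Category.id_comp, Category.comp_id, hp]
  have h2 := middleExchange_naturality A ε
  simp only [Category.assoc] at h2 ⊢
  rw [reassoc_of% h1, reassoc_of% h2, ← MonoidalCategory.tensorHom_comp_tensorHom, Category.assoc]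
  congr 1
  have h3 : (β_ A (𝟙_ C)).inv = (λ_ A).hom ≫ (ρ_ A).inv := by
    rw [← cancel_epi (β_ A (𝟙_ C)).hom, Iso.hom_inv_id]
    simp
  rw [h3, MonoidalCategory.tensorHom_def' q]
  have h4 : (A ⊗ A) ◁ (λ_ (𝟙_ C)).hom ≫ q ▷ 𝟙_ C ≫ (ρ_ A).hom =
      (A ⊗ A) ◁ (λ_ (𝟙_ C)).hom ≫ (ρ_ (A ⊗ A)).hom ≫ q := by
    rw [rightUnitor_naturality]
  rw [Category.assoc, h4]
  monoidal

end augmentation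

section

variable {M : Center C} {m : MonObj M} {ε : M.1 ⟶ 𝟙_ C} (hm : IsAlgHomToBase m ε) (A : C) [MonObj A]

include hm

/-- `A ⊗ ε : A ⊗ M ⟶ A` is a homomorphism of algebras. -/
theorem isAlgHomToBase_tensorAlgebra : IsAlgHomToBase (tensorAlgebra (iotaPlusAlgebra A) m)
    ((A ◁ ε) ≫ (ρ_ A).hom) where
  one := by
    have h1 : (tensorAlgebra (iotaPlusAlgebra A) m).one.f =
        (λ_ (𝟙_ C)).inv ≫ (η[A] ⊗ₘ m.one.f) := by
      change (λ_ (𝟙_ (Center C))).inv.f ≫ ((𝟙 (𝟙_ C) ≫ η[A]) ⊗ₘ m.one.f) = _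
      rw [Center.leftUnitor_inv_f]
      exact congrArg (fun x => (λ_ (𝟙_ C)).inv ≫ (x ⊗ₘ m.one.f)) (Category.id_comp η[A])
    rw [h1]
    exact augmentation_one hm.one η[A]
  mul := by
    have hb : (β_ ((iotaPlus C).obj A) M).inv.f = (β_ A M.1).inv :=
      (cancel_epi (β_ A M.1).hom).1 ((congrArg (fun x => x.f)
        (β_ ((iotaPlus C).obj A) M).hom_inv_id).trans (β_ A M.1).hom_inv_id.symm)
    have h1 : (tensorAlgebra (iotaPlusAlgebra A) m).mul.f = (α_ A M.1 (A ⊗ M.1)).hom ≫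
        A ◁ ((α_ M.1 A M.1).inv ≫ (β_ A M.1).inv ▷ M.1 ≫ (α_ A M.1 M.1).hom) ≫
          (α_ A A (M.1 ⊗ M.1)).inv ≫ (μ[A] ⊗ₘ m.mul.f) := by
      rw [tensorAlgebra_mul]
      change (α_ A M.1 (A ⊗ M.1)).hom ≫ A ◁ ((α_ M ((iotaPlus C).obj A) M).inv.f ≫
        (β_ ((iotaPlus C).obj A) M).inv.f ▷ M.1 ≫ (α_ A M.1 M.1).hom) ≫
        (α_ ((iotaPlus C).obj A) ((iotaPlus C).obj A) (M ⊗ M)).inv.f ≫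
          ((𝟙 (A ⊗ A) ≫ μ[A]) ⊗ₘ m.mul.f) = _
      rw [Center.associator_inv_f, Center.associator_inv_f, hb]
      exact congrArg (fun x => (α_ A M.1 (A ⊗ M.1)).hom ≫
        A ◁ ((α_ M.1 A M.1).inv ≫ (β_ A M.1).inv ▷ M.1 ≫ (α_ A M.1 M.1).hom) ≫
          (α_ A A (M.1 ⊗ M.1)).inv ≫ (x ⊗ₘ m.mul.f)) (Category.id_comp μ[A])
    rw [h1]
    exact augmentation_mul hm.mul μ[A]

end

end

end CentreOfAlgebra

end

noncomputable section

namespace CentreOfAlgebra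

section

open scoped MonObj

variable {C : Type u} [Category.{v} C] [MonoidalCategory C]

section

variable {B A Y : C} {ζ : B ⟶ A} {p : B ⊗ B ⟶ B} {q : A ⊗ A ⟶ A} (hp : p ≫ ζ = (ζ ⊗ₘ ζ) ≫ q)
  (y : Y ⟶ B)

include hp

theorem whiskerRight_mul_comp : (y ▷ B ≫ p) ≫ ζ = Y ◁ ζ ≫ (y ≫ ζ) ▷ A ≫ q := by
  simp only [Category.assoc, hp, comp_whiskerRight, MonoidalCategory.tensorHom_def,
    whisker_exchange_assoc]

theorem whiskerLeft_mul_comp {b : Y ⊗ B ⟶ B ⊗ Y} {b' : Y ⊗ A ⟶ A ⊗ Y}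
    (hb : Y ◁ ζ ≫ b' = b ≫ ζ ▷ Y) :
    (b ≫ B ◁ y ≫ p) ≫ ζ = Y ◁ ζ ≫ b' ≫ A ◁ (y ≫ ζ) ≫ q := by
  rw [Category.assoc, Category.assoc, hp, reassoc_of% hb, MonoidalCategory.whiskerLeft_comp,
    MonoidalCategory.tensorHom_def, Category.assoc, Category.assoc, whisker_exchange_assoc]

end

variable {B : Center C} {m : MonObj B} {A : C} [MonObj A] {ζ : B.1 ⟶ A} (hζ : IsAlgHomToBase m ζ)
  {s : A ⟶ B.1} (hs : s ≫ ζ = 𝟙 A)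
  (hB : ∀ W : Center C, Function.Bijective (fun f : W ⟶ B => f.f ≫ ζ))

include hζ hs hB

/-- For an algebra `B` in the centre that is cofree on `A`, a morphism to `B` is left central
if and only if the corresponding morphism to `A` is central. -/
theorem isLeftCentral_iff_isCentral {Y : Center C} (y : Y ⟶ B) :
    IsLeftCentral m y ↔ IsCentral A Y (y.f ≫ ζ) := by
  have h1 : (y ▷ B ≫ m.mul).f ≫ ζ = Y.1 ◁ ζ ≫ (y.f ≫ ζ) ▷ A ≫ μ[A] :=
    whiskerRight_mul_comp hζ.mul y.f
  have h2 : ((β_ Y B).hom ≫ B ◁ y ≫ m.mul).f ≫ ζ =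
      Y.1 ◁ ζ ≫ (Y.2.β A).hom ≫ A ◁ (y.f ≫ ζ) ≫ μ[A] :=
    whiskerLeft_mul_comp hζ.mul y.f (Y.2.naturality ζ)
  have h3 : Y.1 ◁ s ≫ Y.1 ◁ ζ = 𝟙 _ := by
    rw [← MonoidalCategory.whiskerLeft_comp, hs, MonoidalCategory.whiskerLeft_id]
  constructor
  · intro h
    have h4 := h1.symm.trans ((congrArg (fun f => f.f ≫ ζ) h).trans h2)
    have h5 := congrArg (Y.1 ◁ s ≫ ·) h4
    rw [IsCentral]
    simpa only [reassoc_of% h3] using h5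
  · intro h
    refine (hB _).1 (h1.trans (Eq.trans ?_ h2.symm))
    exact congrArg (Y.1 ◁ ζ ≫ ·) h

/-- The left centre of an algebra in the centre that is cofree on `A` is the full centre of `A`. -/
theorem IsLeftCentre.isFullCentre {L : Center C} {l : L ⟶ B} (h : IsLeftCentre m L l) :
    IsFullCentre A L (l.f ≫ ζ) where
  central := (isLeftCentral_iff_isCentral hζ hs hB l).1 h.central
  terminal W ω hω := by
    obtain ⟨y, rfl⟩ := (hB W).2 ω
    obtain ⟨f, hf, hf'⟩ := h.terminal W y ((isLeftCentral_iff_isCentral hζ hs hB y).2 hω)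
    refine ⟨f, ?_, fun g hg => hf' g ((hB W).1 ?_)⟩
    · change f.f ≫ l.f ≫ ζ = y.f ≫ ζ
      rw [← hf]
      exact (Category.assoc _ _ _).symm
    · exact (Category.assoc _ _ _).trans hg

omit hs hB in
theorem IsAlgHomToBase.of_isAlgHom {L : Center C} {n : MonObj L} {l : L ⟶ B}
    (h : IsAlgHom n m l) : IsAlgHomToBase n (l.f ≫ ζ) where
  one := (Category.assoc _ _ _).symm.trans ((congrArg (fun f => f.f ≫ ζ) h.one).trans hζ.one)
  mul := by
    have h1 : n.mul.f ≫ l.f = (l.f ⊗ₘ l.f) ≫ m.mul.f := congrArg (fun f => f.f) h.mul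
    rw [← MonoidalCategory.tensorHom_comp_tensorHom, Category.assoc]
    exact (Category.assoc _ _ _).symm.trans ((congrArg (· ≫ ζ) h1).trans
      ((Category.assoc _ _ _).trans (congrArg (_ ≫ ·) hζ.mul)))

end

/-! ### The underlying functor of `C ⊠ C ⥤ Z(C)` -/

section

variable {k : Type w} [Field k] {C : Type u} [Category.{v} C] [Preadditive C] [Linear k C]
  [MonoidalCategory C] [MonoidalPreadditive C] [MonoidalLinear k C]

instance [∀ X Y : C, Module.Finite k (X ⟶ Y)] (X Y : Center C) : Module.Finite k (X ⟶ Y) :=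
  Module.Finite.of_injective
    ({ toFun := fun f => f.f, map_add' := fun _ _ => rfl, map_smul' := fun _ _ => rfl } :
      (X ⟶ Y) →ₗ[k] (X.1 ⟶ Y.1)) (CenterLinear.f_injective X Y)

instance : (Center.forget C).Additive where
  map_add := rfl

variable [BraidedCategory C] [HasFiniteBiproducts C] [IsIdempotentComplete C]

theorem iotaPair_forget_map {X Y : LinProd k C} (z : X ⟶ Y) :
    (Center.forget C).map ((LinProd.lift (iotaPair C) (iotaPair_isBilinear k C)).map z) =
      (linProdTensor k C).map z := by
  induction z using LinProd.hom_induction with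
  | h0 => rw [Functor.map_zero, Functor.map_zero, Functor.map_zero]; rfl
  | ha a b ha hb =>
    rw [Functor.map_add, Functor.map_add]
    refine Eq.trans ?_ (linProdTensor k C).map_add.symm
    exact congrArg₂ (· + ·) ha hb
  | ht f g =>
    exact (congrArg (fun x : _ ⟶ _ => Center.Hom.f x) 
      (LinProd.lift_map_tmul (iotaPair C) (iotaPair_isBilinear k C) f g)).trans
      (LinProd.lift_map_tmul (curriedTensor C) (curriedTensor_isBilinear k C) f g).symm

variable (k C) in
/-- The underlying object of the image of `X ⊠ Y` in the centre is `X ⊗ Y`. -/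
def centerFunctorForgetIso :
    toEnvelope (LinProd k C) ⋙ centerFunctor k C ⋙ Center.forget C ≅ linProdTensor k C :=
  Functor.isoWhiskerRight
    (toEnvelopeExtendIso (LinProd.lift (iotaPair C) (iotaPair_isBilinear k C)))
    (Center.forget C) ≪≫
  NatIso.ofComponents (fun _ => Iso.refl _) (fun z => by
    exact (Category.comp_id _).trans ((iotaPair_forget_map z).trans (Category.id_comp _).symm))

theorem centerFunctorForgetIso_hom_app (X Y : C) :
    (centerFunctorForgetIso k C).hom.app ⟨X, Y⟩ = (centerFunctorBoxIso k X Y).hom.f :=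
  Category.comp_id _

end

section

variable {k : Type w} [Field k] {C : Type u} [Category.{v} C] [Abelian C] [Linear k C]
  [MonoidalCategory C] [MonoidalPreadditive C] [MonoidalLinear k C] [RightRigidCategory C]

variable (k) in
/-- The isomorphism `A ⊠ B ≅ (𝟙 ⊗ A) ⊠ B`. -/
def boxUnitIso (A B : C) : boxObj k A B ≅ boxObj k (𝟙_ C ⊗ A) B where
  hom := boxMor (LinProd.tmul (λ_ A).inv (𝟙 B))
  inv := boxMor (LinProd.tmul (λ_ A).hom (𝟙 B))
  hom_inv_id := by
    rw [boxMor_comp, LinProd.tmul_comp_tmul, Iso.inv_hom_id, Category.comp_id, ← boxMor_id]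
    rfl
  inv_hom_id := by
    rw [boxMor_comp, LinProd.tmul_comp_tmul, Iso.hom_inv_id, Category.comp_id, ← boxMor_id]
    rfl

theorem boxUnitIso_naturality {A A' B B' : C} (g : A ⟶ A') (f : B ⟶ B') :
    boxMor (LinProd.tmul g f) ≫ (boxUnitIso k A' B').hom =
      (boxUnitIso k A B).hom ≫ boxMor (LinProd.tmul (𝟙_ C ◁ g) f) := by
  change boxMor _ ≫ boxMor _ = boxMor _ ≫ boxMor _
  rw [boxMor_comp, boxMor_comp, LinProd.tmul_comp_tmul, LinProd.tmul_comp_tmul, Category.comp_id,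
    Category.id_comp, leftUnitor_inv_naturality]

theorem boxUnitIso_inv_naturality {A A' B B' : C} (g : A ⟶ A') (f : B ⟶ B') :
    boxMor (LinProd.tmul (𝟙_ C ◁ g) f) ≫ (boxUnitIso k A' B').inv =
      (boxUnitIso k A B).inv ≫ boxMor (LinProd.tmul g f) := by
  rw [Iso.comp_inv_eq, Category.assoc, boxUnitIso_naturality, Iso.inv_hom_id_assoc]

/-- If `F` is left adjoint to the functor `R` of coends, then morphisms to the coend of
`Y^∨ ⊠ Y` are the same as morphisms to `𝟙` after applying `F`. -/
theorem TensorCoend.exists_cofree {R : C ⥤ DeligneProd k C} (d : TensorCoend R)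
    {F : DeligneProd k C ⥤ C} (b : toEnvelope (LinProd k C) ⋙ F ≅ linProdTensor k C) (adj : F ⊣ R)
    (hadj : ∀ X Y : C, F.map (d.π X Y) ≫ adj.counit.app X =
      b.hom.app ⟨X ⊗ Yᘁ, Y⟩ ≫ (α_ X Yᘁ Y).hom ≫ (X ◁ ε_ Y Yᘁ) ≫ (ρ_ X).hom)
    (c : Cowedge (dualBox k C)) (hc : IsColimit c) :
    ∃ e : F.obj c.pt ⟶ 𝟙_ C, (∀ Y : C, F.map (c.π Y) ≫ e = b.hom.app ⟨Yᘁ, Y⟩ ≫ ε_ Y Yᘁ) ∧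
      (∀ e' : F.obj c.pt ⟶ 𝟙_ C,
        (∀ Y : C, F.map (c.π Y) ≫ e' = b.hom.app ⟨Yᘁ, Y⟩ ≫ ε_ Y Yᘁ) → e' = e) ∧
      ∀ Z, Function.Bijective (fun f : Z ⟶ c.pt => F.map f ≫ e) := by
  let π : ∀ Y : C, boxObj k Yᘁ Y ⟶ c.pt := fun Y => c.π Y
  have hπ : ∀ {Y Y' : C} (f : Y ⟶ Y'), boxMor (LinProd.tmul (fᘁ) (𝟙 Y)) ≫ π Y =
      boxMor (LinProd.tmul (𝟙 Y'ᘁ) f) ≫ π Y' := fun f => Cowedge.condition c f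
  have hd0 : ∀ {Y Y' : C} (f : Y ⟶ Y'), boxMor (LinProd.tmul (fᘁ) (𝟙 Y)) ≫
      (boxUnitIso k Yᘁ Y).hom ≫ d.π (𝟙_ C) Y = boxMor (LinProd.tmul (𝟙 Y'ᘁ) f) ≫
        (boxUnitIso k Y'ᘁ Y').hom ≫ d.π (𝟙_ C) Y' := fun {Y Y'} f => by
    rw [← Category.assoc, ← Category.assoc, boxUnitIso_naturality, boxUnitIso_naturality,
      Category.assoc, Category.assoc, d.dinatural, MonoidalCategory.whiskerLeft_id]
  let d' : Cowedge (dualBox k C) := Cowedge.mk (F := dualBox k C) (R.obj (𝟙_ C))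
    (fun Y => (boxUnitIso k Yᘁ Y).hom ≫ d.π (𝟙_ C) Y) (fun Y Y' f => hd0 f)
  let δ : c.pt ⟶ R.obj (𝟙_ C) := hc.desc d'
  obtain ⟨κ', hκ'⟩ := d.exists_desc (𝟙_ C) (fun Y => (boxUnitIso k Yᘁ Y).inv ≫ π Y)
    (fun {Y Y'} f => by
      rw [← MonoidalCategory.whiskerLeft_id, ← Category.assoc, ← Category.assoc,
        boxUnitIso_inv_naturality, boxUnitIso_inv_naturality, Category.assoc, Category.assoc, hπ])
  have hd : ∀ Y, π Y ≫ δ = (boxUnitIso k Yᘁ Y).hom ≫ d.π (𝟙_ C) Y :=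
    fun Y => hc.fac d' (WalkingMultispan.right Y)
  have h1 : ∀ Y, π Y ≫ δ ≫ κ' = π Y ≫ 𝟙 c.pt := fun Y => by
    rw [← Category.assoc, hd, Category.assoc, hκ', Iso.hom_inv_id_assoc, Category.comp_id]
  let κ : c.pt ≅ R.obj (𝟙_ C) :=
    { hom := δ
      inv := κ'
      hom_inv_id := Cowedge.IsColimit.hom_ext hc h1
      inv_hom_id := d.hom_ext fun Y => by
        rw [← Category.assoc, hκ', Category.assoc]
        refine (congrArg _ (hd Y)).trans ?_
        rw [Iso.inv_hom_id_assoc, Category.comp_id] }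
  have hb : ∀ {A B A' B' : C} (f : A ⟶ A') (g : B ⟶ B'),
      F.map (boxMor (LinProd.tmul f g)) ≫ b.hom.app ⟨A', B'⟩ =
        b.hom.app ⟨A, B⟩ ≫ (f ⊗ₘ g) := fun f g =>
    (b.hom.naturality _).trans (congrArg (b.hom.app _ ≫ ·) (linProdTensor_map_tmul f g))
  have he : ∀ Y : C, F.map (π Y) ≫ F.map κ.hom ≫ adj.counit.app (𝟙_ C) =
      b.hom.app ⟨Yᘁ, Y⟩ ≫ ε_ Y Yᘁ := fun Y => by
    have h2 : ((λ_ Yᘁ).inv ⊗ₘ 𝟙 Y) ≫ (α_ (𝟙_ C) Yᘁ Y).hom ≫ (𝟙_ C ◁ ε_ Y Yᘁ) ≫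
        (ρ_ (𝟙_ C)).hom = ε_ Y Yᘁ := by
      rw [← unitors_equal, MonoidalCategory.tensorHom_id]
      simp
    have h3 : F.map (π Y) ≫ F.map κ.hom = F.map (boxUnitIso k Yᘁ Y).hom ≫ F.map (d.π (𝟙_ C) Y) := by
      rw [← F.map_comp, ← F.map_comp]
      exact congrArg F.map (hd Y)
    rw [← Category.assoc, h3, Category.assoc, hadj]
    refine (Category.assoc _ _ _).symm.trans
      ((congrArg (· ≫ _) (hb (λ_ Yᘁ).inv (𝟙 Y))).trans ((Category.assoc _ _ _).trans ?_))
    exact congrArg (b.hom.app _ ≫ ·) h2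
  refine ⟨F.map κ.hom ≫ adj.counit.app (𝟙_ C), he, fun e' he' => ?_, fun Z => ?_⟩
  · apply (adj.homEquiv c.pt (𝟙_ C)).injective
    have h2 : ∀ Y : C, π Y ≫ adj.homEquiv c.pt (𝟙_ C) e' =
        π Y ≫ adj.homEquiv c.pt (𝟙_ C) (F.map κ.hom ≫ adj.counit.app (𝟙_ C)) := fun Y => by
      rw [← adj.homEquiv_naturality_left, ← adj.homEquiv_naturality_left, he]
      exact congrArg _ (he' Y)
    exact Cowedge.IsColimit.hom_ext hc h2
  · have h : (fun f : Z ⟶ c.pt => F.map f ≫ F.map κ.hom ≫ adj.counit.app (𝟙_ C)) =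
        fun f => (adj.homEquiv Z (𝟙_ C)).symm (f ≫ κ.hom) := funext fun f => by
      rw [adj.homEquiv_counit, F.map_comp, Category.assoc]
    rw [h]
    exact (adj.homEquiv Z (𝟙_ C)).symm.bijective.comp (κ.homToEquiv (Z := Z)).bijective

end

end CentreOfAlgebra

end

noncomputable section

namespace CentreOfAlgebra

/-! ### The centre of a modular category -/

/-- The property of `e` of being cofree may be checked on the objects of an equivalent category. -/
theorem bijective_map_comp_of_isEquivalence {D E E' : Type*} [Category* D] [Category* E]
    [Category* E'] (G : D ⥤ E) [G.IsEquivalence] (U : E ⥤ E') {P : D} {I : E'}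
    (e : U.obj (G.obj P) ⟶ I)
    (h : ∀ Z, Function.Bijective (fun f : Z ⟶ P => (G ⋙ U).map f ≫ e)) (W : E) :
    Function.Bijective (fun f : W ⟶ G.obj P => U.map f ≫ e) := by
  let a := G.objObjPreimageIso W
  have ha : ∀ (x : G.objPreimage W ⟶ P) (f : W ⟶ G.obj P), G.map x = a.hom ≫ f →
      U.map f ≫ e = U.map a.inv ≫ (G ⋙ U).map x ≫ e := fun x f hx => by
    rw [Functor.comp_map, hx, ← U.map_comp_assoc, Iso.inv_hom_id_assoc]
  constructor
  · intro f f' hf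
    have h1 := ha (G.preimage (a.hom ≫ f)) f (G.map_preimage _)
    have h2 := ha (G.preimage (a.hom ≫ f')) f' (G.map_preimage _)
    have h3 : G.preimage (a.hom ≫ f) = G.preimage (a.hom ≫ f') := (h _).1 <| by
      rw [← cancel_epi (U.map a.inv)]
      exact h1.symm.trans (hf.trans h2)
    have h4 := congrArg G.map h3
    rwa [G.map_preimage, G.map_preimage, cancel_epi] at h4
  · intro y
    obtain ⟨x, hx⟩ := (h _).2 (U.map a.hom ≫ y)
    refine ⟨a.inv ≫ G.map x, (ha x _ (a.hom_inv_id_assoc _).symm).trans ?_⟩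
    refine (congrArg (U.map a.inv ≫ ·) hx).trans ?_
    change U.map a.inv ≫ U.map a.hom ≫ y = y
    rw [← U.map_comp_assoc, Iso.inv_hom_id, U.map_id, Category.id_comp]

section

variable {k : Type w} [Field k] {C : Type u} [Category.{v} C] [Abelian C] [Linear k C]
  [∀ X Y : C, Module.Finite k (X ⟶ Y)] [MonoidalCategory C] [MonoidalPreadditive C]
  [MonoidalLinear k C] [BraidedCategory C]

/-- If `C ⊠ C ⥤ Z(C)` is an equivalence, the trace of the underlying morphism in `C` is a
nondegenerate trace on the centre. -/
def MultiplicativeTrace.center (τ : MultiplicativeTrace k C) [(centerFunctor k C).IsEquivalence] :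
    SemisimpleTrace k (Center C) where
  tr {X} := τ.tr ∘ₗ
    { toFun := fun f => f.f
      map_add' := fun _ _ => rfl
      map_smul' := fun _ _ => rfl }
  cyc f g := τ.cyc f.f g.f
  nondeg {X Y} f hf := by
    have hcyc : ∀ {X Y : Center C} (f : X ⟶ Y) (g : Y ⟶ X), τ.tr (f ≫ g).f = τ.tr (g ≫ f).f :=
      fun f g => τ.cyc f.f g.f
    let G := centerFunctor k C
    let a := G.objObjPreimageIso X
    let b := G.objObjPreimageIso Y
    have h : G.preimage (a.hom ≫ f ≫ b.inv) = 0 :=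
      τ.eq_zero_of_tr_map (G ⋙ Center.forget C) (centerFunctorForgetIso k C) _ fun g => by
        refine Eq.trans ?_ (hf (b.inv ≫ G.map g ≫ a.hom))
        change τ.tr (G.map _).f = τ.tr (f ≫ _).f
        rw [G.map_comp, G.map_preimage, Category.assoc, hcyc]
        simp only [Category.assoc]
    have h' : a.hom ≫ f ≫ b.inv = 0 := by
      rw [← G.map_preimage (a.hom ≫ f ≫ b.inv), h, G.map_zero]
    rwa [Preadditive.IsIso.comp_left_eq_zero, Preadditive.IsIso.comp_right_eq_zero] at h'
  nil {X} f hf := by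
    refine τ.nil (X := X.1) ((Center.forget C).map f) ?_
    obtain ⟨n, hn⟩ := hf
    exact ⟨n, (map_pow ((Center.forget C).mapEnd X) f n).symm.trans
      ((congrArg _ hn).trans ((Center.forget C).map_zero X X))⟩

end

section

variable {k : Type w} [Field k] {C : Type u} [Category.{v} C] [Abelian C] [Linear k C]
  [∀ X Y : C, Module.Finite k (X ⟶ Y)] [MonoidalCategory C] [MonoidalPreadditive C]
  [MonoidalLinear k C] [RightRigidCategory C]

instance : (tensorFunctor k C).Additive :=
  inferInstanceAs (extend _).Additive

instance [BraidedCategory C] : (centerFunctor k C).Additive :=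
  inferInstanceAs (extend _).Additive

theorem nonempty_isColimit_mulCowedge_of_isPure (h : IsPureRibbon C k ∨ IsPureSpherical C k)
    {c : Cowedge (dualBox k C)} (hc : IsColimit c) (X : C) :
    Nonempty (IsColimit (mulCowedge k X c)) := by
  obtain ⟨X', ⟨_⟩⟩ := exists_exactPairing h X
  exact nonempty_isColimit_mulCowedge (boxUnitMulAdjunction k X' X) c hc

/-- In a modular category, the image of the coend of `Y^∨ ⊠ Y` in the centre is cofree on `𝟙`: it
is the value at `𝟙` of the right adjoint of the forgetful functor `Z(C) ⥤ C`, which becomes the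
tensor product functor on `C ⊠ C`. -/
theorem IsModular.exists_isEvaluation [BraidedCategory C] (h : IsModular k C)
    {c : Cowedge (dualBox k C)} (hc : IsColimit c) :
    ∃ ε : ((centerFunctor k C).obj c.pt).1 ⟶ 𝟙_ C, IsEvaluation k c ε ∧
      (∀ ε', IsEvaluation k c ε' → ε' = ε) ∧
      ∀ W, Function.Bijective (fun f : W ⟶ (centerFunctor k C).obj c.pt => f.f ≫ ε) := by
  have hp : IsPureRibbon C k ∨ IsPureSpherical C k := Or.inl h.isPureRibbon
  have := h.nondegenerate
  obtain ⟨τ⟩ := nonempty_multiplicativeTrace hp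
  let d := tensorCoendMulFunctor c fun X => (nonempty_isColimit_mulCowedge_of_isPure hp hc X).some
  obtain ⟨adj, hadj⟩ := d.exists_adjunction τ (centerFunctor k C ⋙ Center.forget C)
    (centerFunctorForgetIso k C)
  obtain ⟨e, he, huniq, hbij⟩ := d.exists_cofree (centerFunctorForgetIso k C) adj hadj c hc
  have hev : ∀ ε : ((centerFunctor k C).obj c.pt).1 ⟶ 𝟙_ C, IsEvaluation k c ε ↔
      ∀ Y : C, (centerFunctor k C ⋙ Center.forget C).map (c.π Y) ≫ ε =
        (centerFunctorForgetIso k C).hom.app ⟨Yᘁ, Y⟩ ≫ ε_ Y Yᘁ := fun ε =>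
    forall_congr' fun Y => by rw [centerFunctorForgetIso_hom_app]; rfl
  refine ⟨e, (hev e).2 he, fun e' he' => huniq e' ((hev e').1 he'), fun W => ?_⟩
  exact bijective_map_comp_of_isEquivalence (centerFunctor k C) (Center.forget C) e hbij W

/-- The algebra `ι₊(A) ⊗ R̃` is cofree on `A`, so its left centre is the full centre of `A`. -/
theorem isFullCentre_and_exists_monObj [BraidedCategory C] {M : Center C} {ε : M.1 ⟶ 𝟙_ C}
    (hε : ∀ W : Center C, Function.Bijective (fun f : W ⟶ M => f.f ≫ ε)) {m : MonObj M}
    (hm : IsAlgHomToBase m ε) (A : C) [MonObj A] {L : Center C} {l : L ⟶ (iotaPlus C).obj A ⊗ M}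
    (h : IsLeftCentre (tensorAlgebra (iotaPlusAlgebra A) m) L l) :
    IsFullCentre A L (l.f ≫ (A ◁ ε) ≫ (ρ_ A).hom) ∧
      ∃ n : MonObj L, IsCommAlg n ∧ IsAlgHom n (tensorAlgebra (iotaPlusAlgebra A) m) l ∧
        IsAlgHomToBase n (l.f ≫ (A ◁ ε) ≫ (ρ_ A).hom) := by
  have hA := isAlgHomToBase_tensorAlgebra hm A
  have hu : m.one.f ≫ ε = 𝟙 (𝟙_ C) := hm.one
  have hs : ((ρ_ A).inv ≫ A ◁ m.one.f) ≫ (A ◁ ε) ≫ (ρ_ A).hom = 𝟙 A := augmentation_section hu A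
  obtain ⟨n, h1, h2⟩ := h.exists_monObj
  exact ⟨IsLeftCentre.isFullCentre hA hs (bijective_comp_whiskerLeft hε A Aᘁ) h, n, h1, h2,
    IsAlgHomToBase.of_isAlgHom hA h2⟩

end

end CentreOfAlgebra

end


theorem mainTheorem11 (k : Type w) [Field k] (C : Type u) [Category.{v} C] [Abelian C]
    [Linear k C] [∀ X Y : C, Module.Finite k (X ⟶ Y)] [MonoidalCategory C]
    [MonoidalPreadditive C] [MonoidalLinear k C] [RightRigidCategory C] :
    (IsPureRibbon C k ∨ IsPureSpherical C k →
      (HasFinitelyManySimples C →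
        ∃ c : Cowedge (dualBox k C), Nonempty (IsColimit c)) ∧
      ∀ c : Cowedge (dualBox k C), Nonempty (IsColimit c) →
        (∀ X : C, Nonempty (IsColimit (mulCowedge k X c))) ∧
        ∃ adj : tensorFunctor k C ⊣ mulFunctor k c.pt, ∀ X Y : C,
          (tensorFunctor k C).map ((mulCowedge k X c).π Y) ≫ adj.counit.app X =
            (tensorFunctorBoxIso k (X ⊗ Yᘁ) Y).hom ≫
              (α_ X Yᘁ Y).hom ≫ (X ◁ ε_ Y Yᘁ) ≫ (ρ_ X).hom) ∧
    (∀ [BraidedCategory C], IsModular k C →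
      (∃ c : Cowedge (dualBox k C), Nonempty (IsColimit c)) ∧
      ∀ c : Cowedge (dualBox k C), Nonempty (IsColimit c) →
        (∃! ε : ((centerFunctor k C).obj c.pt).1 ⟶ 𝟙_ C, IsEvaluation k c ε) ∧
        ∀ ε : ((centerFunctor k C).obj c.pt).1 ⟶ 𝟙_ C, IsEvaluation k c ε →
          (∃! m : MonObj ((centerFunctor k C).obj c.pt), IsAlgHomToBase m ε) ∧
          ∀ m : MonObj ((centerFunctor k C).obj c.pt), IsAlgHomToBase m ε →
            ∀ (A : C) [MonObj A],
              (∃ L l, IsLeftCentre (tensorAlgebra (iotaPlusAlgebra A) m) L l) ∧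
              ∀ (L : Center C) (l : L ⟶ (iotaPlus C).obj A ⊗ (centerFunctor k C).obj c.pt),
                IsLeftCentre (tensorAlgebra (iotaPlusAlgebra A) m) L l →
                  IsFullCentre A L (l.f ≫ (A ◁ ε) ≫ (ρ_ A).hom) ∧
                  ∃ n : MonObj L, IsCommAlg n ∧
                    IsAlgHom n (tensorAlgebra (iotaPlusAlgebra A) m) l ∧
                    IsAlgHomToBase n (l.f ≫ (A ◁ ε) ≫ (ρ_ A).hom)) := by
  refine ⟨fun h => ?_, fun {_} h => ?_⟩
  · obtain ⟨τ⟩ := nonempty_multiplicativeTrace h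
    refine ⟨τ.exists_coend, fun c ⟨hc⟩ => ?_⟩
    have hcX := nonempty_isColimit_mulCowedge_of_isPure h hc
    exact ⟨hcX, (tensorCoendMulFunctor c fun X => (hcX X).some).exists_adjunction τ
      (tensorFunctor k C)
      (toEnvelopeExtendIso (LinProd.lift (curriedTensor C) (curriedTensor_isBilinear k C)))⟩
  · have := h.nondegenerate
    obtain ⟨τ⟩ := nonempty_multiplicativeTrace (Or.inl h.isPureRibbon)
    refine ⟨τ.exists_coend h.finite, fun c ⟨hc⟩ => ?_⟩
    obtain ⟨ε₀, hε₀, huniq, hbij⟩ := h.exists_isEvaluation hc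
    refine ⟨⟨ε₀, hε₀, huniq⟩, fun ε hε => ?_⟩
    obtain rfl := huniq ε hε
    exact ⟨existsUnique_monObj hbij, fun m hm A _ => ⟨exists_isLeftCentre τ.center _,
      fun L l hl => isFullCentre_and_exists_monObj hbij hm A hl⟩⟩
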